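/- **Setting.** Let $\mathbb K$ be an algebraically closed field of characteristic $0$, let $A=(A_{ij})_{i,j\in I}$ ($I$ finite) be an invertible symmetrisable generalised Cartan matrix, and let $\mathfrak g$ be the Kac–Moody algebra of $A$, with Chevalley generators $e_i,f_i,h_i$, $i\in I$. Let $\varepsilon_i\in\mathbb K\setminus\{0\}$ be such that $D^{-1}A$ is symmetric for $D=\operatorname{diag}(\varepsilon_i)$, and let $\kappa$ be the invariant symmetric bilinear form on $\mathfrak g$ with $\kappa(e_i,f_j)=\delta_{ij}\varepsilon_j$. It induces a form $(\cdot,\cdot)$ on the weights, via the isomorphism $\varphi$ from the Cartan subalgebra to its dual with $\varphi(h_i)(h_j)=\kappa(h_i,h_j)$. For a weight $\mu$ with Dynkin labels $\mu_i=\mu(h_i)$, let $\mu^\blacktriangle$ and $\mu^\blacktriangledown$ be the weights with Dynkin labels $\mu_i/\varepsilon_i$ and $\varepsilon_i\mu_i$, respectively. A weight $\mu$ is called pseudo-minuscule if it is dominant integral (all $\mu_i\in\mathbb Z_{\ge0}$) and $(\mu^\blacktriangledown,\alpha)\in\{0,1\}$ for every positive root $\alpha$ of $\mathfrak g$. Let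 $\lambda$ be a dominant integral weight, and $J=\{j\in I:\lambda_j\neq0\}$. Let $B$ be the matrix with rows and columns indexed by $\{0\}\cup I$ and entries $B_{00}=0$, $B_{i0}=-\lambda_i$, $B_{0j}=-\lambda_j/\varepsilon_j$, $B_{ij}=A_{ij}$ ($i,j\in I$), and assume that $B$ is invertible. Let $\mathcal B$ be the contragredient Lie superalgebra of $B$: it is generated by $e_i,f_i,h_i$ ($i\in\{0\}\cup I$), where $e_0,f_0$ are odd and the other generators are even, with relations $[h_i,e_j]=B_{ij}e_j$, $[h_i,f_j]=-B_{ij}f_j$, $[e_i,f_j]=\delta_{ij}h_j$, modulo the maximal ideal that is graded with respect to the grading $\deg e_i=1=-\deg f_i$, $\deg h_i=0$, and meets the local part (degrees $-1,0,1$) trivially. In the consistent $\mathbb Z$-grading $\mathcal B=\bigoplus_k\mathcal B_k$, $e_0$ has degree $1$, $f_0$ has degree $-1$, and all other generators have degree $0$. Let $L=\sum_{i}(B^{-1})_{0i}h_i\in\mathcal B_0$, so that $[L,x]=kx$ for $x\in\mathcal B_k$. Let $\langle\cdot|\cdot\rangle$ be the invariant pairing of $\mathcal B_{\pm1}$ with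 $\mathcal B_{\mp1}$ with $\langle x|y\rangle=-\langle y|x\rangle$ and $\langle e_0|f_0\rangle=-\langle f_0|e_0\rangle=1$. Brackets in $\mathcal B$ are written $\llbracket\cdot,\cdot\rrbracket$. **Cartanification.** Let $U=U(\mathcal B_0)$ be the universal enveloping algebra, and let $G_{\pm1}=\mathcal B_{\pm1}U=U\mathcal B_{\pm1}$ be the $U$-bimodules that are equal to $\mathcal B_{\pm1}\otimes U$ as right modules, with $zx=xz+\llbracket z,x\rrbracket$ for $z\in\mathcal B_0$, $x\in\mathcal B_{\pm1}$. For $x\in\mathcal B_{-1}$ and $y\in\mathcal B_1$ set $$xy=-\llbracket x,y\rrbracket+\langle x|y\rangle L,\qquad yx=\llbracket y,x\rrbracket+\langle y|x\rangle L+\langle y|x\rangle$$ in $U$, and extend these to products $G_{\pm1}\times G_{\mp1}\to U$ by $(ux)(yv)=u(xy)v$ for $u,v\in U$, $x\in\mathcal B_{\pm1}$, $y\in\mathcal B_{\mp1}$. With the graded commutator $ab-(-1)^{kl}ba$ ($a$ of degree $k$, $b$ of degree $l$) as bracket, $G_{-1}\oplus U\oplus G_1$ is a local Lie superalgebra. The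 local cartanification of $\mathcal B$ is its subalgebra generated by $\mathcal B_{-1}\mathcal B_0$ and $\mathcal B_1$, modulo the maximal graded ideal of this subalgebra that meets the component of degree $0$ trivially. The cartanification $\mathcal B^W$ is the minimal $\mathbb Z$-graded Lie superalgebra with this local part, that is, the maximal one modulo its maximal graded ideal that meets the local part trivially. For $x\in\mathcal B_{-1}$ and $z\in\mathcal B_0$, the product $xz\in\mathcal B_{-1}\mathcal B_0$ is also regarded as an element of $\mathcal B^W$. **Proposition.** If $\lambda^\blacktriangle$ is pseudo-minuscule and $\lambda=\lambda^\blacktriangle$, then $$f_0f_j-\llbracket f_0,f_j\rrbracket\,h_j=0\quad\text{in }\mathcal B^W\qquad\text{for every } j\in J .$$ -/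

import Mathlib

open scoped TensorProduct

noncomputable section

namespace Cartanif

/-! ### Nonassociative algebras given by a bilinear product -/

section Bilinear

variable {𝕂 : Type*} [Field 𝕂] {V : Type*} [AddCommGroup V] [Module 𝕂 V]

/-- A subspace `N` is a two-sided ideal for the bilinear product `μ`. -/
structure IsIdealFor (μ : V →ₗ[𝕂] V →ₗ[𝕂] V) (N : Submodule 𝕂 V) : Prop where
  left : ∀ x, ∀ n ∈ N, μ x n ∈ N
  right : ∀ n ∈ N, ∀ x, μ n x ∈ N

/-- A subspace `N` is graded with respect to the family of subspaces `gr`: it is spanned by its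
homogeneous elements. -/
def IsGradedFor (gr : ℤ → Submodule 𝕂 V) (N : Submodule 𝕂 V) : Prop :=
  N ≤ ⨆ k, N ⊓ gr k

lemma isIdealFor_sSup (μ : V →ₗ[𝕂] V →ₗ[𝕂] V) (s : Set (Submodule 𝕂 V))
    (hs : ∀ N ∈ s, IsIdealFor μ N) : IsIdealFor μ (sSup s) := by
  constructor
  · intro x
    have : sSup s ≤ (sSup s).comap (μ x) :=
      sSup_le fun N hN n hn => (le_sSup hN : N ≤ sSup s) ((hs N hN).left x n hn)
    exact fun n hn => this hn
  · intro n hn x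
    have : sSup s ≤ (sSup s).comap (μ.flip x) :=
      sSup_le fun N hN n hn => (le_sSup hN : N ≤ sSup s) ((hs N hN).right n hn x)
    exact this hn

lemma isIdealFor_sInf (μ : V →ₗ[𝕂] V →ₗ[𝕂] V) (s : Set (Submodule 𝕂 V))
    (hs : ∀ N ∈ s, IsIdealFor μ N) : IsIdealFor μ (sInf s) := by
  constructor
  · intro x n hn
    rw [Submodule.mem_sInf] at hn ⊢
    exact fun N hN => (hs N hN).left x n (hn N hN)
  · intro n hn x
    rw [Submodule.mem_sInf] at hn ⊢
    exact fun N hN => (hs N hN).right n (hn N hN) x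

lemma isIdealFor_sup (μ : V →ₗ[𝕂] V →ₗ[𝕂] V) {M N : Submodule 𝕂 V}
    (hM : IsIdealFor μ M) (hN : IsIdealFor μ N) : IsIdealFor μ (M ⊔ N) := by
  rw [← sSup_pair]
  refine isIdealFor_sSup μ _ ?_
  rintro P (rfl | rfl) <;> assumption

/-- The product induced on the quotient by an ideal. -/
def quotMul (μ : V →ₗ[𝕂] V →ₗ[𝕂] V) (N : Submodule 𝕂 V) (hN : IsIdealFor μ N) :
    (V ⧸ N) →ₗ[𝕂] (V ⧸ N) →ₗ[𝕂] (V ⧸ N) :=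
  N.liftQ
    { toFun := fun x => N.mapQ N (μ x) (fun n hn => hN.left x n hn)
      map_add' := fun x y => by ext z; simp
      map_smul' := fun c x => by ext z; simp }
    (fun n hn => by
      rw [LinearMap.mem_ker]
      ext z
      simpa using hN.right n hn z)

@[simp] lemma quotMul_mk (μ : V →ₗ[𝕂] V →ₗ[𝕂] V) (N : Submodule 𝕂 V) (hN : IsIdealFor μ N)
    (x y : V) : quotMul μ N hN (N.mkQ x) (N.mkQ y) = N.mkQ (μ x y) := rfl

/-- The product induced on a subspace that is closed under the product. -/
def subMul (μ : V →ₗ[𝕂] V →ₗ[𝕂] V) (S : Submodule 𝕂 V)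
    (hS : ∀ x ∈ S, ∀ y ∈ S, μ x y ∈ S) : S →ₗ[𝕂] S →ₗ[𝕂] S :=
  LinearMap.mk₂ 𝕂 (fun x y => ⟨μ x y, hS x x.2 y y.2⟩)
    (fun _ _ _ => by ext; simp) (fun _ _ _ => by ext; simp)
    (fun _ _ _ => by ext; simp) (fun _ _ _ => by ext; simp)

end Bilinear

/-! ### Graded Lie superalgebras given by generators and relations -/

section Presentation

variable (𝕂 : Type*) [Field 𝕂] {X : Type*}

/-- The free nonassociative algebra on `X`. -/
abbrev FreeNA (X : Type*) : Type _ := FreeNonUnitalNonAssocAlgebra 𝕂 X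

/-- The nonassociative monomials. -/
def mon (m : FreeMagma X) : FreeNA 𝕂 X := MonoidAlgebra.single m 1

/-- The degree of a nonassociative word, given the degrees of the letters. -/
def wordDeg (d : X → ℤ) : FreeMagma X → ℤ
  | .of x => d x
  | .mul a b => wordDeg d a + wordDeg d b

/-- The sign `(-1) ^ (m * n)`. -/
def ksgn (m n : ℤ) : 𝕂 := if Odd m ∧ Odd n then -1 else 1

/-- The subspace of elements of degree `n` of the free nonassociative algebra. -/
def freeGr (d : X → ℤ) (n : ℤ) : Submodule 𝕂 (FreeNA 𝕂 X) :=
  Submodule.span 𝕂 {x | ∃ m, wordDeg d m = n ∧ mon 𝕂 m = x}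

variable {𝕂}

/-- The smallest ideal of the free nonassociative algebra containing the relations `R`, and modulo
which the product is a Lie superbracket (graded antisymmetry and graded Jacobi identity), where
the parity of a word is its degree with respect to `p` modulo two. -/
def superIdeal (p : X → ℤ) (R : Set (FreeNA 𝕂 X)) : Submodule 𝕂 (FreeNA 𝕂 X) :=
  sInf {N | IsIdealFor (LinearMap.mul 𝕂 (FreeNA 𝕂 X)) N ∧
    (∀ a b, mon 𝕂 a * mon 𝕂 b + ksgn 𝕂 (wordDeg p a) (wordDeg p b) • (mon 𝕂 b * mon 𝕂 a) ∈ N) ∧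
    (∀ a b c, mon 𝕂 a * (mon 𝕂 b * mon 𝕂 c) - (mon 𝕂 a * mon 𝕂 b) * mon 𝕂 c
      - ksgn 𝕂 (wordDeg p a) (wordDeg p b) • (mon 𝕂 b * (mon 𝕂 a * mon 𝕂 c)) ∈ N) ∧
    R ⊆ N}

/-- The sum of `superIdeal p R` and of all the ideals that contain it, are graded with respect to
the degree `d`, and coincide with it in the degrees `-1`, `0` and `1`.  In other words, the preimage
in the free algebra of the maximal graded ideal that intersects trivially the local part of
the Lie superalgebra presented by `X` and `R`. -/
def minIdeal (p d : X → ℤ) (R : Set (FreeNA 𝕂 X)) : Submodule 𝕂 (FreeNA 𝕂 X) :=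
  superIdeal p R ⊔
    sSup {N | IsIdealFor (LinearMap.mul 𝕂 (FreeNA 𝕂 X)) N ∧ superIdeal p R ≤ N ∧
      IsGradedFor (freeGr 𝕂 d) N ∧
      ∀ k ∈ ({-1, 0, 1} : Set ℤ), N ⊓ freeGr 𝕂 d k ≤ superIdeal p R}

lemma isIdealFor_superIdeal (p : X → ℤ) (R : Set (FreeNA 𝕂 X)) :
    IsIdealFor (LinearMap.mul 𝕂 (FreeNA 𝕂 X)) (superIdeal p R) :=
  isIdealFor_sInf _ _ fun _ hN => hN.1

lemma isIdealFor_minIdeal (p d : X → ℤ) (R : Set (FreeNA 𝕂 X)) :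
    IsIdealFor (LinearMap.mul 𝕂 (FreeNA 𝕂 X)) (minIdeal p d R) :=
  isIdealFor_sup _ (isIdealFor_superIdeal p R) (isIdealFor_sSup _ _ fun _ hN => hN.1)

/-- The Lie superalgebra with generators `X` and relations `R`, modulo its maximal `d`-graded ideal
that intersects the local part (the degrees `-1`, `0`, `1` with respect to `d`) trivially.
The parity is given by the degree with respect to `p` modulo two. -/
def MinSuper (p d : X → ℤ) (R : Set (FreeNA 𝕂 X)) : Type _ := FreeNA 𝕂 X ⧸ minIdeal p d R

namespace MinSuper

variable {p d : X → ℤ} {R : Set (FreeNA 𝕂 X)}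

instance : AddCommGroup (MinSuper p d R) :=
  inferInstanceAs (AddCommGroup (FreeNA 𝕂 X ⧸ minIdeal p d R))

instance : Module 𝕂 (MinSuper p d R) :=
  inferInstanceAs (Module 𝕂 (FreeNA 𝕂 X ⧸ minIdeal p d R))

variable (p d R) in
/-- The quotient map from the free nonassociative algebra. -/
def mk : FreeNA 𝕂 X →ₗ[𝕂] MinSuper p d R := (minIdeal p d R).mkQ

variable (p d R) in
/-- The image of a generator. -/
def gen (x : X) : MinSuper p d R := mk p d R (mon 𝕂 (.of x))

/-- The Lie superbracket. -/
def br : MinSuper p d R →ₗ[𝕂] MinSuper p d R →ₗ[𝕂] MinSuper p d R :=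
  quotMul (LinearMap.mul 𝕂 (FreeNA 𝕂 X)) (minIdeal p d R) (isIdealFor_minIdeal p d R)

lemma br_mk (x y : FreeNA 𝕂 X) : br (mk p d R x) (mk p d R y) = mk p d R (x * y) := rfl

variable (p d R) in
/-- The component of degree `n` with respect to the `ℤ`-grading given by `p`. -/
def gr (n : ℤ) : Submodule 𝕂 (MinSuper p d R) := (freeGr 𝕂 p n).map (mk p d R)

lemma mk_eq_zero_of_mem {x : FreeNA 𝕂 X} (hx : x ∈ superIdeal p R) : mk p d R x = 0 :=
  (Submodule.Quotient.mk_eq_zero _).2 ((le_sup_left : superIdeal p R ≤ minIdeal p d R) hx)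

lemma mk_mon_mem (m : FreeMagma X) : mk p d R (mon 𝕂 m) ∈ gr p d R (wordDeg p m) :=
  Submodule.mem_map_of_mem (Submodule.subset_span ⟨m, rfl, rfl⟩)

lemma gen_mem {x : X} {n : ℤ} (h : p x = n) : gen p d R x ∈ gr p d R n := by
  subst h; exact mk_mon_mem (.of x)

lemma gr_eq_span (n : ℤ) : gr p d R n =
    Submodule.span 𝕂 {x | ∃ m, wordDeg p m = n ∧ mk p d R (mon 𝕂 m) = x} := by
  rw [gr, freeGr, Submodule.map_span]
  congr 1
  ext x
  constructor
  · rintro ⟨_, ⟨m, hm, rfl⟩, rfl⟩; exact ⟨m, hm, rfl⟩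
  · rintro ⟨m, hm, rfl⟩; exact ⟨_, ⟨m, hm, rfl⟩, rfl⟩

lemma gr_induction {n : ℤ} {P : MinSuper p d R → Prop} (h0 : P 0)
    (hadd : ∀ x y, P x → P y → P (x + y)) (hsmul : ∀ (c : 𝕂) x, P x → P (c • x))
    (hmon : ∀ m, wordDeg p m = n → P (mk p d R (mon 𝕂 m))) {x : MinSuper p d R}
    (hx : x ∈ gr p d R n) : P x := by
  rw [gr_eq_span] at hx
  induction hx using Submodule.span_induction with
  | mem x h => obtain ⟨m, hm, rfl⟩ := h; exact hmon m hm
  | zero => exact h0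
  | add x y _ _ hx hy => exact hadd x y hx hy
  | smul c x _ hx => exact hsmul c x hx

lemma mon_mul (a b : FreeMagma X) : mon 𝕂 a * mon 𝕂 b = mon 𝕂 (.mul a b) := by
  simp only [mon, MonoidAlgebra.single_mul_single, mul_one]; rfl

lemma br_mem {m n : ℤ} {x y : MinSuper p d R} (hx : x ∈ gr p d R m) (hy : y ∈ gr p d R n) :
    br x y ∈ gr p d R (m + n) := by
  refine gr_induction (P := fun x => br x y ∈ gr p d R (m + n)) (by simp)
    (fun a b ha hb => by simpa using add_mem ha hb)
    (fun c a ha => by simpa using Submodule.smul_mem _ c ha) (fun a ha => ?_) hx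
  refine gr_induction (P := fun y => br (mk p d R (mon 𝕂 a)) y ∈ gr p d R (m + n)) (by simp)
    (fun a b ha hb => by simpa using add_mem ha hb)
    (fun c a ha => by simpa using Submodule.smul_mem _ c ha) (fun b hb => ?_) hy
  rw [br_mk, mon_mul, ← ha, ← hb]
  exact mk_mon_mem (FreeMagma.mul a b)

/-- Graded antisymmetry. -/
lemma br_skew {m n : ℤ} {x y : MinSuper p d R} (hx : x ∈ gr p d R m) (hy : y ∈ gr p d R n) :
    br x y = -(ksgn 𝕂 m n • br y x) := by
  refine gr_induction (P := fun x => br x y = -(ksgn 𝕂 m n • br y x)) (by simp)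
    (fun a b ha hb => by simp [ha, hb]; abel)
    (fun c a ha => by simp [ha, smul_comm c]) (fun a ha => ?_) hx
  refine gr_induction (P := fun y => br (mk p d R (mon 𝕂 a)) y =
      -(ksgn 𝕂 m n • br y (mk p d R (mon 𝕂 a)))) (by simp)
    (fun a b ha hb => by simp [ha, hb]; abel)
    (fun c a ha => by simp [ha, smul_comm c]) (fun b hb => ?_) hy
  suffices key : mk p d R (mon 𝕂 a * mon 𝕂 b + ksgn 𝕂 m n • (mon 𝕂 b * mon 𝕂 a)) = 0 by
    rw [map_add, map_smul] at key
    exact eq_neg_of_add_eq_zero_left key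
  apply mk_eq_zero_of_mem
  rw [superIdeal, Submodule.mem_sInf]
  rintro N ⟨_, h, _⟩
  rw [← ha, ← hb]
  exact h a b

/-- The graded Jacobi identity. -/
lemma br_jacobi {m n k : ℤ} {x y z : MinSuper p d R} (hx : x ∈ gr p d R m) (hy : y ∈ gr p d R n)
    (hz : z ∈ gr p d R k) :
    br x (br y z) = br (br x y) z + ksgn 𝕂 m n • br y (br x z) := by
  refine gr_induction (P := fun x => br x (br y z) = br (br x y) z + ksgn 𝕂 m n • br y (br x z))
    (by simp) (fun a b ha hb => by simp [ha, hb]; abel)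
    (fun c a ha => by simp [ha, smul_comm c]) (fun a ha => ?_) hx
  refine gr_induction (P := fun y => br (mk p d R (mon 𝕂 a)) (br y z) =
      br (br (mk p d R (mon 𝕂 a)) y) z + ksgn 𝕂 m n • br y (br (mk p d R (mon 𝕂 a)) z))
    (by simp) (fun a b ha hb => by simp [ha, hb]; abel)
    (fun c a ha => by simp [ha, smul_comm c]) (fun b hb => ?_) hy
  refine gr_induction (P := fun z => br (mk p d R (mon 𝕂 a)) (br (mk p d R (mon 𝕂 b)) z) =
      br (br (mk p d R (mon 𝕂 a)) (mk p d R (mon 𝕂 b))) z +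
        ksgn 𝕂 m n • br (mk p d R (mon 𝕂 b)) (br (mk p d R (mon 𝕂 a)) z))
    (by simp) (fun a b ha hb => by simp [ha, hb]; abel)
    (fun c a ha => by simp [ha, smul_comm c]) (fun c hc => ?_) hz
  suffices key : mk p d R (mon 𝕂 a * (mon 𝕂 b * mon 𝕂 c) - (mon 𝕂 a * mon 𝕂 b) * mon 𝕂 c
      - ksgn 𝕂 m n • (mon 𝕂 b * (mon 𝕂 a * mon 𝕂 c))) = 0 by
    rw [map_sub, map_sub, map_smul, sub_sub] at key
    exact sub_eq_zero.1 key
  apply mk_eq_zero_of_mem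
  rw [superIdeal, Submodule.mem_sInf]
  rintro N ⟨_, _, h, _⟩
  rw [← ha, ← hb]
  exact h a b c

lemma ksgn_zero_left (n : ℤ) : ksgn 𝕂 0 n = 1 := by simp [ksgn]

/-- The bracket `⟦x, y⟧` of two homogeneous elements, the second one of degree zero. -/
def brZero {n : ℤ} (x : gr p d R n) (y : gr p d R 0) : gr p d R n :=
  ⟨br x.1 y.1, by simpa using br_mem x.2 y.2⟩

/-- The component of degree zero is a Lie algebra. -/
instance [CharZero 𝕂] : LieRing (gr p d R 0) where
  bracket x y := ⟨br x.1 y.1, by simpa using br_mem x.2 y.2⟩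
  add_lie x y z := by ext; simp
  lie_add x y z := by ext; simp
  lie_self x := by
    have h := br_skew x.2 x.2
    rw [ksgn_zero_left, one_smul, eq_neg_iff_add_eq_zero, ← two_smul 𝕂] at h
    ext
    simpa using h
  leibniz_lie x y z := by
    ext
    have h := br_jacobi x.2 y.2 z.2
    rwa [ksgn_zero_left, one_smul] at h

instance [CharZero 𝕂] : LieAlgebra 𝕂 (gr p d R 0) where
  lie_smul c x y := by ext; exact map_smul (br x.1) c y.1

/-- The adjoint action of the component of degree zero on the other components. -/
instance [CharZero 𝕂] (n : ℤ) : LieRingModule (gr p d R 0) (gr p d R n) where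
  bracket x y := ⟨br x.1 y.1, by simpa using br_mem x.2 y.2⟩
  add_lie x y z := by ext; simp
  lie_add x y z := by ext; simp
  leibniz_lie x y z := by
    ext
    have h := br_jacobi x.2 y.2 z.2
    rwa [ksgn_zero_left, one_smul] at h

instance [CharZero 𝕂] (n : ℤ) : LieModule 𝕂 (gr p d R 0) (gr p d R n) where
  smul_lie c x y := by ext; exact LinearMap.congr_fun (map_smul br c x.1) y.1
  lie_smul c x y := by ext; exact map_smul (br x.1) c y.1

end MinSuper

/-- The generators of the Lie superalgebras with a given local part: the homogeneous elements of the
local part, together with their degrees. -/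
def LocalGen {V : Type*} [AddCommGroup V] [Module 𝕂 V] (gr : ℤ → Submodule 𝕂 V) : Type _ :=
  {x : ℤ × V // x.1 ∈ ({-1, 0, 1} : Set ℤ) ∧ x.2 ∈ gr x.1}

section MinimalExtension

variable {V : Type*} [AddCommGroup V] [Module 𝕂 V]

/-- The degree of a generator. -/
def LocalGen.deg {gr : ℤ → Submodule 𝕂 V} (x : LocalGen gr) : ℤ := x.1.1

/-- The underlying element of the local part. -/
def LocalGen.val {gr : ℤ → Submodule 𝕂 V} (x : LocalGen gr) : V := x.1.2

/-- The relations of the maximal `ℤ`-graded Lie superalgebra with local part `V`: the linear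
relations and the brackets of `V`, as far as they take values in the degrees `-1`, `0`, `1`. -/
inductive LocalRel (gr : ℤ → Submodule 𝕂 V) (μ : V →ₗ[𝕂] V →ₗ[𝕂] V) : FreeNA 𝕂 (LocalGen gr) → Prop
  | add (a b c : LocalGen gr) (hb : b.deg = a.deg) (hc : c.deg = a.deg) (h : c.val = a.val + b.val) :
      LocalRel gr μ (mon 𝕂 (.of c) - (mon 𝕂 (.of a) + mon 𝕂 (.of b)))
  | smul (t : 𝕂) (a c : LocalGen gr) (hc : c.deg = a.deg) (h : c.val = t • a.val) :
      LocalRel gr μ (mon 𝕂 (.of c) - t • mon 𝕂 (.of a))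
  | bracket (a b c : LocalGen gr) (hc : c.deg = a.deg + b.deg) (h : c.val = μ a.val b.val) :
      LocalRel gr μ (mon 𝕂 (.of c) - mon 𝕂 (.of a) * mon 𝕂 (.of b))

/-- The minimal `ℤ`-graded Lie superalgebra with the given local part: the maximal one modulo
its maximal graded ideal that intersects the local part trivially. -/
abbrev MinimalExtension (gr : ℤ → Submodule 𝕂 V) (μ : V →ₗ[𝕂] V →ₗ[𝕂] V) : Type _ :=
  MinSuper (LocalGen.deg (gr := gr)) LocalGen.deg {r | LocalRel gr μ r}

/-- The image in the minimal `ℤ`-graded Lie superalgebra of an element of its local part. -/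
def MinimalExtension.ofLocal {gr : ℤ → Submodule 𝕂 V} (μ : V →ₗ[𝕂] V →ₗ[𝕂] V) {k : ℤ}
    (hk : k ∈ ({-1, 0, 1} : Set ℤ)) {x : V} (hx : x ∈ gr k) : MinimalExtension gr μ :=
  MinSuper.gen _ _ _ (⟨(k, x), hk, hx⟩ : LocalGen gr)

end MinimalExtension

end Presentation

/-! ### The cartanification of a contragredient local Lie superalgebra -/

section Cartanification

attribute [local instance] LieRing.ofAssociativeRing

/-- A contragredient local Lie superalgebra with a consistent `ℤ`-grading, that is, with even part
`G₀` and odd part `G₋ ⊕ G₊`: a Lie algebra `G₀`, two `G₀`-modules `G₋` and `G₊`, an equivariant map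
`⟦x, y⟧ = ⟦y, x⟧` (for `x` of degree `-1` and `y` of degree `1`), an invariant pairing `⟨x | y⟩`,
and a grading element `L`.  The pairing of the degrees `1` and `-1` in the other order is
`⟨y | x⟩ = -⟨x | y⟩`. -/
structure ContragredientLocal (𝕂 G₀ Gm Gp : Type*) [Field 𝕂] [LieRing G₀] [LieAlgebra 𝕂 G₀]
    [AddCommGroup Gm] [Module 𝕂 Gm] [LieRingModule G₀ Gm] [LieModule 𝕂 G₀ Gm]
    [AddCommGroup Gp] [Module 𝕂 Gp] [LieRingModule G₀ Gp] [LieModule 𝕂 G₀ Gp] where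
  /-- The bracket of an element of degree `-1` and an element of degree `1`. -/
  brk : Gm →ₗ[𝕂] Gp →ₗ[𝕂] G₀
  lie_brk : ∀ (z : G₀) (x : Gm) (y : Gp), ⁅z, brk x y⁆ = brk ⁅z, x⁆ y + brk x ⁅z, y⁆
  /-- The pairing `⟨x | y⟩` of an element of degree `-1` and an element of degree `1`. -/
  form : Gm →ₗ[𝕂] Gp →ₗ[𝕂] 𝕂
  form_invariant : ∀ (x : Gm) (z : G₀) (y : Gp), form (-⁅z, x⁆) y = form x ⁅z, y⁆
  /-- The grading element. -/
  L : G₀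
  lie_L_zero : ∀ z : G₀, ⁅L, z⁆ = 0
  lie_L_neg : ∀ x : Gm, ⁅L, x⁆ = -x
  lie_L_pos : ∀ y : Gp, ⁅L, y⁆ = y

variable {𝕂 G₀ : Type*} [Field 𝕂] [LieRing G₀] [LieAlgebra 𝕂 G₀]

variable (𝕂 G₀) in
/-- The universal enveloping algebra of the component of degree zero. -/
abbrev Env : Type _ := UniversalEnvelopingAlgebra 𝕂 G₀

section Bimodule

variable (V : Type*) [AddCommGroup V] [Module 𝕂 V] [LieRingModule G₀ V] [LieModule 𝕂 G₀ V]

/-- Left multiplication by elements of `G₀` on `V U(G₀)`, given by `z (x u) = ⁅z, x⁆ u + x (z u)`.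
Here `V` is a component of degree `1` or `-1`, and `x ⊗ u` stands for `x u`. -/
def leftHom : G₀ →ₗ⁅𝕂⁆ Module.End 𝕂 (V ⊗[𝕂] Env 𝕂 G₀) where
  toFun z := (LieModule.toEnd 𝕂 G₀ V z).rTensor (Env 𝕂 G₀) +
    (LinearMap.mulLeft 𝕂 (UniversalEnvelopingAlgebra.ι 𝕂 z)).lTensor V
  map_add' z w := by
    ext x
    simp [TensorProduct.tmul_add, add_mul]; abel
  map_smul' c z := by
    ext x
    simp [TensorProduct.smul_tmul']
  map_lie' {z w} := by
    ext x
    simp [TensorProduct.tmul_sub, LieRing.of_associative_ring_bracket,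
      sub_mul, mul_assoc]
    abel

/-- Left multiplication by elements of `U(G₀)` on `V U(G₀)`. -/
def leftMul : Env 𝕂 G₀ →ₐ[𝕂] Module.End 𝕂 (V ⊗[𝕂] Env 𝕂 G₀) :=
  UniversalEnvelopingAlgebra.lift 𝕂 (leftHom V)

/-- Right multiplication by elements of `U(G₀)` on `V U(G₀)`. -/
def rightMul : Env 𝕂 G₀ →ₗ[𝕂] Module.End 𝕂 (V ⊗[𝕂] Env 𝕂 G₀) :=
  LinearMap.lTensorHom V ∘ₗ (LinearMap.mul 𝕂 (Env 𝕂 G₀)).flip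

/-- The commutator `u m - m u` of `u ∈ U(G₀)` and `m ∈ V U(G₀)`. -/
def commVU : Env 𝕂 G₀ →ₗ[𝕂] Module.End 𝕂 (V ⊗[𝕂] Env 𝕂 G₀) :=
  (leftMul V).toLinearMap - rightMul V

/-- Right multiplication by elements of `G₀` on `U(G₀) V`, given by
`(u x) z = (u z) x - u ⁅z, x⁆`. -/
def rightHom : G₀ →ₗ⁅𝕂⁆ (Module.End 𝕂 (Env 𝕂 G₀ ⊗[𝕂] V))ᵐᵒᵖ where
  toFun z := MulOpposite.op ((LinearMap.mulRight 𝕂 (UniversalEnvelopingAlgebra.ι 𝕂 z)).rTensor V -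
    (LieModule.toEnd 𝕂 G₀ V z).lTensor (Env 𝕂 G₀))
  map_add' z w := by
    rw [← MulOpposite.op_add]
    congr 1
    ext x
    simp [TensorProduct.add_tmul, mul_add]; abel
  map_smul' c z := by
    rw [RingHom.id_apply, ← MulOpposite.op_smul]
    congr 1
    ext x
    simp [TensorProduct.smul_tmul', smul_sub]
  map_lie' {z w} := by
    rw [LieRing.of_associative_ring_bracket, ← MulOpposite.op_mul, ← MulOpposite.op_mul,
      ← MulOpposite.op_sub]
    congr 1
    ext x
    simp [TensorProduct.sub_tmul, LieRing.of_associative_ring_bracket,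
      mul_sub, mul_assoc]
    abel

/-- The identification `V U(G₀) = U(G₀) V`, which rewrites `x u` with the factor of degree
`1` or `-1` to the right. -/
def toLeftForm : V ⊗[𝕂] Env 𝕂 G₀ →ₗ[𝕂] Env 𝕂 G₀ ⊗[𝕂] V :=
  TensorProduct.lift
    (LinearMap.mk₂ 𝕂
      (fun (x : V) (u : Env 𝕂 G₀) =>
        (UniversalEnvelopingAlgebra.lift 𝕂 (rightHom V) u).unop (1 ⊗ₜ[𝕂] x))
      (fun x y u => by rw [TensorProduct.tmul_add, map_add])
      (fun c x u => by rw [TensorProduct.tmul_smul, map_smul])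
      (fun x u w => by simp)
      (fun c x u => by simp))

variable {V} {W : Type*} [AddCommGroup W] [Module 𝕂 W]

/-- Given the products `x y ∈ U(G₀)` for `x ∈ V` and `y ∈ W`, the product
`(u x) (y w) = (u (x y)) w` of `U(G₀) V` and `W U(G₀)`, with values in `U(G₀)`. -/
def crossMul (π : V →ₗ[𝕂] W →ₗ[𝕂] Env 𝕂 G₀) :
    Env 𝕂 G₀ ⊗[𝕂] V →ₗ[𝕂] W ⊗[𝕂] Env 𝕂 G₀ →ₗ[𝕂] Env 𝕂 G₀ :=
  TensorProduct.lift
    (LinearMap.mk₂ 𝕂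
      (fun (u : Env 𝕂 G₀) (x : V) => TensorProduct.lift
        (LinearMap.mul 𝕂 (Env 𝕂 G₀) ∘ₗ LinearMap.mulLeft 𝕂 u ∘ₗ π x))
      (fun u w x => by ext; simp [add_mul])
      (fun c u x => by ext; simp)
      (fun u x y => by ext; simp [mul_add])
      (fun c u x => by ext; simp))

/-- The product of `V U(G₀)` and `W U(G₀)`, for `V` and `W` of opposite degrees. -/
def pairMul (π : V →ₗ[𝕂] W →ₗ[𝕂] Env 𝕂 G₀) :
    V ⊗[𝕂] Env 𝕂 G₀ →ₗ[𝕂] W ⊗[𝕂] Env 𝕂 G₀ →ₗ[𝕂] Env 𝕂 G₀ :=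
  crossMul π ∘ₗ toLeftForm V

end Bimodule

namespace ContragredientLocal

variable {Gm Gp : Type*}
  [AddCommGroup Gm] [Module 𝕂 Gm] [LieRingModule G₀ Gm] [LieModule 𝕂 G₀ Gm]
  [AddCommGroup Gp] [Module 𝕂 Gp] [LieRingModule G₀ Gp] [LieModule 𝕂 G₀ Gp]
  (C : ContragredientLocal 𝕂 G₀ Gm Gp)

local notation "ιU" => UniversalEnvelopingAlgebra.ι 𝕂

/-- The product `x y = -⟦y, x⟧ + ⟨x | y⟩ L` for `x` of degree `-1` and `y` of degree `1`. -/
def negPos : Gm →ₗ[𝕂] Gp →ₗ[𝕂] Env 𝕂 G₀ :=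
  LinearMap.mk₂ 𝕂 (fun x y => -ιU (C.brk x y) + C.form x y • ιU C.L)
    (fun _ _ _ => by simp [add_smul]; abel) (fun _ _ _ => by simp [mul_smul])
    (fun _ _ _ => by simp [add_smul]; abel) (fun _ _ _ => by simp [mul_smul])

/-- The product `y x = ⟦x, y⟧ + ⟨y | x⟩ L + ⟨y | x⟩` for `y` of degree `1` and `x` of degree `-1`,
where `⟨y | x⟩ = -⟨x | y⟩`. -/
def posNeg : Gp →ₗ[𝕂] Gm →ₗ[𝕂] Env 𝕂 G₀ :=
  LinearMap.mk₂ 𝕂 (fun y x => ιU (C.brk x y) + (-C.form x y) • ιU C.L +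
      (-C.form x y) • (1 : Env 𝕂 G₀))
    (fun _ _ _ => by simp [add_smul]; abel) (fun _ _ _ => by simp [mul_smul])
    (fun _ _ _ => by simp [add_smul]; abel) (fun _ _ _ => by simp [mul_smul])

/-- The anticommutator `a b + b a` of `a ∈ G₋ U(G₀)` and `b ∈ G₊ U(G₀)`. -/
def anticomm : Gm ⊗[𝕂] Env 𝕂 G₀ →ₗ[𝕂] Gp ⊗[𝕂] Env 𝕂 G₀ →ₗ[𝕂] Env 𝕂 G₀ :=
  pairMul C.negPos + (pairMul C.posNeg).flip

/-- The local part `G₋ U(G₀) ⊕ U(G₀) ⊕ G₊ U(G₀)` of the algebra with restricted associativity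
associated to a contragredient local Lie superalgebra. -/
abbrev Loc (_C : ContragredientLocal 𝕂 G₀ Gm Gp) : Type _ :=
  (Gm ⊗[𝕂] Env 𝕂 G₀) × Env 𝕂 G₀ × (Gp ⊗[𝕂] Env 𝕂 G₀)

/-- The components of degrees `-1`, `0` and `1` of the local part; the others are zero. -/
def locGr : ℤ → Submodule 𝕂 C.Loc := fun k =>
  if k = -1 then (⊤ : Submodule 𝕂 (Gm ⊗[𝕂] Env 𝕂 G₀)).prod ⊥
  else if k = 0 then (⊥ : Submodule 𝕂 (Gm ⊗[𝕂] Env 𝕂 G₀)).prod (Submodule.prod ⊤ ⊥)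
  else if k = 1 then (⊥ : Submodule 𝕂 (Gm ⊗[𝕂] Env 𝕂 G₀)).prod (Submodule.prod ⊥ ⊤)
  else ⊥

/-- The bracket of the local Lie superalgebra `G₋ U(G₀) ⊕ U(G₀) ⊕ G₊ U(G₀)`: the graded commutator
`a b - (-1) ^ (deg a * deg b) • b a`.  The bracket of two elements of degree `1`, or of
two elements of degree `-1`, is not part of the structure of a local Lie superalgebra, and
such pairs contribute zero. -/
def locBr : C.Loc →ₗ[𝕂] C.Loc →ₗ[𝕂] C.Loc :=
  LinearMap.mk₂ 𝕂
    (fun a b =>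
      (commVU Gm a.2.1 b.1 - commVU Gm b.2.1 a.1,
       (a.2.1 * b.2.1 - b.2.1 * a.2.1) + C.anticomm a.1 b.2.2 + C.anticomm b.1 a.2.2,
       commVU Gp a.2.1 b.2.2 - commVU Gp b.2.1 a.2.2))
    (fun a a' b => by
      ext1
      · simp; abel
      · ext1
        · simp [add_mul, mul_add]; abel
        · simp; abel)
    (fun c a b => by
      ext1
      · simp [smul_sub]
      · ext1
        · simp [smul_sub]
        · simp [smul_sub])
    (fun a b b' => by
      ext1
      · simp; abel
      · ext1
        · simp [add_mul, mul_add]; abel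
        · simp; abel)
    (fun c a b => by
      ext1
      · simp [smul_sub]
      · ext1
        · simp [smul_sub]
        · simp [smul_sub])

/-- The element `x z` of `G₋ G₀`, in degree `-1`. -/
def negZero (x : Gm) (z : G₀) : C.Loc := (x ⊗ₜ[𝕂] ιU z, 0, 0)

/-- The element `y` of `G₊`, in degree `1`. -/
def pos (y : Gp) : C.Loc := (0, 0, y ⊗ₜ[𝕂] (1 : Env 𝕂 G₀))

/-- The subalgebra of the local Lie superalgebra `G₋ U(G₀) ⊕ U(G₀) ⊕ G₊ U(G₀)` generated by
`G₋ G₀` and `G₊`. -/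
def cartSub : Submodule 𝕂 C.Loc :=
  sInf {S | IsGradedFor C.locGr S ∧ (∀ a ∈ S, ∀ b ∈ S, C.locBr a b ∈ S) ∧
    (∀ x z, C.negZero x z ∈ S) ∧ ∀ y, C.pos y ∈ S}

lemma locBr_mem_cartSub : ∀ a ∈ C.cartSub, ∀ b ∈ C.cartSub, C.locBr a b ∈ C.cartSub := by
  intro a ha b hb
  rw [cartSub, Submodule.mem_sInf] at ha hb ⊢
  exact fun S hS => hS.2.1 a (ha S hS) b (hb S hS)

lemma negZero_mem_cartSub (x : Gm) (z : G₀) : C.negZero x z ∈ C.cartSub := by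
  rw [cartSub, Submodule.mem_sInf]
  exact fun S hS => hS.2.2.1 x z

/-- The bracket of the subalgebra `C.cartSub`. -/
def subBr : C.cartSub →ₗ[𝕂] C.cartSub →ₗ[𝕂] C.cartSub :=
  subMul C.locBr C.cartSub C.locBr_mem_cartSub

/-- The grading of the subalgebra `C.cartSub`. -/
def subGr (k : ℤ) : Submodule 𝕂 C.cartSub := (C.locGr k).comap C.cartSub.subtype

/-- The maximal peripheral ideal of `C.cartSub`: the maximal graded ideal that intersects the
component of degree zero trivially. -/
def peripheral : Submodule 𝕂 C.cartSub :=
  sSup {N | IsIdealFor C.subBr N ∧ IsGradedFor C.subGr N ∧ N ⊓ C.subGr 0 = ⊥}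

lemma isIdealFor_peripheral : IsIdealFor C.subBr C.peripheral :=
  isIdealFor_sSup _ _ fun _ hN => hN.1

/-- The local cartanification. -/
abbrev LocalCart : Type _ := C.cartSub ⧸ C.peripheral

/-- The bracket of the local cartanification. -/
def cartBr : C.LocalCart →ₗ[𝕂] C.LocalCart →ₗ[𝕂] C.LocalCart :=
  quotMul C.subBr C.peripheral C.isIdealFor_peripheral

/-- The grading of the local cartanification. -/
def cartGr (k : ℤ) : Submodule 𝕂 C.LocalCart := (C.subGr k).map C.peripheral.mkQ

/-- The cartanification: the minimal `ℤ`-graded Lie superalgebra whose local part is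
the local cartanification. -/
abbrev Cart : Type _ := MinimalExtension C.cartGr C.cartBr

/-- The class in the local cartanification of the product `x z`, for `x ∈ G₋` and `z ∈ G₀`. -/
def localProd (x : Gm) (z : G₀) : C.LocalCart :=
  C.peripheral.mkQ ⟨C.negZero x z, C.negZero_mem_cartSub x z⟩

lemma localProd_mem (x : Gm) (z : G₀) : C.localProd x z ∈ C.cartGr (-1) :=
  Submodule.mem_map_of_mem (by
    change C.negZero x z ∈ C.locGr (-1)
    simp [locGr, negZero])

/-- The product `x z` in the component of degree `-1` of the cartanification, for `x ∈ G₋` and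
`z ∈ G₀`. -/
def prod (x : Gm) (z : G₀) : C.Cart :=
  MinimalExtension.ofLocal C.cartBr (by simp) (C.localProd_mem x z)

end ContragredientLocal

end Cartanification

/-! ### Contragredient Lie superalgebras -/

section Contragredient

/-- The Chevalley generators `e i`, `f i`, `h i`. -/
inductive ChevGen (ι : Type*)
  | e (i : ι)
  | f (i : ι)
  | h (i : ι)

/-- The degrees of the Chevalley generators, given the degrees `c i` of `e i`. -/
def ChevGen.deg {ι : Type*} (c : ι → ℤ) : ChevGen ι → ℤ
  | .e i => c i
  | .f i => -c i
  | .h _ => 0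

variable {𝕂 : Type*} [Field 𝕂] {ι : Type*} [DecidableEq ι]

/-- The Chevalley relations `[h i, e j] = B i j e j`, `[h i, f j] = -B i j f j` and
`[e i, f j] = δ i j h j`. -/
inductive ChevRel (B : Matrix ι ι 𝕂) : FreeNA 𝕂 (ChevGen ι) → Prop
  | he (i j : ι) : ChevRel B (mon 𝕂 (.of (.h i)) * mon 𝕂 (.of (.e j)) - B i j • mon 𝕂 (.of (.e j)))
  | hf (i j : ι) : ChevRel B (mon 𝕂 (.of (.h i)) * mon 𝕂 (.of (.f j)) - -B i j • mon 𝕂 (.of (.f j)))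
  | ef (i j : ι) : ChevRel B (mon 𝕂 (.of (.e i)) * mon 𝕂 (.of (.f j)) -
      (if i = j then (1 : 𝕂) else 0) • mon 𝕂 (.of (.h j)))

/-- The contragredient Lie superalgebra of the matrix `B`, where `e i` and `f i` are odd if and only
if `c i` is odd: the Lie superalgebra presented by the Chevalley generators and relations, modulo
its maximal ideal that is graded with respect to the grading where every `e i` has degree `1` and
every `f i` has degree `-1`, and that intersects the local part trivially. -/
abbrev Contragredient (B : Matrix ι ι 𝕂) (c : ι → ℤ) : Type _ :=
  MinSuper (ChevGen.deg c) (ChevGen.deg fun _ => 1) {r | ChevRel B r}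

namespace Contragredient

open MinSuper

variable (B : Matrix ι ι 𝕂) (c : ι → ℤ)

/-- The generator `e i`. -/
def e (i : ι) : Contragredient B c := gen _ _ _ (.e i)

/-- The generator `f i`. -/
def f (i : ι) : Contragredient B c := gen _ _ _ (.f i)

/-- The generator `h i`. -/
def h (i : ι) : Contragredient B c := gen _ _ _ (.h i)

variable {B c}

lemma mk_rel {r : FreeNA 𝕂 (ChevGen ι)} (hr : ChevRel B r) :
    mk (ChevGen.deg c) (ChevGen.deg fun _ => 1) {r | ChevRel B r} r = 0 := by
  apply mk_eq_zero_of_mem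
  rw [superIdeal, Submodule.mem_sInf]
  exact fun N hN => hN.2.2.2 hr

lemma br_h_e (i j : ι) : br (h B c i) (e B c j) = B i j • e B c j := by
  have := mk_rel (c := c) (ChevRel.he (B := B) i j)
  rw [map_sub, map_smul] at this
  exact sub_eq_zero.1 this

lemma br_h_f (i j : ι) : br (h B c i) (f B c j) = -B i j • f B c j := by
  have := mk_rel (c := c) (ChevRel.hf (B := B) i j)
  rw [map_sub, map_smul] at this
  exact sub_eq_zero.1 this

lemma br_e_f (i j : ι) :
    br (e B c i) (f B c j) = (if i = j then (1 : 𝕂) else 0) • h B c j := by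
  have := mk_rel (c := c) (ChevRel.ef (B := B) i j)
  rw [map_sub, map_smul] at this
  exact sub_eq_zero.1 this

lemma e_mem (i : ι) : e B c i ∈ gr (ChevGen.deg c) (ChevGen.deg fun _ => 1) {r | ChevRel B r} (c i) :=
  gen_mem rfl

lemma f_mem (i : ι) :
    f B c i ∈ gr (ChevGen.deg c) (ChevGen.deg fun _ => 1) {r | ChevRel B r} (-c i) :=
  gen_mem rfl

lemma h_mem (i : ι) : h B c i ∈ gr (ChevGen.deg c) (ChevGen.deg fun _ => 1) {r | ChevRel B r} 0 :=
  gen_mem rfl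

lemma br_h_h (i j : ι) : br (h B c i) (h B c j) = 0 := by
  have h1 : h B c j = br (e B c j) (f B c j) := by rw [br_e_f, if_pos rfl, one_smul]
  rw [h1, br_jacobi (h_mem i) (e_mem j) (f_mem j), ksgn_zero_left, one_smul, br_h_e, br_h_f]
  simp

/-- An element that multiplies every generator by its degree acts as the degree derivation. -/
lemma br_grading {L : Contragredient B c}
    (hL : L ∈ gr (ChevGen.deg c) (ChevGen.deg fun _ => 1) {r | ChevRel B r} 0)
    (he : ∀ i, br L (e B c i) = (c i : 𝕂) • e B c i)
    (hf : ∀ i, br L (f B c i) = (-c i : 𝕂) • f B c i) (hh : ∀ i, br L (h B c i) = 0)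
    {n : ℤ} {x : Contragredient B c}
    (hx : x ∈ gr (ChevGen.deg c) (ChevGen.deg fun _ => 1) {r | ChevRel B r} n) :
    br L x = (n : 𝕂) • x := by
  refine gr_induction (P := fun x => br L x = (n : 𝕂) • x) (by simp)
    (fun a b ha hb => by simp [ha, hb]) (fun t a ha => by simp [ha, smul_comm t])
    (fun m hm => ?_) hx
  subst hm
  clear hx x
  induction m using FreeMagma.rec with
  | of y =>
    cases y with
    | e i => exact he i
    | f i => have := hf i; rw [← Int.cast_neg] at this; exact this
    | h i => rw [wordDeg, ChevGen.deg, Int.cast_zero, zero_smul]; exact hh i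
  | mul a b ha hb =>
    have key := br_jacobi hL (mk_mon_mem (p := ChevGen.deg c) (d := ChevGen.deg fun _ => 1)
      (R := {r | ChevRel B r}) a) (mk_mon_mem (p := ChevGen.deg c) (d := ChevGen.deg fun _ => 1)
      (R := {r | ChevRel B r}) b)
    rw [ha, hb, ksgn_zero_left, one_smul, map_smul, map_smul, LinearMap.smul_apply, ← add_smul,
      br_mk, mon_mul] at key
    rw [wordDeg, Int.cast_add]
    exact key

end Contragredient

end Contragredient

section Character

/-! An auxiliary module, used to show that the invariant pairing exists: the highest weight module
generated by a vector `v` such that `f i v = 0` for `i ≠ o` and `h i v = δ i o v`.  The basis vector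
`none` stands for `v`, and `some w` stands for `f w f o v`. -/

namespace Contragredient

open MinSuper

variable {𝕂 : Type*} [Field 𝕂] {ι : Type*} (B : Matrix ι ι 𝕂) (c : ι → ℤ) (o : ι)

lemma end_ext {S T : Module.End 𝕂 (Option (List ι) →₀ 𝕂)}
    (h : ∀ b, S (Finsupp.single b 1) = T (Finsupp.single b 1)) : S = T :=
  Finsupp.lhom_ext' fun b => LinearMap.ext_ring (h b)

/-- The degrees of the basis vectors, given the degrees `c i` of `e i`. -/
def vDeg (c : ι → ℤ) : Option (List ι) → ℤ
  | none => 0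
  | some w => -c o - (w.map c).sum

variable (𝕂) in
/-- The component of degree `n` of the module. -/
def vGr (c : ι → ℤ) (n : ℤ) : Submodule 𝕂 (Option (List ι) →₀ 𝕂) :=
  Finsupp.supported 𝕂 𝕂 {b | vDeg o c b = n}

lemma single_mem_vGr (c : ι → ℤ) (b : Option (List ι)) (t : 𝕂) {n : ℤ} (h : vDeg o c b = n) :
    Finsupp.single b t ∈ vGr 𝕂 o c n :=
  Finsupp.single_mem_supported 𝕂 t h

lemma vGr_map {S : Module.End 𝕂 (Option (List ι) →₀ 𝕂)} {c : ι → ℤ} {n k : ℤ}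
    (h : ∀ b, vDeg o c b = n → S (Finsupp.single b 1) ∈ vGr 𝕂 o c (n + k)) :
    ∀ v ∈ vGr 𝕂 o c n, S v ∈ vGr 𝕂 o c (n + k) := by
  intro v hv
  have : vGr 𝕂 o c n ≤ (vGr 𝕂 o c (n + k)).comap S := by
    rw [vGr, Finsupp.supported_eq_span_single, Submodule.span_le]
    rintro _ ⟨b, hb, rfl⟩
    exact h b hb
  exact this hv

variable [DecidableEq ι]

/-- The weights of the basis vectors. -/
def vWt (i : ι) : Option (List ι) → 𝕂
  | none => if i = o then 1 else 0
  | some w => (if i = o then 1 else 0) - B i o - (w.map fun j => B i j).sum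

variable (𝕂) in
/-- The action of `f i` on the basis vectors. -/
def vFb (i : ι) : Option (List ι) → (Option (List ι) →₀ 𝕂)
  | none => if i = o then Finsupp.single (some []) 1 else 0
  | some w => Finsupp.single (some (i :: w)) 1

variable (𝕂) in
/-- The action of `f i`. -/
def vF (i : ι) : Module.End 𝕂 (Option (List ι) →₀ 𝕂) := Finsupp.linearCombination 𝕂 (vFb 𝕂 o i)

/-- The action of `h i`. -/
def vH (i : ι) : Module.End 𝕂 (Option (List ι) →₀ 𝕂) :=
  Finsupp.linearCombination 𝕂 fun b => Finsupp.single b (vWt B o i b)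

/-- The action of `e i` on the basis vectors `some w`. -/
def vEw (i : ι) : List ι → (Option (List ι) →₀ 𝕂)
  | [] => if i = o then Finsupp.single none 1 else 0
  | j :: w => (if i = j then Finsupp.single (some w) (vWt B o i (some w)) else 0) +
      ksgn 𝕂 (c i) (c j) • vF 𝕂 o j (vEw i w)

/-- The action of `e i`. -/
def vE (i : ι) : Module.End 𝕂 (Option (List ι) →₀ 𝕂) :=
  Finsupp.linearCombination 𝕂 fun b => b.elim 0 (vEw B c o i)

/-- The action of the generators. -/
def vGen : ChevGen ι → Module.End 𝕂 (Option (List ι) →₀ 𝕂)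
  | .e i => vE B c o i
  | .f i => vF 𝕂 o i
  | .h i => vH B o i

/-- The action of nonassociative words. -/
def vMon : FreeMagma (ChevGen ι) → Module.End 𝕂 (Option (List ι) →₀ 𝕂)
  | .of x => vGen B c o x
  | .mul a b => vMon a * vMon b -
      ksgn 𝕂 (wordDeg (ChevGen.deg c) a) (wordDeg (ChevGen.deg c) b) • (vMon b * vMon a)

lemma vF_single_none (i : ι) :
    vF 𝕂 o i (Finsupp.single none 1) = if i = o then Finsupp.single (some []) 1 else 0 := by
  simp [vF, vFb]

lemma vF_single_some (i : ι) (w : List ι) :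
    vF 𝕂 o i (Finsupp.single (some w) 1) = Finsupp.single (some (i :: w)) 1 := by
  simp [vF, vFb]

lemma vH_single (i : ι) (b : Option (List ι)) :
    vH B o i (Finsupp.single b 1) = vWt B o i b • Finsupp.single b 1 := by
  simp [vH]

lemma vE_single_none (i : ι) : vE B c o i (Finsupp.single none 1) = 0 := by
  simp [vE]

lemma vE_single_some (i : ι) (w : List ι) :
    vE B c o i (Finsupp.single (some w) 1) = vEw B c o i w := by
  simp [vE]

lemma vHF (i j : ι) : vH B o i * vF 𝕂 o j - vF 𝕂 o j * vH B o i = -B i j • vF 𝕂 o j := by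
  apply end_ext
  intro b
  cases b with
  | none =>
    simp only [LinearMap.sub_apply, Module.End.mul_apply, LinearMap.smul_apply, vF_single_none,
      vH_single, map_smul]
    split_ifs with hj
    · subst hj
      rw [vH_single, ← sub_smul]
      simp [vWt]
    · simp
  | some w =>
    simp only [LinearMap.sub_apply, Module.End.mul_apply, LinearMap.smul_apply, vF_single_some,
      vH_single, map_smul]
    rw [← sub_smul]
    congr 1
    simp [vWt]

lemma vH_vEw (i j : ι) (w : List ι) :
    vH B o i (vEw B c o j w) = (vWt B o i (some w) + B i j) • vEw B c o j w := by
  induction w with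
  | nil =>
    simp only [vEw]
    split_ifs with hj
    · subst hj
      rw [vH_single]
      simp [vWt]
    · simp
  | cons k w ih =>
    have hF := LinearMap.congr_fun (vHF B o i k) (vEw B c o j w)
    simp only [LinearMap.sub_apply, Module.End.mul_apply, LinearMap.smul_apply, ih, map_smul,
      sub_eq_iff_eq_add] at hF
    simp only [vEw, map_add, map_smul, hF, smul_add]
    congr 1
    · split_ifs with hj
      · subst hj
        rw [← mul_one (vWt B o j (some w)), ← smul_eq_mul, ← Finsupp.smul_single, map_smul,
          vH_single, smul_smul, smul_smul, mul_comm]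
        congr 2
        simp only [vWt, List.map_cons, List.sum_cons]
        ring
      · simp
    · have hk : -B i k + (vWt B o i (some w) + B i j) = vWt B o i (some (k :: w)) + B i j := by
        simp only [vWt, List.map_cons, List.sum_cons]
        ring
      rw [← smul_add, ← add_smul, smul_comm, hk]

lemma vHE (i j : ι) : vH B o i * vE B c o j - vE B c o j * vH B o i = B i j • vE B c o j := by
  apply end_ext
  intro b
  cases b with
  | none =>
    simp only [LinearMap.sub_apply, Module.End.mul_apply, LinearMap.smul_apply, vE_single_none,
      vH_single, map_smul]
    simp
  | some w =>
    simp only [LinearMap.sub_apply, Module.End.mul_apply, LinearMap.smul_apply, vE_single_some,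
      vH_single, map_smul, vH_vEw]
    rw [← sub_smul]
    congr 1
    ring

lemma vEF (i j : ι) : vE B c o i * vF 𝕂 o j - ksgn 𝕂 (c i) (c j) • (vF 𝕂 o j * vE B c o i) =
    (if i = j then (1 : 𝕂) else 0) • vH B o j := by
  apply end_ext
  intro b
  cases b with
  | none =>
    simp only [LinearMap.sub_apply, Module.End.mul_apply, LinearMap.smul_apply, vE_single_none,
      vF_single_none, vH_single, map_zero, smul_zero, sub_zero]
    split_ifs with hj hi hi
    · subst hj; subst hi
      rw [vE_single_some]
      simp [vEw, vWt]
    · subst hj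
      rw [vE_single_some]
      simp [vEw, hi]
    · subst hi
      simp [vWt, hj]
    · simp
  | some w =>
    simp only [LinearMap.sub_apply, Module.End.mul_apply, LinearMap.smul_apply, vE_single_some,
      vF_single_some, vH_single, vEw, add_sub_cancel_right]
    split_ifs with hi
    · subst hi; simp
    · simp

lemma vF_mem (c' : ι → ℤ) (i : ι) (n : ℤ) :
    ∀ v ∈ vGr 𝕂 o c' n, vF 𝕂 o i v ∈ vGr 𝕂 o c' (n + -c' i) := by
  apply vGr_map
  rintro (_ | w) hb
  · rw [vF_single_none]
    split_ifs with hi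
    · subst hi
      apply single_mem_vGr
      simp only [vDeg] at hb ⊢
      simp; lia
    · exact zero_mem _
  · rw [vF_single_some]
    apply single_mem_vGr
    simp only [vDeg, List.map_cons, List.sum_cons] at hb ⊢
    lia

lemma vH_mem (c' : ι → ℤ) (i : ι) (n : ℤ) :
    ∀ v ∈ vGr 𝕂 o c' n, vH B o i v ∈ vGr 𝕂 o c' (n + 0) := by
  apply vGr_map
  intro b hb
  rw [vH_single]
  exact Submodule.smul_mem _ _ (single_mem_vGr o c' b 1 (by lia))

lemma vEw_mem (c' : ι → ℤ) (i : ι) (w : List ι) :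
    vEw B c o i w ∈ vGr 𝕂 o c' (vDeg o c' (some w) + c' i) := by
  induction w with
  | nil =>
    simp only [vEw]
    split_ifs with hi
    · subst hi
      apply single_mem_vGr
      simp [vDeg]
    · exact zero_mem _
  | cons j w ih =>
    simp only [vEw]
    refine add_mem ?_ (Submodule.smul_mem _ _ ?_)
    · split_ifs with hi
      · subst hi
        apply single_mem_vGr
        simp only [vDeg, List.map_cons, List.sum_cons]
        lia
      · exact zero_mem _
    · have := vF_mem o c' j _ _ ih
      convert this using 2
      simp only [vDeg, List.map_cons, List.sum_cons]
      lia

lemma vE_mem (c' : ι → ℤ) (i : ι) (n : ℤ) :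
    ∀ v ∈ vGr 𝕂 o c' n, vE B c o i v ∈ vGr 𝕂 o c' (n + c' i) := by
  apply vGr_map
  rintro (_ | w) hb
  · rw [vE_single_none]
    exact zero_mem _
  · rw [vE_single_some, ← hb]
    exact vEw_mem B c o c' i w

lemma vMon_mem (c' : ι → ℤ) (m : FreeMagma (ChevGen ι)) : ∀ n, ∀ v ∈ vGr 𝕂 o c' n,
    vMon B c o m v ∈ vGr 𝕂 o c' (n + wordDeg (ChevGen.deg c') m) := by
  induction m using FreeMagma.rec with
  | of x =>
    cases x with
    | e i => exact vE_mem B c o c' i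
    | f i => exact vF_mem o c' i
    | h i => exact vH_mem B o c' i
  | mul a b ha hb =>
    intro n v hv
    rw [vMon, wordDeg]
    refine sub_mem ?_ (Submodule.smul_mem _ _ ?_)
    · have := ha _ _ (hb _ _ hv)
      rwa [add_assoc, add_comm (wordDeg _ b)] at this
    · have := hb _ _ (ha _ _ hv)
      rwa [add_assoc] at this

/-- The product of the superalgebra of endomorphisms, an endomorphism being written as the pair of
its even part and its odd part: the graded commutator. -/
def pairBr {E : Type*} [Ring E] [Algebra 𝕂 E] : (E × E) →ₗ[𝕂] (E × E) →ₗ[𝕂] (E × E) :=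
  LinearMap.mk₂ 𝕂 (fun a b => (a.1 * b.1 - b.1 * a.1 + (a.2 * b.2 + b.2 * a.2),
      a.1 * b.2 - b.2 * a.1 + (a.2 * b.1 - b.1 * a.2)))
    (fun a a' b => by ext1 <;> simp [add_mul, mul_add] <;> abel)
    (fun t a b => by ext1 <;> simp [smul_sub])
    (fun a b b' => by ext1 <;> simp [add_mul, mul_add] <;> abel)
    (fun t a b => by ext1 <;> simp [smul_sub])

/-- An endomorphism of degree `n`, as the pair of its even part and its odd part. -/
def toPair {E : Type*} [Ring E] (n : ℤ) (x : E) : E × E := if Odd n then (0, x) else (x, 0)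

lemma pairBr_toPair {E : Type*} [Ring E] [Algebra 𝕂 E] (m n : ℤ) (x y : E) :
    pairBr (𝕂 := 𝕂) (toPair m x) (toPair n y) = toPair (m + n) (x * y - ksgn 𝕂 m n • (y * x)) := by
  by_cases hm : Odd m <;> by_cases hn : Odd n <;>
    simp [pairBr, toPair, ksgn, hm, hn, Int.odd_add, ← Int.not_odd_iff_even]

lemma toPair_add {E : Type*} [Ring E] (n : ℤ) (x y : E) :
    toPair n (x + y) = toPair n x + toPair n y := by
  unfold toPair; split_ifs <;> simp

lemma toPair_smul {E : Type*} [Ring E] [Algebra 𝕂 E] (n : ℤ) (t : 𝕂) (x : E) :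
    toPair n (t • x) = t • toPair n x := by
  unfold toPair; split_ifs <;> simp

lemma toPair_zero {E : Type*} [Ring E] (n : ℤ) : toPair n (0 : E) = 0 := by
  unfold toPair; split_ifs <;> rfl

variable (𝕂) in
lemma ksgn_eq (m n : ℤ) : ksgn 𝕂 m n = 1 ∨ ksgn 𝕂 m n = -1 := by
  unfold ksgn; split_ifs <;> simp

variable (𝕂) in
lemma ksgn_comm (m n : ℤ) : ksgn 𝕂 m n = ksgn 𝕂 n m := by
  simp only [ksgn, and_comm]

variable (𝕂) in
lemma ksgn_add (m n k : ℤ) : ksgn 𝕂 m (n + k) = ksgn 𝕂 m n * ksgn 𝕂 m k := by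
  by_cases hm : Odd m <;> by_cases hn : Odd n <;> by_cases hk : Odd k <;>
    simp [ksgn, hm, hn, hk, Int.odd_add, ← Int.not_odd_iff_even]

lemma pairBr_skew {E : Type*} [Ring E] [Algebra 𝕂 E] (m n : ℤ) (x y : E) :
    pairBr (𝕂 := 𝕂) (toPair m x) (toPair n y) +
      ksgn 𝕂 m n • pairBr (𝕂 := 𝕂) (toPair n y) (toPair m x) = 0 := by
  rw [pairBr_toPair, pairBr_toPair, add_comm n m, ← toPair_smul, ← toPair_add, ksgn_comm 𝕂 n m]
  convert toPair_zero (E := E) (m + n) using 2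
  obtain h | h := ksgn_eq 𝕂 m n <;> rw [h] <;> simp

lemma pairBr_jacobi {E : Type*} [Ring E] [Algebra 𝕂 E] (m n k : ℤ) (x y z : E) :
    pairBr (𝕂 := 𝕂) (toPair m x) (pairBr (𝕂 := 𝕂) (toPair n y) (toPair k z)) -
      pairBr (𝕂 := 𝕂) (pairBr (𝕂 := 𝕂) (toPair m x) (toPair n y)) (toPair k z) -
      ksgn 𝕂 m n • pairBr (𝕂 := 𝕂) (toPair n y)
        (pairBr (𝕂 := 𝕂) (toPair m x) (toPair k z)) = 0 := by
  simp only [pairBr_toPair]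
  rw [← add_assoc, ← add_assoc, add_comm n m, ← toPair_smul, sub_eq_add_neg, sub_eq_add_neg,
    ← neg_one_smul 𝕂 (toPair _ _), ← neg_one_smul 𝕂 (toPair _ (ksgn 𝕂 m n • _)), ← toPair_smul,
    ← toPair_smul, ← toPair_add, ← toPair_add, ksgn_add, ksgn_add, ksgn_comm 𝕂 (m + n) k,
    ksgn_add, ksgn_comm 𝕂 k m, ksgn_comm 𝕂 k n, ksgn_comm 𝕂 n m]
  convert toPair_zero (E := E) (m + n + k) using 2
  obtain h1 | h1 := ksgn_eq 𝕂 m n <;> obtain h2 | h2 := ksgn_eq 𝕂 m k <;>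
    obtain h3 | h3 := ksgn_eq 𝕂 n k <;> rw [h1, h2, h3] <;> simp <;> noncomm_ring

/-- The action of the free nonassociative algebra, as a pair of even and odd parts. -/
def vRep : FreeNA 𝕂 (ChevGen ι) →ₗ[𝕂]
    Module.End 𝕂 (Option (List ι) →₀ 𝕂) × Module.End 𝕂 (Option (List ι) →₀ 𝕂) :=
  (Finsupp.linearCombination 𝕂 fun m => toPair (wordDeg (ChevGen.deg c) m) (vMon B c o m)) ∘ₗ
    (MonoidAlgebra.coeffLinearEquiv 𝕂).toLinearMap

lemma vRep_mon (m : FreeMagma (ChevGen ι)) :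
    vRep B c o (mon 𝕂 m) = toPair (wordDeg (ChevGen.deg c) m) (vMon B c o m) := by
  simp [vRep, mon]

lemma freeNA_ext {X W : Type*} [AddCommMonoid W] [Module 𝕂 W] {S T : FreeNA 𝕂 X →ₗ[𝕂] W}
    (h : ∀ m, S (mon 𝕂 m) = T (mon 𝕂 m)) : S = T := by
  have : S ∘ₗ (MonoidAlgebra.coeffLinearEquiv 𝕂).symm.toLinearMap =
      T ∘ₗ (MonoidAlgebra.coeffLinearEquiv 𝕂).symm.toLinearMap :=
    Finsupp.lhom_ext' fun m => LinearMap.ext_ring (h m)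
  refine LinearMap.ext fun x => ?_
  simpa using LinearMap.congr_fun this (MonoidAlgebra.coeffLinearEquiv 𝕂 x)

lemma vRep_mul (x y : FreeNA 𝕂 (ChevGen ι)) :
    vRep B c o (x * y) = pairBr (𝕂 := 𝕂) (vRep B c o x) (vRep B c o y) := by
  have : (LinearMap.mul 𝕂 (FreeNA 𝕂 (ChevGen ι))).compr₂ (vRep B c o) =
      (pairBr (𝕂 := 𝕂) (E := Module.End 𝕂 (Option (List ι) →₀ 𝕂))).compl₁₂
        (vRep B c o) (vRep B c o) := by
    apply freeNA_ext
    intro a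
    apply freeNA_ext
    intro b
    simp only [LinearMap.compr₂_apply, LinearMap.mul_apply', LinearMap.compl₁₂_apply, vRep_mon,
      MinSuper.mon_mul, pairBr_toPair]
    rfl
  exact LinearMap.congr_fun (LinearMap.congr_fun this x) y

lemma vRep_sub_mem {x y : FreeNA 𝕂 (ChevGen ι)} (hxy : vRep B c o x = vRep B c o y) :
    x - y ∈ LinearMap.ker (vRep B c o) := by
  have h : x - y = x + (-1 : 𝕂) • y := by rw [neg_one_smul, sub_eq_add_neg]
  have h2 : vRep B c o y + (-1 : 𝕂) • vRep B c o y = ((1 : 𝕂) + -1) • vRep B c o y := by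
    rw [add_smul, one_smul]
  rw [LinearMap.mem_ker, h, map_add, map_smul, hxy, h2, add_neg_cancel, zero_smul]

lemma superIdeal_le_ker : superIdeal (ChevGen.deg c) {r | ChevRel B r} ≤
    LinearMap.ker (vRep B c o) := by
  apply sInf_le
  refine ⟨⟨fun x n hn => ?_, fun n hn x => ?_⟩, fun a b => ?_, fun a b d => ?_, ?_⟩
  · rw [LinearMap.mem_ker] at hn ⊢
    rw [LinearMap.mul_apply', vRep_mul, hn, map_zero]
  · rw [LinearMap.mem_ker] at hn ⊢
    rw [LinearMap.mul_apply', vRep_mul, hn, map_zero, LinearMap.zero_apply]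
  · rw [LinearMap.mem_ker, map_add, map_smul, vRep_mul, vRep_mul, vRep_mon, vRep_mon]
    exact pairBr_skew _ _ _ _
  · rw [LinearMap.mem_ker, map_sub, map_sub, map_smul]
    simp only [vRep_mul, vRep_mon]
    exact pairBr_jacobi _ _ _ _ _ _
  · rintro _ (⟨i, j⟩ | ⟨i, j⟩ | ⟨i, j⟩)
    · refine vRep_sub_mem B c o ?_
      rw [map_smul, vRep_mul, vRep_mon, vRep_mon, pairBr_toPair, ← toPair_smul]
      simp only [wordDeg, ChevGen.deg, zero_add, MinSuper.ksgn_zero_left, one_smul]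
      exact congrArg (toPair (c j)) (vHE B c o i j)
    · refine vRep_sub_mem B c o ?_
      rw [map_smul, vRep_mul, vRep_mon, vRep_mon, pairBr_toPair, ← toPair_smul]
      simp only [wordDeg, ChevGen.deg, zero_add, MinSuper.ksgn_zero_left, one_smul]
      exact congrArg (toPair (-c j)) (vHF B o i j)
    · refine vRep_sub_mem B c o ?_
      rw [map_smul, vRep_mul, vRep_mon, vRep_mon, vRep_mon, pairBr_toPair, ← toPair_smul]
      have hs : ksgn 𝕂 (c i) (-c j) = ksgn 𝕂 (c i) (c j) := by simp [ksgn]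
      simp only [wordDeg, ChevGen.deg, vMon, vGen]
      rw [hs, vEF B c o i j]
      split_ifs with hij
      · subst hij
        simp
      · simp [toPair_zero]

/-- The functional taking the coefficient of the highest weight vector `v` in `x v`. -/
def vChar : FreeNA 𝕂 (ChevGen ι) →ₗ[𝕂] 𝕂 :=
  Finsupp.lapply none ∘ₗ LinearMap.applyₗ (Finsupp.single none 1) ∘ₗ LinearMap.fst 𝕂 _ _ ∘ₗ
    vRep B c o

lemma vChar_mon {m : FreeMagma (ChevGen ι)} (hm : wordDeg (ChevGen.deg c) m = 0) :
    vChar B c o (mon 𝕂 m) = vMon B c o m (Finsupp.single none 1) none := by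
  simp [vChar, vRep_mon, hm, toPair]

lemma vChar_eq_zero {k : ℤ} (hk : k ≠ 0) {x : FreeNA 𝕂 (ChevGen ι)}
    (hx : x ∈ freeGr 𝕂 (ChevGen.deg fun _ => 1) k) : vChar B c o x = 0 := by
  have : freeGr 𝕂 (ChevGen.deg fun _ => 1) k ≤ LinearMap.ker (vChar B c o) := by
    rw [freeGr, Submodule.span_le]
    rintro _ ⟨m, hm, rfl⟩
    refine LinearMap.mem_ker.2 ?_
    have h1 := vMon_mem B c o (fun _ => 1) m 0 (Finsupp.single none 1)
      (single_mem_vGr o _ _ _ rfl)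
    have h2 : vMon B c o m (Finsupp.single none 1) none = 0 := by
      by_contra hne
      have := (Finsupp.mem_supported _ _).1 h1 (Finsupp.mem_support_iff.2 hne)
      simp only [vDeg, Set.mem_ofPred_eq] at this
      lia
    simp only [vChar, LinearMap.comp_apply, vRep_mon, toPair]
    split_ifs
    · simp
    · simpa using h2
  exact this hx

lemma minIdeal_le_ker_vChar :
    minIdeal (ChevGen.deg c) (ChevGen.deg fun _ => 1) {r | ChevRel B r} ≤
      LinearMap.ker (vChar B c o) := by
  have h0 : superIdeal (ChevGen.deg c) {r | ChevRel B r} ≤ LinearMap.ker (vChar B c o) := by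
    intro x hx
    have := LinearMap.mem_ker.1 (superIdeal_le_ker B c o hx)
    rw [LinearMap.mem_ker, vChar]
    simp [this]
  refine sup_le h0 (sSup_le ?_)
  rintro N ⟨_, _, hgr, hloc⟩
  refine hgr.trans (iSup_le fun k => ?_)
  by_cases hk : k = 0
  · subst hk
    exact (hloc 0 (by simp)).trans h0
  · exact fun x hx => LinearMap.mem_ker.2 (vChar_eq_zero B c o hk hx.2)

/-- The functional induced on the contragredient Lie superalgebra. -/
def char : Contragredient B c →ₗ[𝕂] 𝕂 :=
  (minIdeal (ChevGen.deg c) (ChevGen.deg fun _ => 1) {r | ChevRel B r}).liftQ (vChar B c o)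
    (minIdeal_le_ker_vChar B c o)

lemma char_mk (x : FreeNA 𝕂 (ChevGen ι)) : char B c o (mk _ _ _ x) = vChar B c o x := rfl

lemma char_h (i : ι) : char B c o (h B c i) = if i = o then 1 else 0 := by
  rw [h, gen, char_mk, vChar_mon _ _ _ (by rfl)]
  simp only [vMon, vGen, vH_single, vWt]
  split_ifs <;> simp

/-- The functional vanishes on the brackets of elements of degree zero. -/
lemma char_br (ho : c o = 1) (hc : ∀ i, 0 ≤ c i) {x y : Contragredient B c}
    (hx : x ∈ gr (ChevGen.deg c) (ChevGen.deg fun _ => 1) {r | ChevRel B r} 0)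
    (hy : y ∈ gr (ChevGen.deg c) (ChevGen.deg fun _ => 1) {r | ChevRel B r} 0) :
    char B c o (br x y) = 0 := by
  have key : ∀ m : FreeMagma (ChevGen ι), wordDeg (ChevGen.deg c) m = 0 →
      ∃ t : 𝕂, vMon B c o m (Finsupp.single none 1) = t • Finsupp.single none 1 := by
    intro m hm
    have h1 := vMon_mem B c o c m 0 (Finsupp.single none 1) (single_mem_vGr o _ _ _ rfl)
    refine ⟨vMon B c o m (Finsupp.single none 1) none, ?_⟩
    ext b
    cases b with
    | none => simp
    | some w =>
      have hw : 0 ≤ (w.map c).sum := List.sum_nonneg (by simpa using fun a _ => hc a)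
      have h2 : vMon B c o m (Finsupp.single none 1) (some w) = 0 := by
        by_contra hne
        have := (Finsupp.mem_supported _ _).1 h1 (Finsupp.mem_support_iff.2 hne)
        simp only [vDeg, Set.mem_ofPred_eq] at this
        lia
      simp [h2]
  refine gr_induction (P := fun x => char B c o (br x y) = 0) (by simp)
    (fun a b ha hb => by simp [ha, hb]) (fun t a ha => by simp [ha]) (fun a ha => ?_) hx
  refine gr_induction (P := fun y => char B c o (br (mk _ _ _ (mon 𝕂 a)) y) = 0) (by simp)
    (fun a b ha hb => by simp [ha, hb]) (fun t a ha => by simp [ha]) (fun b hb => ?_) hy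
  rw [br_mk, mon_mul, char_mk, vChar_mon _ _ _ (by rw [wordDeg, ha, hb, add_zero])]
  obtain ⟨s, hs⟩ := key a ha
  obtain ⟨t, ht⟩ := key b hb
  simp only [vMon, LinearMap.sub_apply, Module.End.mul_apply, ha,
    ksgn_zero_left, one_smul, hs, ht, map_smul]
  rw [smul_comm, sub_self]
  rfl

end Contragredient

end Character

/-! ### The Lie superalgebras given by a triple `(g, lam, κ)` -/

section Triple

/-- The matrix `A` extended by a row and a column `0` (written `none`) with `B 0 0 = 0`,
`B i 0 = -lam i` and `B 0 j = -lam j / ε j`. -/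
def extMatrix {𝕂 I : Type*} [Field 𝕂] (A : Matrix I I ℤ) (ε : I → 𝕂) (lam : I → ℕ) :
    Matrix (Option I) (Option I) 𝕂 :=
  Matrix.of fun i j => match i, j with
    | none, none => 0
    | some i, none => -(lam i : 𝕂)
    | none, some j => -((lam j : 𝕂) / ε j)
    | some i, some j => (A i j : 𝕂)

/-- The data `(g, lam, κ)`: an invertible symmetrisable generalised Cartan matrix `A`, the Dynkin
labels `lam i` of a dominant integral weight `lam`, and nonzero numbers `ε i = κ (e i, f i)` such
that `D⁻¹ A` is symmetric for `D = diag ε`, which determine an invariant symmetric bilinear form `κ`.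
The extended matrix is invertible, too. -/
structure Triple (𝕂 I : Type*) [Field 𝕂] [Fintype I] [DecidableEq I] where
  /-- The Cartan matrix. -/
  A : Matrix I I ℤ
  A_diag : ∀ i, A i i = 2
  A_nonpos : ∀ i j, i ≠ j → A i j ≤ 0
  A_zero : ∀ i j, A i j = 0 → A j i = 0
  isUnit_A : IsUnit (A.map (Int.cast : ℤ → 𝕂))
  /-- The numbers `κ (e i, f i)`. -/
  ε : I → 𝕂
  ε_ne_zero : ∀ i, ε i ≠ 0
  isSymm : (Matrix.diagonal (fun i => (ε i)⁻¹) * A.map (Int.cast : ℤ → 𝕂)).IsSymm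
  /-- The Dynkin labels of the weight `lam`. -/
  lam : I → ℕ
  isUnit_B : IsUnit (extMatrix A ε lam)

/-- The degrees of the generators `e i` in the consistent grading: only `e 0` has degree `1`. -/
def nodeDeg {I : Type*} : Option I → ℤ
  | none => 1
  | some _ => 0

namespace Triple

open MinSuper

variable {𝕂 I : Type*} [Field 𝕂] [Fintype I] [DecidableEq I] (T : Triple 𝕂 I)

/-! #### The Kac-Moody algebra and its weights

A weight `μ` is given by its Dynkin labels `μ i = μ (h i)`. -/

/-- The Kac-Moody algebra `g` of the Cartan matrix `A`. -/
abbrev g : Type _ := Contragredient (T.A.map (Int.cast : ℤ → 𝕂)) fun _ => 0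

/-- `α` is a root of `g`. -/
def IsRoot (α : I → 𝕂) : Prop :=
  α ≠ 0 ∧ ∃ x : T.g, x ≠ 0 ∧ ∀ i, br (Contragredient.h _ _ i) x = α i • x

/-- `α` is a positive root of `g`: a root that is a combination of the simple roots `α k`, where
`α k (h i) = A i k`, with non-negative integer coefficients. -/
def IsPosRoot (α : I → 𝕂) : Prop :=
  T.IsRoot α ∧ ∃ a : I → ℕ, ∀ i, α i = ∑ k, (a k : 𝕂) * (T.A i k : 𝕂)

/-- The Gram matrix `κ (h i, h j) = κ (e i, [f i, h j]) = ε i * A j i`. -/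
def gram : Matrix I I 𝕂 := Matrix.of fun i j => T.ε i * (T.A j i : 𝕂)

/-- The bilinear form on the weights that corresponds to `κ` under the identification of the Cartan
subalgebra with its dual given by `κ`. -/
def weightForm (μ ν : I → 𝕂) : 𝕂 := dotProduct μ (T.gram⁻¹.mulVec ν)

/-- The weight with Dynkin labels `μ i / ε i`. -/
def triUp (μ : I → 𝕂) : I → 𝕂 := fun i => μ i / T.ε i

/-- The weight with Dynkin labels `ε i * μ i`. -/
def triDown (μ : I → 𝕂) : I → 𝕂 := fun i => T.ε i * μ i

/-- A weight `μ` is pseudo-minuscule if it is dominant integral and `(triDown μ, α)` is `0` or `1`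
for every positive root `α`. -/
def IsPseudoMinuscule (μ : I → 𝕂) : Prop :=
  (∀ i, ∃ n : ℕ, μ i = n) ∧
    ∀ α, T.IsPosRoot α → T.weightForm (T.triDown μ) α = 0 ∨ T.weightForm (T.triDown μ) α = 1

/-- The weight `lam`. -/
def lamWeight : I → 𝕂 := fun i => (T.lam i : 𝕂)

/-! #### The contragredient Lie superalgebra -/

/-- The matrix `B`, with rows and columns indexed by `{0} ∪ I`. -/
def B : Matrix (Option I) (Option I) 𝕂 := extMatrix T.A T.ε T.lam

/-- The contragredient Lie superalgebra of the matrix `B`, where only `e 0` and `f 0` are odd. -/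
abbrev BKM : Type _ := Contragredient T.B nodeDeg

/-- The components of the consistent `ℤ`-grading. -/
abbrev comp (n : ℤ) : Submodule 𝕂 T.BKM :=
  gr (ChevGen.deg nodeDeg) (ChevGen.deg fun _ => 1) {r | ChevRel T.B r} n

/-- The generator `e 0`. -/
def e0 : T.comp 1 := ⟨Contragredient.e T.B nodeDeg none, gen_mem (by simp [ChevGen.deg, nodeDeg])⟩

/-- The generator `f 0`. -/
def f0 : T.comp (-1) := ⟨Contragredient.f T.B nodeDeg none, gen_mem (by simp [ChevGen.deg, nodeDeg])⟩

/-- The generators `h i`, for `i ∈ {0} ∪ I`. -/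
def h (i : Option I) : T.comp 0 := ⟨Contragredient.h T.B nodeDeg i, Contragredient.h_mem _⟩

/-- The generators `f i`, for `i ∈ I`. -/
def f (i : I) : T.comp 0 := ⟨Contragredient.f T.B nodeDeg (some i), gen_mem (by simp [ChevGen.deg, nodeDeg])⟩

/-- The bracket of two elements of degrees `-1` and `1`. -/
def brk : T.comp (-1) →ₗ[𝕂] T.comp 1 →ₗ[𝕂] T.comp 0 :=
  LinearMap.mk₂ 𝕂 (fun x y => ⟨br x.1 y.1, by simpa using br_mem x.2 y.2⟩)
    (fun _ _ _ => by ext; simp) (fun _ _ _ => by ext; simp)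
    (fun _ _ _ => by ext; simp) (fun _ _ _ => by ext; simp)

/-- The grading element `L = ∑ i, (B⁻¹) 0 i • h i`. -/
def L : T.comp 0 := ∑ i, T.B⁻¹ none i • T.h i

lemma br_L {n : ℤ} (x : T.comp n) : br T.L.1 x.1 = (n : 𝕂) • x.1 := by
  have hB : T.B⁻¹ * T.B = 1 :=
    Matrix.nonsing_inv_mul _ ((Matrix.isUnit_iff_isUnit_det _).1 T.isUnit_B)
  have key : ∀ j, ∑ i, T.B⁻¹ none i * T.B i j = ((nodeDeg j : ℤ) : 𝕂) := by
    intro j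
    rw [← Matrix.mul_apply, hB]
    cases j <;> simp [nodeDeg]
  have hL : T.L.1 = ∑ i, T.B⁻¹ none i • Contragredient.h T.B nodeDeg i := by
    simp [L, h]
  refine Contragredient.br_grading T.L.2 (fun j => ?_) (fun j => ?_) (fun j => ?_) x.2
  · rw [hL, ← key, map_sum, LinearMap.sum_apply, Finset.sum_smul]
    refine Finset.sum_congr rfl fun i _ => ?_
    rw [map_smul, LinearMap.smul_apply, Contragredient.br_h_e, smul_smul]
  · rw [hL, ← key, map_sum, LinearMap.sum_apply, neg_smul, Finset.sum_smul,
      ← Finset.sum_neg_distrib]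
    refine Finset.sum_congr rfl fun i _ => ?_
    rw [map_smul, LinearMap.smul_apply, Contragredient.br_h_f, smul_smul, mul_neg, neg_smul]
  · rw [hL]
    simp [Contragredient.br_h_h]

variable [CharZero 𝕂]

lemma lie_brk (z : T.comp 0) (x : T.comp (-1)) (y : T.comp 1) :
    ⁅z, T.brk x y⁆ = T.brk ⁅z, x⁆ y + T.brk x ⁅z, y⁆ := by
  ext
  have := br_jacobi z.2 x.2 y.2
  rwa [ksgn_zero_left, one_smul] at this

/-- There is an invariant pairing of the components of degrees `-1` and `1` with `⟨f 0 | e 0⟩ = -1`.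
It is unique, since these components are generated by `f 0` and `e 0`, respectively, under
the component of degree `0`. -/
theorem exists_pairing : ∃ F : T.comp (-1) →ₗ[𝕂] T.comp 1 →ₗ[𝕂] 𝕂,
    (∀ (x : T.comp (-1)) (z : T.comp 0) (y : T.comp 1), F (-⁅z, x⁆) y = F x ⁅z, y⁆) ∧
      F T.f0 T.e0 = -1 := by
  refine ⟨-(T.brk.compr₂ (Contragredient.char T.B nodeDeg none ∘ₗ (T.comp 0).subtype)),
    fun x z y => ?_, ?_⟩
  · have h1 := Contragredient.char_br T.B nodeDeg none rfl (by rintro (_ | _) <;> simp [nodeDeg])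
      z.2 (T.brk x y).2
    have h2 : br z.1 (T.brk x y).1 = (T.brk ⁅z, x⁆ y).1 + (T.brk x ⁅z, y⁆).1 :=
      congrArg Subtype.val (T.lie_brk z x y)
    rw [h2, map_add] at h1
    simp only [LinearMap.neg_apply, LinearMap.compr₂_apply, map_neg, LinearMap.comp_apply,
      Submodule.subtype_apply, neg_neg]
    exact eq_neg_of_add_eq_zero_left h1
  · have h1 : (T.brk T.f0 T.e0).1 = Contragredient.h T.B nodeDeg none := by
      have h2 := br_skew T.f0.2 T.e0.2
      have h3 : br T.e0.1 T.f0.1 = Contragredient.h T.B nodeDeg none := by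
        refine (Contragredient.br_e_f none none).trans ?_
        rw [if_pos rfl, one_smul]
      rw [h3] at h2
      exact h2.trans (by simp [ksgn])
    simp only [LinearMap.neg_apply, LinearMap.compr₂_apply, LinearMap.comp_apply,
      Submodule.subtype_apply, h1, Contragredient.char_h, if_true]

/-- The pairing `⟨x | y⟩` for `x` of degree `-1` and `y` of degree `1`: the restriction of
the invariant bilinear form with `ℤ₂`-graded symmetry that extends `κ`, normalised by
`⟨e 0 | f 0⟩ = -⟨f 0 | e 0⟩ = 1`. -/
def pairing : T.comp (-1) →ₗ[𝕂] T.comp 1 →ₗ[𝕂] 𝕂 := T.exists_pairing.choose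

/-- The local part of the contragredient Lie superalgebra, as a contragredient local
Lie superalgebra. -/
def localPart : ContragredientLocal 𝕂 (T.comp 0) (T.comp (-1)) (T.comp 1) where
  brk := T.brk
  lie_brk := T.lie_brk
  form := T.pairing
  form_invariant := T.exists_pairing.choose_spec.1
  L := T.L
  lie_L_zero z := by
    ext
    exact (T.br_L z).trans (by simp)
  lie_L_neg x := by
    ext
    exact (T.br_L x).trans (by simp)
  lie_L_pos y := by
    ext
    exact (T.br_L y).trans (by simp)

/-- The cartanification of the contragredient Lie superalgebra. -/
abbrev BW : Type _ := T.localPart.Cart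

/-- The product `x z`, for `x` of degree `-1` and `z` of degree `0`, as an element of
the component of degree `-1` of the cartanification. -/
def mulW (x : T.comp (-1)) (z : T.comp 0) : T.BW := T.localPart.prod x z

end Triple

end Triple

end Cartanif

end

/-!
The element `X = f₀ f j - ⟦f₀, f j⟧ h j` has degree `-1`, and the elements of degree `-1` that have zero
bracket with all of `G₊` vanish in the cartanification, as they form an ideal that intersects
the component of degree zero trivially (`radical_comap_le_peripheral`).
This is because the subalgebra generated by `G₋ G₀` and `G₊` consists of `G₋ G₀`, `G₀` and `G₊`
in degrees `-1`, `0` and `1`, and the bracket of `x z` and `y` is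
`-⟨x|y⟩ z - ⟦x, ⟦z, y⟧⟧ + ⟨x|⟦z, y⟧⟩ L`, an equivariant map (`contract`).  So one has to show
`contract X y = 0` for all `y`.

As `G₊` is generated by `e₀` under the `e k` with `k ∈ I`, it suffices to show that all elements
that are obtained from `X` by the action of the `e k` have zero bracket with `e₀`.  Grade the positive
part `n₊` of the Kac-Moody algebra by the number of factors `e k` with `k ∈ J`.  The condition
`lam = triUp lam` and the pseudo-minuscule condition give `ε k = 1` and `lam k = 1` for `k ∈ J`, and
that the degrees of this grading are at most `1` (`gword_lam_le_one`, `word_eq_zero`), so that the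
component of degree `1` is abelian.  The component of degree `0` annihilates `e₀` and `f₀`, so one
only has to consider the images of `X` under the component `S` of degree `1`: these are `X` itself,
the elements `⁅x, X⁆`, which are equal to `-f₀ ⁅f j, x⁆ - b ⟦f j, f₀⟧ x` where `b` is
the `h j`-weight of `x` (if `x ≠ e j`), and the elements `⁅x', ⁅x, X⁆⁆`, which are of the form `f₀ z`
with `z` in the span of `S`.  Their brackets with `e₀` are `0`, `(b - 1) ⁅f j, x⁆` (or `0`, if
`x = e j`) and `z - z`.
Now `(b - 1) ⁅f j, x⁆ = 0`, by a computation in `sl 2` that uses `⁅f j, ⁅f j, x⁆⁆ = 0` and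
`⁅e j, x⁆ = 0` (`lie_f_word_properties`).

The pseudo-minuscule condition concerns the roots of the Kac-Moody algebra, whereas the above takes
place in the contragredient Lie superalgebra.  The relations of the positive part of the former are
transferred to the latter (`psi_eq_zero`) by means of the criterion that an element of degree at least
two that commutes with all `f i` is zero (`Contragredient.mk_eq_zero_of_br_f`).
-/

noncomputable section

namespace Cartanif

/-! ### Brackets with the component of degree one of a local Lie superalgebra -/

namespace ContragredientLocal

attribute [local instance] LieRing.ofAssociativeRing

variable {𝕂 G₀ : Type*} [Field 𝕂] [LieRing G₀] [LieAlgebra 𝕂 G₀]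
  {Gm Gp : Type*}
  [AddCommGroup Gm] [Module 𝕂 Gm] [LieRingModule G₀ Gm] [LieModule 𝕂 G₀ Gm]
  [AddCommGroup Gp] [Module 𝕂 Gp] [LieRingModule G₀ Gp] [LieModule 𝕂 G₀ Gp]
  (C : ContragredientLocal 𝕂 G₀ Gm Gp)

local notation "ιU" => UniversalEnvelopingAlgebra.ι 𝕂

lemma form_lie_right (z : G₀) (x : Gm) (y : Gp) : C.form x ⁅z, y⁆ = -C.form ⁅z, x⁆ y := by
  rw [← C.form_invariant, map_neg, LinearMap.neg_apply]

lemma lie_L (z : G₀) : ⁅z, C.L⁆ = 0 := by rw [← lie_skew, C.lie_L_zero, neg_zero]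

/-- The bracket in the cartanification of an element of `G₋ G₀` with an element `y` of `G₊`,
which takes values in `G₀`: it maps `x z` and `y` to `-⟨x|y⟩ z - ⟦x, ⟦z, y⟧⟧ + ⟨x|⟦z, y⟧⟩ L`. -/
def contract : Gm ⊗[𝕂] G₀ →ₗ[𝕂] Gp →ₗ[𝕂] G₀ :=
  TensorProduct.lift <| LinearMap.mk₂ 𝕂
    (fun x z => LinearMap.mk₂ 𝕂 (fun (x : Gm) (y : Gp) =>
      -(C.form x y • z) - C.brk x ⁅z, y⁆ + C.form x ⁅z, y⁆ • C.L)
      (fun _ _ _ => by simp [add_smul]; abel)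
      (fun _ _ _ => by simp [mul_smul, smul_sub])
      (fun _ _ _ => by simp [add_smul]; abel)
      (fun _ _ _ => by simp [mul_smul, smul_sub]) x)
    (fun _ _ _ => by simp)
    (fun _ _ _ => by simp)
    (fun _ _ _ => by ext; simp [add_smul]; abel)
    (fun c x z => by
      ext y
      simp [mul_smul, smul_sub, smul_comm _ c])

@[simp] lemma contract_tmul (x : Gm) (z : G₀) (y : Gp) : C.contract (x ⊗ₜ z) y =
    -(C.form x y • z) - C.brk x ⁅z, y⁆ + C.form x ⁅z, y⁆ • C.L := rfl

/-- The bracket of `G₋ G₀` and `G₊` is equivariant. -/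
lemma lie_contract (w : G₀) (m : Gm ⊗[𝕂] G₀) (y : Gp) :
    ⁅w, C.contract m y⁆ = C.contract ⁅w, m⁆ y + C.contract m ⁅w, y⁆ := by
  induction m using TensorProduct.induction_on with
  | zero => simp
  | add a b ha hb => simp only [map_add, LinearMap.add_apply, lie_add, ha, hb]; abel
  | tmul x z =>
    simp only [TensorProduct.LieModule.lie_tmul_right, map_add, LinearMap.add_apply, contract_tmul,
      lie_add, lie_sub, lie_neg, lie_smul, C.lie_L, C.lie_brk, C.form_lie_right, lie_lie,
      map_sub, sub_smul, neg_smul, smul_zero]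
    abel

section Tensor

variable (V : Type*) [AddCommGroup V] [Module 𝕂 V]

/-- The map of `V ⊗ G₀` onto the subspace `V G₀` of `V U(G₀)`. -/
def tensorEnv : V ⊗[𝕂] G₀ →ₗ[𝕂] V ⊗[𝕂] Env 𝕂 G₀ :=
  (ιU : G₀ →ₗ⁅𝕂⁆ Env 𝕂 G₀).toLinearMap.lTensor V

@[simp] lemma tensorEnv_tmul (x : V) (z : G₀) : tensorEnv V (x ⊗ₜ z) = x ⊗ₜ[𝕂] ιU z := rfl

end Tensor

lemma commVU_ι_tmul {V : Type*} [AddCommGroup V] [Module 𝕂 V] [LieRingModule G₀ V]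
    [LieModule 𝕂 G₀ V] (w : G₀) (x : V) (u : Env 𝕂 G₀) :
    commVU V (ιU w) (x ⊗ₜ u) = ⁅w, x⁆ ⊗ₜ u + x ⊗ₜ (ιU w * u - u * ιU w) := by
  simp [commVU, leftMul, leftHom, rightMul, TensorProduct.tmul_sub]
  abel

lemma commVU_ι_tensorEnv (w : G₀) (m : Gm ⊗[𝕂] G₀) :
    commVU Gm (ιU w) (tensorEnv Gm m) = tensorEnv Gm ⁅w, m⁆ := by
  induction m using TensorProduct.induction_on with
  | zero => simp only [lie_zero, map_zero]
  | add a b ha hb => simp only [lie_add, map_add, ha, hb]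
  | tmul x z =>
    rw [tensorEnv_tmul, commVU_ι_tmul, TensorProduct.LieModule.lie_tmul_right, map_add,
      tensorEnv_tmul, tensorEnv_tmul, LieHom.map_lie, LieRing.of_associative_ring_bracket]

lemma commVU_ι_tmul_one (w : G₀) (y : Gp) :
    commVU Gp (ιU w) (y ⊗ₜ (1 : Env 𝕂 G₀)) = ⁅w, y⁆ ⊗ₜ (1 : Env 𝕂 G₀) := by
  rw [commVU_ι_tmul]; simp

lemma toLeftForm_tmul_ι (x : Gm) (z : G₀) :
    toLeftForm Gm (x ⊗ₜ[𝕂] ιU z) = ιU z ⊗ₜ[𝕂] x - 1 ⊗ₜ[𝕂] ⁅z, x⁆ := by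
  simp [toLeftForm, rightHom]

lemma toLeftForm_tmul_one (y : Gp) :
    toLeftForm Gp (y ⊗ₜ[𝕂] (1 : Env 𝕂 G₀)) = 1 ⊗ₜ[𝕂] y := by
  simp [toLeftForm]

lemma anticomm_tensorEnv (m : Gm ⊗[𝕂] G₀) (y : Gp) :
    C.anticomm (tensorEnv Gm m) (y ⊗ₜ (1 : Env 𝕂 G₀)) = ιU (C.contract m y) := by
  induction m using TensorProduct.induction_on with
  | zero => simp only [map_zero, LinearMap.zero_apply]
  | add a b ha hb => simp only [map_add, LinearMap.add_apply, ha, hb]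
  | tmul x z =>
    have h1 : ιU (C.brk x ⁅z, y⁆) = ιU z * ιU (C.brk x y) - ιU (C.brk x y) * ιU z
        - ιU (C.brk ⁅z, x⁆ y) := by
      rw [← LieRing.of_associative_ring_bracket, ← LieHom.map_lie, C.lie_brk, map_add]
      abel
    have h2 : ιU z * ιU C.L = ιU C.L * ιU z := by
      rw [← sub_eq_zero, ← LieRing.of_associative_ring_bracket, ← LieHom.map_lie, C.lie_L, map_zero]
    have h3 (c : 𝕂) (w : G₀) : ιU (c • w) = c • ιU w :=
      map_smul (ιU : G₀ →ₗ⁅𝕂⁆ Env 𝕂 G₀).toLinearMap c w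
    simp only [anticomm, pairMul, LinearMap.add_apply, LinearMap.flip_apply, LinearMap.comp_apply,
      tensorEnv_tmul, toLeftForm_tmul_ι, toLeftForm_tmul_one, map_sub, LinearMap.sub_apply,
      crossMul, TensorProduct.lift.tmul, LinearMap.mk₂_apply, LinearMap.mulLeft_apply,
      LinearMap.mul_apply', mul_one, one_mul, negPos, posNeg, contract_tmul, map_add, map_neg,
      h3, h1, C.form_lie_right, smul_mul_assoc, mul_smul_comm, h2,
      neg_smul, LinearMap.add_apply, LinearMap.neg_apply]
    abel

/-- The subspace `G₋ G₀ ⊕ G₀ ⊕ G₊` of `G₋ U(G₀) ⊕ U(G₀) ⊕ G₊ U(G₀)`. -/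
def linearPart : Submodule 𝕂 C.Loc :=
  (LinearMap.range (tensorEnv (𝕂 := 𝕂) (G₀ := G₀) Gm)).prod
    ((LinearMap.range (ιU : G₀ →ₗ⁅𝕂⁆ Env 𝕂 G₀).toLinearMap).prod
      (LinearMap.range ((TensorProduct.mk 𝕂 Gp (Env 𝕂 G₀)).flip 1)))

lemma mem_linearPart {a : C.Loc} : a ∈ C.linearPart ↔
    ∃ m z y, a = (tensorEnv Gm m, ιU z, y ⊗ₜ[𝕂] (1 : Env 𝕂 G₀)) := by
  constructor
  · rintro ⟨⟨m, hm⟩, ⟨z, hz⟩, ⟨y, hy⟩⟩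
    exact ⟨m, z, y, by ext1; exacts [hm.symm, by ext1; exacts [hz.symm, hy.symm]]⟩
  · rintro ⟨m, z, y, rfl⟩
    exact ⟨⟨m, rfl⟩, ⟨z, rfl⟩, ⟨y, rfl⟩⟩

lemma locBr_linear (m m' : Gm ⊗[𝕂] G₀) (z z' : G₀) (y y' : Gp) :
    C.locBr (tensorEnv Gm m, ιU z, y ⊗ₜ[𝕂] (1 : Env 𝕂 G₀))
      (tensorEnv Gm m', ιU z', y' ⊗ₜ[𝕂] (1 : Env 𝕂 G₀)) =
    (tensorEnv Gm (⁅z, m'⁆ - ⁅z', m⁆), ιU (⁅z, z'⁆ + C.contract m y' + C.contract m' y),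
      (⁅z, y'⁆ - ⁅z', y⁆) ⊗ₜ[𝕂] (1 : Env 𝕂 G₀)) := by
  simp only [locBr, LinearMap.mk₂_apply, commVU_ι_tensorEnv, anticomm_tensorEnv, commVU_ι_tmul_one,
    map_sub, map_add, LieHom.map_lie, LieRing.of_associative_ring_bracket, TensorProduct.sub_tmul]

/-- In degrees `-1`, `0` and `1`, the subalgebra generated by `G₋ G₀` and `G₊` is contained in
`G₋ G₀`, `G₀` and `G₊`, respectively. -/
lemma cartSub_le_linearPart : C.cartSub ≤ C.linearPart := by
  refine sInf_le ⟨?_, ?_, ?_, ?_⟩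
  · intro a ha
    obtain ⟨m, z, y, rfl⟩ := C.mem_linearPart.1 ha
    have h : ((tensorEnv Gm m, ιU z, y ⊗ₜ[𝕂] (1 : Env 𝕂 G₀)) : C.Loc) =
        (tensorEnv Gm m, 0, 0) + (0, ιU z, 0) + (0, 0, y ⊗ₜ[𝕂] (1 : Env 𝕂 G₀)) := by simp
    rw [h]
    refine add_mem (add_mem ?_ ?_) ?_
    · refine Submodule.mem_iSup_of_mem (-1) ⟨C.mem_linearPart.2 ⟨m, 0, 0, by simp⟩, ?_⟩
      simp [locGr]
    · refine Submodule.mem_iSup_of_mem 0 ⟨C.mem_linearPart.2 ⟨0, z, 0, by simp⟩, ?_⟩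
      simp [locGr]
    · refine Submodule.mem_iSup_of_mem 1 ⟨C.mem_linearPart.2 ⟨0, 0, y, by simp⟩, ?_⟩
      simp [locGr]
  · intro a ha b hb
    obtain ⟨m, z, y, rfl⟩ := C.mem_linearPart.1 ha
    obtain ⟨m', z', y', rfl⟩ := C.mem_linearPart.1 hb
    exact C.mem_linearPart.2 ⟨_, _, _, C.locBr_linear m m' z z' y y'⟩
  · exact fun x z => C.mem_linearPart.2 ⟨x ⊗ₜ z, 0, 0, by simp [negZero]⟩
  · exact fun y => C.mem_linearPart.2 ⟨0, 0, y, by simp [pos]⟩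

/-- The elements of degree `-1` that have zero bracket with `G₊`. -/
def radical : Submodule 𝕂 C.Loc :=
  (LinearMap.ker C.contract).map (LinearMap.inl 𝕂 _ _ ∘ₗ tensorEnv Gm)

lemma mem_radical {a : C.Loc} :
    a ∈ C.radical ↔ ∃ m, C.contract m = 0 ∧ (tensorEnv Gm m, 0, 0) = a := Iff.rfl

lemma radical_le_locGr : C.radical ≤ C.locGr (-1) := by
  intro a ha
  obtain ⟨m, -, rfl⟩ := C.mem_radical.1 ha
  simp [locGr]

lemma radical_comap_le_peripheral : C.radical.comap C.cartSub.subtype ≤ C.peripheral := by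
  refine le_sSup ⟨⟨?_, ?_⟩, ?_, ?_⟩
  · rintro ⟨a, ha⟩ ⟨b, hb⟩ hbr
    obtain ⟨m, z, y, rfl⟩ := C.mem_linearPart.1 (C.cartSub_le_linearPart ha)
    obtain ⟨n, hn, rfl⟩ := C.mem_radical.1 hbr
    refine C.mem_radical.2 ⟨⁅z, n⁆, ?_, ?_⟩
    · ext y'
      have := C.lie_contract z n y'
      simpa [hn] using this.symm
    · have := C.locBr_linear m n z 0 y 0
      simp only [hn, map_zero, TensorProduct.zero_tmul, lie_zero, zero_lie, sub_zero,
        LinearMap.zero_apply, add_zero] at this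
      exact this.symm
  · rintro ⟨b, hb⟩ hbr ⟨a, ha⟩
    obtain ⟨m, z, y, rfl⟩ := C.mem_linearPart.1 (C.cartSub_le_linearPart ha)
    obtain ⟨n, hn, rfl⟩ := C.mem_radical.1 hbr
    refine C.mem_radical.2 ⟨-⁅z, n⁆, ?_, ?_⟩
    · ext y'
      have := C.lie_contract z n y'
      simpa [hn] using this.symm
    · have := C.locBr_linear n m 0 z 0 y
      simp only [hn, map_zero, TensorProduct.zero_tmul, lie_zero, zero_lie, sub_zero, zero_sub,
        LinearMap.zero_apply, add_zero] at this
      exact this.symm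
  · exact fun a ha => Submodule.mem_iSup_of_mem (-1) ⟨ha, Submodule.mem_comap.2 (C.radical_le_locGr ha)⟩
  · rw [eq_bot_iff]
    rintro ⟨a, ha⟩ ⟨har, h0⟩
    obtain ⟨n, hn, rfl⟩ := C.mem_radical.1 har
    have h0' : ((tensorEnv Gm n, 0, 0) : C.Loc) ∈ C.locGr 0 := h0
    have : tensorEnv Gm n = 0 := by simpa [locGr] using h0'
    simp [this]

/-- Two products in the cartanification agree if they have the same brackets with `G₊`. -/
lemma prod_eq_prod {x x' : Gm} {z z' : G₀} (h : C.contract (x ⊗ₜ z - x' ⊗ₜ z') = 0) :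
    C.prod x z = C.prod x' z' := by
  have hloc : C.localProd x z = C.localProd x' z' := by
    rw [localProd, localProd, ← sub_eq_zero, ← map_sub, Submodule.mkQ_apply,
      Submodule.Quotient.mk_eq_zero]
    refine C.radical_comap_le_peripheral (C.mem_radical.2 ⟨_, h, ?_⟩)
    simp [negZero]
  unfold prod
  congr 1

end ContragredientLocal

/-! ### The vanishing of `f₀ f - ⟦f₀, f⟧ h` from relations between the generators -/

namespace ContragredientLocal

variable {𝕂 G₀ : Type*} [Field 𝕂] [LieRing G₀] [LieAlgebra 𝕂 G₀]
  {Gm Gp : Type*}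
  [AddCommGroup Gm] [Module 𝕂 Gm] [LieRingModule G₀ Gm] [LieModule 𝕂 G₀ Gm]
  [AddCommGroup Gp] [Module 𝕂 Gp] [LieRingModule G₀ Gp] [LieModule 𝕂 G₀ Gp]
  (C : ContragredientLocal 𝕂 G₀ Gm Gp)

/-- The smallest set that contains `T` and is closed under the action of the elements of `E`. -/
inductive Raised {M : Type*} [Bracket G₀ M] (E : Set G₀) (T : Set M) : M → Prop
  | base {t : M} : t ∈ T → Raised E T t
  | lie {x : G₀} {m : M} : x ∈ E → Raised E T m → Raised E T ⁅x, m⁆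

/-- The linear span of `Raised E T` is closed under the action of `E`. -/
lemma lie_mem_span_raised {M : Type*} [AddCommGroup M] [Module 𝕂 M] [LieRingModule G₀ M]
    [LieModule 𝕂 G₀ M] {E : Set G₀} {T : Set M} {x : G₀} (hx : x ∈ E) {m : M}
    (hm : m ∈ Submodule.span 𝕂 {m | Raised E T m}) :
    ⁅x, m⁆ ∈ Submodule.span 𝕂 {m | Raised E T m} := by
  induction hm using Submodule.span_induction with
  | mem m h => exact Submodule.subset_span (.lie hx h)
  | zero => simp
  | add a b _ _ ha hb => rw [lie_add]; exact add_mem ha hb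
  | smul c a _ ha => rw [lie_smul]; exact Submodule.smul_mem _ c ha

/-- If the span of `T` is closed under a subspace `S` normalised by `E`, then so is the span of
`Raised E T`. -/
lemma lie_mem_span_raised_of_normalised {M : Type*} [AddCommGroup M] [Module 𝕂 M]
    [LieRingModule G₀ M] [LieModule 𝕂 G₀ M] {E : Set G₀} {T : Set M} {S : Submodule 𝕂 G₀}
    (hS : ∀ x ∈ E, ∀ z ∈ S, ⁅x, z⁆ ∈ S) (hT : ∀ z ∈ S, ∀ t ∈ T, ⁅z, t⁆ ∈ Submodule.span 𝕂 T)
    {m : M} (hm : m ∈ Submodule.span 𝕂 {m | Raised E T m}) :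
    ∀ z ∈ S, ⁅z, m⁆ ∈ Submodule.span 𝕂 {m | Raised E T m} := by
  induction hm using Submodule.span_induction with
  | mem m h =>
    induction h with
    | base ht => exact fun z hz => Submodule.span_mono (fun t ht => .base ht) (hT z hz _ ht)
    | @lie x m hx _ ih =>
      intro z hz
      rw [leibniz_lie z x m, ← lie_skew, neg_lie]
      exact add_mem (neg_mem (ih _ (hS x hx z hz))) (lie_mem_span_raised hx (ih z hz))
  | zero => simp
  | add a b _ _ ha hb => intro z hz; rw [lie_add]; exact add_mem (ha z hz) (hb z hz)
  | smul c a _ ha => intro z hz; rw [lie_smul]; exact Submodule.smul_mem _ c (ha z hz)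

/-- If a subspace `W` is closed under `E` and `G₊` is generated by `y₀` under `E`, then the bracket
of `W` and `G₊` vanishes as soon as the bracket of `W` and `y₀` does. -/
lemma contract_eq_zero_of_raised {E : Set G₀} {W : Submodule 𝕂 (Gm ⊗[𝕂] G₀)} {y₀ : Gp}
    (hW : ∀ x ∈ E, ∀ m ∈ W, ⁅x, m⁆ ∈ W) (h0 : ∀ m ∈ W, C.contract m y₀ = 0)
    (hy : Submodule.span 𝕂 {y | Raised E {y₀} y} = ⊤) {m : Gm ⊗[𝕂] G₀} (hm : m ∈ W) :
    C.contract m = 0 := by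
  have key : ∀ y, Raised E {y₀} y → ∀ m ∈ W, C.contract m y = 0 := by
    intro y hy
    induction hy with
    | base h => rw [Set.mem_singleton_iff.1 h]; exact h0
    | @lie x y hx _ ih =>
      intro m hm
      have := C.lie_contract x m y
      rw [ih m hm, lie_zero, ih _ (hW x hx m hm), zero_add] at this
      exact this.symm
  refine LinearMap.ext_on_range (v := fun y : {y | Raised E {y₀} y} => (y : Gp)) ?_ ?_
  · rw [Subtype.range_coe]; exact hy
  · exact fun y => key y y.2 m hm

/-- Relations between elements `e₀`, `f₀`, `h₀`, `e`, `f`, `h` (where `e`, `f`, `h` are the Chevalley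
generators that belong to a node `j` with `B 0 j = B j 0 = -1`), a set `S` and a set `E`.  The set `S`
spans the component of degree one of the positive part of the Kac-Moody algebra, with respect to
a grading for which `e` has degree one, and this component is required to be abelian.  The set `E`
consists of generators of degree zero.  The factor `b` in `f_x` is the `h`-weight of `x`. -/
structure Abelian (e₀ : Gp) (f₀ : Gm) (h₀ e f h : G₀) (E S : Set G₀) : Prop where
  brk_f₀_e₀ : C.brk f₀ e₀ = h₀
  form_f₀_e₀ : C.form f₀ e₀ = -1
  f_e₀ : ⁅f, e₀⁆ = 0
  h_e₀ : ⁅h, e₀⁆ = -e₀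
  h_f₀ : ⁅h, f₀⁆ = f₀
  h₀_f : ⁅h₀, f⁆ = f
  e_f : ⁅e, f⁆ = h
  h_e : ⁅h, e⁆ = (2 : 𝕂) • e
  e_mem : e ∈ S
  x_f₀ : ∀ x ∈ S, ⁅x, f₀⁆ = 0
  h₀_x : ∀ x ∈ S, ⁅h₀, x⁆ = -x
  x_x : ∀ x ∈ S, ∀ x' ∈ S, ⁅x, x'⁆ = 0
  E_e₀ : ∀ x ∈ E, ⁅x, e₀⁆ = 0
  E_f₀ : ∀ x ∈ E, ⁅x, f₀⁆ = 0
  E_x : ∀ x ∈ E, ∀ x' ∈ S, ⁅x, x'⁆ ∈ Submodule.span 𝕂 S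
  f_x : ∀ x ∈ S, x ≠ e → ⁅⁅f, x⁆, e₀⁆ = 0 ∧ ⁅⁅f, x⁆, f₀⁆ = 0 ∧
    (∀ x' ∈ S, ⁅x', ⁅f, x⁆⁆ ∈ Submodule.span 𝕂 S) ∧
    ∃ b : 𝕂, ⁅h, x⁆ = b • x ∧ b • ⁅f, x⁆ = ⁅f, x⁆

/-- The element `f₀ f - ⟦f₀, f⟧ h`, as a tensor. -/
def tensorElt (f₀ : Gm) (f h : G₀) : Gm ⊗[𝕂] G₀ := f₀ ⊗ₜ f + ⁅f, f₀⁆ ⊗ₜ h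

/-- The element `tensorElt f₀ f h`, its images under `S`, and the elements `f₀ z` for `z` in
the span of `S`.  The second and third kinds are the components of degrees `0` and `1` of
the submodule that is generated by `tensorElt f₀ f h` under `S`. -/
def orbit (f₀ : Gm) (f h : G₀) (S : Set G₀) : Set (Gm ⊗[𝕂] G₀) :=
  {t | t = tensorElt f₀ f h ∨ (∃ x ∈ S, t = ⁅x, tensorElt (𝕂 := 𝕂) f₀ f h⁆) ∨
    ∃ z ∈ Submodule.span 𝕂 S, t = f₀ ⊗ₜ z}

namespace Abelian

variable {C} {e₀ : Gp} {f₀ : Gm} {h₀ e f h : G₀} {E S : Set G₀}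

lemma brk_f₀_lie_e₀ (H : C.Abelian e₀ f₀ h₀ e f h E S) {x : G₀} (hx : x ∈ S) :
    C.brk f₀ ⁅x, e₀⁆ = x := by
  have h1 := C.lie_brk x f₀ e₀
  rw [H.brk_f₀_e₀, H.x_f₀ x hx, map_zero, LinearMap.zero_apply, zero_add, ← lie_skew,
    H.h₀_x x hx, neg_neg] at h1
  exact h1.symm

lemma form_f₀_lie_e₀ (H : C.Abelian e₀ f₀ h₀ e f h E S) {x : G₀} (hx : x ∈ S) :
    C.form f₀ ⁅x, e₀⁆ = 0 := by
  rw [C.form_lie_right, H.x_f₀ x hx, map_zero, LinearMap.zero_apply, neg_zero]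

lemma form_f_f₀ (y : Gp) : C.form ⁅f, f₀⁆ y = -C.form f₀ ⁅f, y⁆ := by
  rw [C.form_lie_right, neg_neg]

lemma brk_f_f₀ (y : Gp) : C.brk ⁅f, f₀⁆ y = ⁅f, C.brk f₀ y⁆ - C.brk f₀ ⁅f, y⁆ := by
  rw [C.lie_brk, add_sub_cancel_right]

/-- The images of `tensorElt f₀ f h` under an element other than `e`. -/
lemma lie_tensorElt (H : C.Abelian e₀ f₀ h₀ e f h E S) {x : G₀} (hx : x ∈ S) (hxe : x ≠ e) :
    ∃ b : 𝕂, b • ⁅f, x⁆ = ⁅f, x⁆ ∧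
      ⁅x, tensorElt (𝕂 := 𝕂) f₀ f h⁆ = -(f₀ ⊗ₜ[𝕂] ⁅f, x⁆) - b • ⁅f, f₀⁆ ⊗ₜ[𝕂] x := by
  obtain ⟨-, h2, -, b, hb, hb'⟩ := H.f_x x hx hxe
  refine ⟨b, hb', ?_⟩
  have h3 : ⁅x, ⁅f, f₀⁆⁆ = 0 := by
    rw [leibniz_lie, H.x_f₀ x hx, lie_zero, add_zero, ← lie_skew, neg_lie, h2, neg_zero]
  rw [tensorElt, lie_add, TensorProduct.LieModule.lie_tmul_right,
    TensorProduct.LieModule.lie_tmul_right, H.x_f₀ x hx, h3, ← lie_skew x f, ← lie_skew x h, hb]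
  simp [TensorProduct.tmul_neg, ← sub_eq_add_neg, -lie_skew]

lemma lie_e_f_f₀ (H : C.Abelian e₀ f₀ h₀ e f h E S) : ⁅e, ⁅f, f₀⁆⁆ = f₀ := by
  rw [leibniz_lie, H.x_f₀ e H.e_mem, lie_zero, add_zero, H.e_f, H.h_f₀]

lemma lie_e_tensorElt (H : C.Abelian e₀ f₀ h₀ e f h E S) : ⁅e, tensorElt (𝕂 := 𝕂) f₀ f h⁆ =
    (2 : 𝕂) • (f₀ ⊗ₜ[𝕂] h - ⁅f, f₀⁆ ⊗ₜ[𝕂] e) := by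
  rw [tensorElt, lie_add, TensorProduct.LieModule.lie_tmul_right,
    TensorProduct.LieModule.lie_tmul_right, H.x_f₀ e H.e_mem, H.lie_e_f_f₀, H.e_f,
    ← lie_skew e h, H.h_e, TensorProduct.tmul_neg, TensorProduct.tmul_smul]
  simp only [TensorProduct.zero_tmul, two_smul]
  abel

lemma contract_tensorElt (H : C.Abelian e₀ f₀ h₀ e f h E S) :
    C.contract (tensorElt f₀ f h) e₀ = 0 := by
  simp only [tensorElt, map_add, LinearMap.add_apply, contract_tmul, H.form_f₀_e₀, H.f_e₀, map_zero,
    form_f_f₀, brk_f_f₀, H.h_e₀, H.brk_f₀_e₀, map_neg, ← lie_skew f h₀, H.h₀_f]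
  simp

lemma contract_lie_tensorElt (H : C.Abelian e₀ f₀ h₀ e f h E S) {x : G₀} (hx : x ∈ S) :
    C.contract ⁅x, tensorElt (𝕂 := 𝕂) f₀ f h⁆ e₀ = 0 := by
  by_cases hxe : x = e
  · subst hxe
    have h1 : ⁅f, ⁅x, e₀⁆⁆ = e₀ := by
      rw [leibniz_lie, H.f_e₀, lie_zero, add_zero, ← lie_skew, H.e_f, neg_lie, H.h_e₀, neg_neg]
    rw [H.lie_e_tensorElt]
    simp only [map_smul, map_sub, LinearMap.smul_apply, LinearMap.sub_apply, contract_tmul,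
      form_f_f₀, brk_f_f₀, H.f_e₀, h1, H.h_e₀, H.brk_f₀_e₀, H.form_f₀_e₀, map_neg,
      H.brk_f₀_lie_e₀ hx, ← lie_skew f x, H.e_f]
    simp
    right; abel
  · obtain ⟨b, hb, h1⟩ := H.lie_tensorElt hx hxe
    have h2 : ⁅f, ⁅x, e₀⁆⁆ = 0 := by
      rw [leibniz_lie, H.f_e₀, lie_zero, add_zero, (H.f_x x hx hxe).1]
    rw [h1]
    simp only [map_smul, map_sub, map_neg, LinearMap.smul_apply, LinearMap.sub_apply,
      LinearMap.neg_apply, contract_tmul, form_f_f₀, brk_f_f₀, H.f_e₀, h2, H.form_f₀_e₀,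
      H.brk_f₀_lie_e₀ hx, (H.f_x x hx hxe).1]
    simp [hb, -lie_skew]

lemma contract_f₀_tmul (H : C.Abelian e₀ f₀ h₀ e f h E S) {z : G₀}
    (hz : z ∈ Submodule.span 𝕂 S) : C.contract (f₀ ⊗ₜ z) e₀ = 0 := by
  induction hz using Submodule.span_induction with
  | mem x hx => simp [H.form_f₀_e₀, H.brk_f₀_lie_e₀ hx, H.form_f₀_lie_e₀ hx]
  | zero => simp
  | add a b _ _ ha hb =>
    rw [TensorProduct.tmul_add, map_add, LinearMap.add_apply, ha, hb, add_zero]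
  | smul c a _ ha => rw [TensorProduct.tmul_smul, map_smul, LinearMap.smul_apply, ha, smul_zero]

lemma contract_orbit (H : C.Abelian e₀ f₀ h₀ e f h E S) {t : Gm ⊗[𝕂] G₀}
    (ht : t ∈ orbit f₀ f h S) : C.contract t e₀ = 0 := by
  obtain rfl | ⟨x, hx, rfl⟩ | ⟨z, hz, rfl⟩ := ht
  exacts [H.contract_tensorElt, H.contract_lie_tensorElt hx, H.contract_f₀_tmul hz]

/-- The second image of `tensorElt f₀ f h` under `S` is of the form `f₀ z`. -/
lemma lie_lie_tensorElt (H : C.Abelian e₀ f₀ h₀ e f h E S) {x x' : G₀} (hx : x ∈ S)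
    (hx' : x' ∈ S) : ∃ z ∈ Submodule.span 𝕂 S, ⁅x', ⁅x, tensorElt (𝕂 := 𝕂) f₀ f h⁆⁆ = f₀ ⊗ₜ z := by
  have hv : ∃ c : 𝕂, ⁅x', ⁅f, f₀⁆⁆ = c • f₀ := by
    by_cases hxe : x' = e
    · exact ⟨1, by rw [hxe, H.lie_e_f_f₀, one_smul]⟩
    · refine ⟨0, ?_⟩
      rw [leibniz_lie, H.x_f₀ x' hx', lie_zero, add_zero, ← lie_skew, neg_lie,
        (H.f_x x' hx' hxe).2.1, neg_zero, zero_smul]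
  have hh : ⁅x', h⁆ ∈ Submodule.span 𝕂 S := by
    by_cases hxe : x' = e
    · rw [hxe, ← lie_skew, H.h_e]
      exact neg_mem (Submodule.smul_mem _ _ (Submodule.subset_span H.e_mem))
    · obtain ⟨-, -, -, b, hb, -⟩ := H.f_x x' hx' hxe
      rw [← lie_skew, hb]
      exact neg_mem (Submodule.smul_mem _ _ (Submodule.subset_span hx'))
  obtain ⟨c, hc⟩ := hv
  by_cases hxe : x = e
  · subst hxe
    refine ⟨(2 : 𝕂) • (⁅x', h⁆ - c • x), Submodule.smul_mem _ _ (sub_mem hh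
      (Submodule.smul_mem _ _ (Submodule.subset_span hx))), ?_⟩
    rw [H.lie_e_tensorElt, lie_smul, lie_sub, TensorProduct.LieModule.lie_tmul_right,
      TensorProduct.LieModule.lie_tmul_right, hc, H.x_f₀ x' hx', H.x_x x' hx' x hx,
      TensorProduct.tmul_smul, TensorProduct.tmul_sub, TensorProduct.tmul_smul,
      TensorProduct.smul_tmul']
    simp
  · obtain ⟨b, -, hb⟩ := H.lie_tensorElt hx hxe
    refine ⟨-⁅x', ⁅f, x⁆⁆ - (b * c) • x, sub_mem (neg_mem ((H.f_x x hx hxe).2.2.1 x' hx'))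
      (Submodule.smul_mem _ _ (Submodule.subset_span hx)), ?_⟩
    rw [hb, lie_sub, lie_neg, lie_smul, TensorProduct.LieModule.lie_tmul_right,
      TensorProduct.LieModule.lie_tmul_right, hc, H.x_f₀ x' hx', H.x_x x' hx' x hx,
      TensorProduct.tmul_sub, TensorProduct.tmul_smul, TensorProduct.tmul_neg, mul_smul,
      TensorProduct.smul_tmul']
    simp

lemma lie_mem_span_orbit (H : C.Abelian e₀ f₀ h₀ e f h E S) {x : G₀}
    (hx : x ∈ Submodule.span 𝕂 S) {t : Gm ⊗[𝕂] G₀} (ht : t ∈ orbit f₀ f h S) :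
    ⁅x, t⁆ ∈ Submodule.span 𝕂 (orbit (𝕂 := 𝕂) f₀ f h S) := by
  induction hx using Submodule.span_induction with
  | mem x hx =>
    obtain rfl | ⟨x', hx', rfl⟩ | ⟨z, hz, rfl⟩ := ht
    · exact Submodule.subset_span (Or.inr (Or.inl ⟨x, hx, rfl⟩))
    · exact Submodule.subset_span (Or.inr (Or.inr (H.lie_lie_tensorElt hx' hx)))
    · have hxz : ⁅x, z⁆ = 0 := by
        induction hz using Submodule.span_induction with
        | mem x' hx' => exact H.x_x x hx x' hx'
        | zero => simp
        | add a b _ _ ha hb => rw [lie_add, ha, hb, add_zero]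
        | smul c a _ ha => rw [lie_smul, ha, smul_zero]
      rw [TensorProduct.LieModule.lie_tmul_right, H.x_f₀ x hx, hxz]
      simp
  | zero => simp
  | add a b _ _ ha hb => rw [add_lie]; exact add_mem ha hb
  | smul c a _ ha => rw [smul_lie]; exact Submodule.smul_mem _ c ha

lemma E_span (H : C.Abelian e₀ f₀ h₀ e f h E S) : ∀ x ∈ E, ∀ z ∈ Submodule.span 𝕂 S,
    ⁅x, z⁆ ∈ Submodule.span 𝕂 S := by
  intro x hx z hz
  induction hz using Submodule.span_induction with
  | mem x' hx' => exact H.E_x x hx x' hx'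
  | zero => simp
  | add a b _ _ ha hb => rw [lie_add]; exact add_mem ha hb
  | smul c a _ ha => rw [lie_smul]; exact Submodule.smul_mem _ c ha

/-- If `G₊` is generated by `e₀` under `E ∪ S`, then the bracket of `f₀ f - ⟦f₀, f⟧ h` and `G₊`
vanishes. -/
lemma contract_tensorElt_eq_zero (H : C.Abelian e₀ f₀ h₀ e f h E S)
    (hy : Submodule.span 𝕂 {y | Raised (E ∪ S) {e₀} y} = ⊤) :
    C.contract (tensorElt f₀ f h) = 0 := by
  refine C.contract_eq_zero_of_raised (E := E ∪ S) (y₀ := e₀)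
    (W := Submodule.span 𝕂 {m | Raised E (orbit f₀ f h S) m}) ?_ ?_ hy
    (Submodule.subset_span (Raised.base (Or.inl rfl)))
  · rintro x (hx | hx) m hm
    · exact lie_mem_span_raised hx hm
    · exact lie_mem_span_raised_of_normalised H.E_span
        (fun z hz t ht => H.lie_mem_span_orbit hz ht) hm x (Submodule.subset_span hx)
  · intro m hm
    induction hm using Submodule.span_induction with
    | mem m h =>
      induction h with
      | base ht => exact H.contract_orbit ht
      | @lie x m hx _ ih =>
        have := C.lie_contract x m e₀
        rw [ih, H.E_e₀ x hx, map_zero, add_zero, lie_zero] at this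
        exact this.symm
    | zero => simp
    | add a b _ _ ha hb => rw [map_add, LinearMap.add_apply, ha, hb, add_zero]
    | smul c a _ ha => rw [map_smul, LinearMap.smul_apply, ha, smul_zero]

end Abelian

end ContragredientLocal

/-! ### Graded ideals of free nonassociative algebras -/

section FreeGrading

variable {𝕂 : Type*} [Field 𝕂] {X : Type*}

lemma mul_mem_freeGr {d : X → ℤ} {m n : ℤ} {x y : FreeNA 𝕂 X} (hx : x ∈ freeGr 𝕂 d m)
    (hy : y ∈ freeGr 𝕂 d n) : x * y ∈ freeGr 𝕂 d (m + n) := by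
  refine Submodule.span_induction₂ (p := fun x y _ _ => x * y ∈ freeGr 𝕂 d (m + n))
    ?_ ?_ ?_ ?_ ?_ ?_ ?_ hx hy
  · rintro _ _ ⟨a, rfl, rfl⟩ ⟨b, rfl, rfl⟩
    rw [MinSuper.mon_mul]
    exact Submodule.subset_span ⟨_, rfl, rfl⟩
  · intro y _; rw [zero_mul]; exact zero_mem _
  · intro x _; rw [mul_zero]; exact zero_mem _
  · intro x y z _ _ _ hx hy; rw [add_mul]; exact add_mem hx hy
  · intro x y z _ _ _ hx hy; rw [mul_add]; exact add_mem hx hy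
  · intro c x y _ _ h; rw [smul_mul_assoc]; exact Submodule.smul_mem _ c h
  · intro c x y _ _ h; rw [mul_smul_comm]; exact Submodule.smul_mem _ c h

lemma mon_mem_freeGr (d : X → ℤ) (m : FreeMagma X) : mon 𝕂 m ∈ freeGr 𝕂 d (wordDeg d m) :=
  Submodule.subset_span ⟨m, rfl, rfl⟩

lemma span_mon : Submodule.span 𝕂 (Set.range (mon 𝕂 (X := X))) = ⊤ := by
  rw [← Submodule.ker_mkQ (Submodule.span 𝕂 (Set.range (mon 𝕂 (X := X)))), LinearMap.ker_eq_top]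
  refine Contragredient.freeNA_ext fun m => ?_
  rw [LinearMap.zero_apply, Submodule.mkQ_apply, Submodule.Quotient.mk_eq_zero]
  exact Submodule.subset_span ⟨m, rfl⟩

lemma freeNA_induction {P : FreeNA 𝕂 X → Prop} (h0 : P 0) (hadd : ∀ x y, P x → P y → P (x + y))
    (hsmul : ∀ (c : 𝕂) x, P x → P (c • x)) (hmon : ∀ m, P (mon 𝕂 m)) (x : FreeNA 𝕂 X) : P x := by
  have hx : x ∈ Submodule.span 𝕂 (Set.range (mon 𝕂 (X := X))) := by rw [span_mon]; trivial
  induction hx using Submodule.span_induction with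
  | mem x h => obtain ⟨m, rfl⟩ := h; exact hmon m
  | zero => exact h0
  | add x y _ _ hx hy => exact hadd x y hx hy
  | smul c x _ hx => exact hsmul c x hx

variable (𝕂) in
/-- The projection of the free nonassociative algebra onto its component of degree `k`. -/
def degProj (d : X → ℤ) (k : ℤ) : FreeNA 𝕂 X →ₗ[𝕂] FreeNA 𝕂 X :=
  (Finsupp.linearCombination 𝕂 fun m => if wordDeg d m = k then mon 𝕂 m else 0) ∘ₗ
    (MonoidAlgebra.coeffLinearEquiv 𝕂).toLinearMap

lemma degProj_mon (d : X → ℤ) (k : ℤ) (m : FreeMagma X) :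
    degProj 𝕂 d k (mon 𝕂 m) = if wordDeg d m = k then mon 𝕂 m else 0 := by
  simp [degProj, mon]

lemma degProj_of_mem {d : X → ℤ} {k n : ℤ} {x : FreeNA 𝕂 X} (hx : x ∈ freeGr 𝕂 d n) :
    degProj 𝕂 d k x = if n = k then x else 0 := by
  induction hx using Submodule.span_induction with
  | mem x h => obtain ⟨m, rfl, rfl⟩ := h; exact degProj_mon d k m
  | zero => simp
  | add x y _ _ hx hy => rw [map_add, hx, hy]; split_ifs <;> simp
  | smul c x _ hx => rw [map_smul, hx]; split_ifs <;> simp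

lemma degProj_mem {d : X → ℤ} {N : Submodule 𝕂 (FreeNA 𝕂 X)} (hN : IsGradedFor (freeGr 𝕂 d) N)
    (k : ℤ) {x : FreeNA 𝕂 X} (hx : x ∈ N) : degProj 𝕂 d k x ∈ N ⊓ freeGr 𝕂 d k := by
  have : (⨆ n, N ⊓ freeGr 𝕂 d n) ≤ (N ⊓ freeGr 𝕂 d k).comap (degProj 𝕂 d k) := by
    refine iSup_le fun n y hy => ?_
    rw [Submodule.mem_comap, degProj_of_mem hy.2]
    split_ifs with h
    · subst h; exact hy
    · exact zero_mem _
  exact this (hN hx)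

lemma isGradedFor_sSup {V : Type*} [AddCommGroup V] [Module 𝕂 V] {gr : ℤ → Submodule 𝕂 V}
    {s : Set (Submodule 𝕂 V)} (hs : ∀ N ∈ s, IsGradedFor gr N) : IsGradedFor gr (sSup s) :=
  sSup_le fun N hN => (hs N hN).trans (iSup_mono fun _ => inf_le_inf_right _ (le_sSup hN))

lemma isGradedFor_sup {V : Type*} [AddCommGroup V] [Module 𝕂 V] {gr : ℤ → Submodule 𝕂 V}
    {M N : Submodule 𝕂 V} (hM : IsGradedFor gr M) (hN : IsGradedFor gr N) :
    IsGradedFor gr (M ⊔ N) := by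
  rw [← sSup_pair]
  refine isGradedFor_sSup ?_
  rintro P (rfl | rfl) <;> assumption

variable {p d : X → ℤ} {R : Set (FreeNA 𝕂 X)}

lemma skew_mem_superIdeal (a b : FreeMagma X) :
    mon 𝕂 a * mon 𝕂 b + ksgn 𝕂 (wordDeg p a) (wordDeg p b) • (mon 𝕂 b * mon 𝕂 a) ∈
      superIdeal p R :=
  (Submodule.mem_sInf).2 fun _ hN => hN.2.1 a b

lemma jacobi_mem_superIdeal (a b c : FreeMagma X) :
    mon 𝕂 a * (mon 𝕂 b * mon 𝕂 c) - (mon 𝕂 a * mon 𝕂 b) * mon 𝕂 c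
      - ksgn 𝕂 (wordDeg p a) (wordDeg p b) • (mon 𝕂 b * (mon 𝕂 a * mon 𝕂 c)) ∈ superIdeal p R :=
  (Submodule.mem_sInf).2 fun _ hN => hN.2.2.1 a b c

lemma rel_mem_superIdeal {r : FreeNA 𝕂 X} (hr : r ∈ R) : r ∈ superIdeal p R :=
  (Submodule.mem_sInf).2 fun _ hN => hN.2.2.2 hr

/-- An ideal that is generated by homogeneous relations is graded. -/
lemma isGradedFor_superIdeal (hR : ∀ r ∈ R, ∃ k, r ∈ freeGr 𝕂 d k) :
    IsGradedFor (freeGr 𝕂 d) (superIdeal p R) := by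
  have hle (k : ℤ) : superIdeal p R ⊓ freeGr 𝕂 d k ≤ ⨆ k, superIdeal p R ⊓ freeGr 𝕂 d k :=
    le_iSup (fun k => superIdeal p R ⊓ freeGr 𝕂 d k) k
  refine sInf_le ⟨⟨fun x n hn => ?_, fun n hn x => ?_⟩, fun a b => ?_, fun a b c => ?_, ?_⟩
  · induction x using freeNA_induction with
    | h0 => simp
    | hadd x y hx hy => rw [map_add, LinearMap.add_apply]; exact add_mem hx hy
    | hsmul c x hx => rw [map_smul, LinearMap.smul_apply]; exact Submodule.smul_mem _ c hx
    | hmon m =>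
      induction hn using Submodule.iSup_induction' with
      | mem k n hn =>
        exact hle _ ⟨(isIdealFor_superIdeal p R).left _ _ hn.1,
          mul_mem_freeGr (mon_mem_freeGr d m) hn.2⟩
      | zero => simp
      | add x y _ _ hx hy => rw [map_add]; exact add_mem hx hy
  · induction x using freeNA_induction with
    | h0 => simp
    | hadd x y hx hy => rw [map_add]; exact add_mem hx hy
    | hsmul c x hx => rw [map_smul]; exact Submodule.smul_mem _ c hx
    | hmon m =>
      induction hn using Submodule.iSup_induction' with
      | mem k n hn =>
        exact hle _ ⟨(isIdealFor_superIdeal p R).right _ hn.1 _,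
          mul_mem_freeGr hn.2 (mon_mem_freeGr d m)⟩
      | zero => simp
      | add x y _ _ hx hy => rw [map_add, LinearMap.add_apply]; exact add_mem hx hy
  · refine hle _ ⟨skew_mem_superIdeal a b, add_mem
      (mul_mem_freeGr (mon_mem_freeGr d a) (mon_mem_freeGr d b)) (Submodule.smul_mem _ _ ?_)⟩
    rw [add_comm]
    exact mul_mem_freeGr (mon_mem_freeGr d b) (mon_mem_freeGr d a)
  · refine hle _ ⟨jacobi_mem_superIdeal a b c, sub_mem (sub_mem (mul_mem_freeGr
      (mon_mem_freeGr d a) (mul_mem_freeGr (mon_mem_freeGr d b) (mon_mem_freeGr d c))) ?_)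
      (Submodule.smul_mem _ _ ?_)⟩
    · rw [← add_assoc]
      exact mul_mem_freeGr (mul_mem_freeGr (mon_mem_freeGr d a) (mon_mem_freeGr d b))
        (mon_mem_freeGr d c)
    · rw [add_left_comm]
      exact mul_mem_freeGr (mon_mem_freeGr d b)
        (mul_mem_freeGr (mon_mem_freeGr d a) (mon_mem_freeGr d c))
  · intro r hr
    obtain ⟨k, hk⟩ := hR r hr
    exact hle k ⟨rel_mem_superIdeal hr, hk⟩

lemma isGradedFor_minIdeal (hR : ∀ r ∈ R, ∃ k, r ∈ freeGr 𝕂 d k) :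
    IsGradedFor (freeGr 𝕂 d) (minIdeal p d R) :=
  isGradedFor_sup (isGradedFor_superIdeal hR) (isGradedFor_sSup fun _ hN => hN.2.2.1)

/-- In the degrees `-1`, `0` and `1`, nothing is factored out in addition to the relations. -/
lemma degProj_mem_superIdeal (hR : ∀ r ∈ R, ∃ k, r ∈ freeGr 𝕂 d k) {k : ℤ}
    (hk : k ∈ ({-1, 0, 1} : Set ℤ)) {x : FreeNA 𝕂 X} (hx : x ∈ minIdeal p d R) :
    degProj 𝕂 d k x ∈ superIdeal p R := by
  have : minIdeal p d R ≤ (superIdeal p R).comap (degProj 𝕂 d k) :=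
    sup_le (fun x hx => (degProj_mem (isGradedFor_superIdeal hR) k hx).1)
      (sSup_le fun N hN x hx => hN.2.2.2 k hk (degProj_mem hN.2.2.1 k hx))
  exact this hx

/-- A set of homogeneous elements of degrees other than `-1`, `0` and `1` that spans an ideal modulo
`minIdeal` is contained in `minIdeal`. -/
lemma subset_minIdeal (hR : ∀ r ∈ R, ∃ k, r ∈ freeGr 𝕂 d k) {S : Set (FreeNA 𝕂 X)}
    (hS : ∀ x ∈ S, ∃ k ∉ ({-1, 0, 1} : Set ℤ), x ∈ freeGr 𝕂 d k)
    (hI : IsIdealFor (LinearMap.mul 𝕂 (FreeNA 𝕂 X)) (minIdeal p d R ⊔ Submodule.span 𝕂 S)) :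
    S ⊆ minIdeal p d R := by
  have hSgr : IsGradedFor (freeGr 𝕂 d) (Submodule.span 𝕂 S) := by
    refine Submodule.span_le.2 fun x hx => ?_
    obtain ⟨k, -, hk⟩ := hS x hx
    exact Submodule.mem_iSup_of_mem k ⟨Submodule.subset_span hx, hk⟩
  have hle : minIdeal p d R ⊔ Submodule.span 𝕂 S ≤ minIdeal p d R := by
    refine le_sup_of_le_right (le_sSup ⟨hI, le_sup_of_le_left le_sup_left,
      isGradedFor_sup (isGradedFor_minIdeal hR) hSgr, fun k hk => ?_⟩)
    rintro x ⟨hx, hxk⟩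
    have h1 : minIdeal p d R ⊔ Submodule.span 𝕂 S ≤
        (superIdeal p R).comap (degProj 𝕂 d k) := by
      refine sup_le (fun x hx => degProj_mem_superIdeal hR hk hx) (Submodule.span_le.2 ?_)
      intro x hx
      obtain ⟨n, hn, hxn⟩ := hS x hx
      rw [SetLike.mem_coe, Submodule.mem_comap, degProj_of_mem hxn,
        if_neg (by rintro rfl; exact hn hk)]
      exact zero_mem _
    have := h1 hx
    rwa [Submodule.mem_comap, degProj_of_mem hxk, if_pos rfl] at this
  exact fun x hx => hle (Submodule.mem_sup_right (Submodule.subset_span hx))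

end FreeGrading

lemma MinSuper.mk_mon_mul {𝕂 X : Type*} [Field 𝕂] {p d : X → ℤ} {R : Set (FreeNA 𝕂 X)}
    (a b : FreeMagma X) : mk p d R (mon 𝕂 (.mul a b)) =
      br (mk p d R (mon 𝕂 a)) (mk p d R (mon 𝕂 b)) := by
  rw [br_mk, mon_mul]

namespace Contragredient

open MinSuper

variable {𝕂 : Type*} [Field 𝕂] {ι : Type*}

/-- The elements obtained from `u` by iterated multiplication from the left by the generators `e i`
and `h i`. -/
inductive BorelWord (u : FreeNA 𝕂 (ChevGen ι)) : FreeNA 𝕂 (ChevGen ι) → Prop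
  | base : BorelWord u u
  | e (i : ι) {v : FreeNA 𝕂 (ChevGen ι)} : BorelWord u v → BorelWord u (mon 𝕂 (.of (.e i)) * v)
  | h (i : ι) {v : FreeNA 𝕂 (ChevGen ι)} : BorelWord u v → BorelWord u (mon 𝕂 (.of (.h i)) * v)

lemma BorelWord.exists_mem_freeGr (c' : ι → ℤ) {u v : FreeNA 𝕂 (ChevGen ι)} (hv : BorelWord u v)
    {n : ℤ} (hu : u ∈ freeGr 𝕂 (ChevGen.deg c') n) :
    ∃ k, v ∈ freeGr 𝕂 (ChevGen.deg c') k ∧ ((∀ i, 0 ≤ c' i) → n ≤ k) := by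
  induction hv with
  | base => exact ⟨n, hu, fun _ => le_rfl⟩
  | e i _ ih =>
    obtain ⟨k, hk, hk'⟩ := ih
    refine ⟨_, mul_mem_freeGr (mon_mem_freeGr (ChevGen.deg c') (.of (.e i))) hk, fun h => ?_⟩
    have := hk' h
    have := h i
    simp only [wordDeg, ChevGen.deg]
    lia
  | h i _ ih =>
    obtain ⟨k, hk, hk'⟩ := ih
    refine ⟨_, mul_mem_freeGr (mon_mem_freeGr (ChevGen.deg c') (.of (.h i))) hk, fun h => ?_⟩
    have := hk' h
    simp only [wordDeg, ChevGen.deg]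
    lia

variable [DecidableEq ι] {B : Matrix ι ι 𝕂} {c : ι → ℤ}

lemma chevRel_homogeneous (c' : ι → ℤ) {r : FreeNA 𝕂 (ChevGen ι)} (hr : ChevRel B r) :
    ∃ k, r ∈ freeGr 𝕂 (ChevGen.deg c') k := by
  have hmon (x : ChevGen ι) : mon 𝕂 (.of x) ∈ freeGr 𝕂 (ChevGen.deg c') (ChevGen.deg c' x) :=
    mon_mem_freeGr (ChevGen.deg c') (.of x)
  cases hr with
  | he i j =>
    have h1 := mul_mem_freeGr (hmon (.h i)) (hmon (.e j))
    refine ⟨_, sub_mem h1 (Submodule.smul_mem _ _ ?_)⟩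
    simpa [ChevGen.deg] using hmon (.e j)
  | hf i j =>
    have h1 := mul_mem_freeGr (hmon (.h i)) (hmon (.f j))
    refine ⟨_, sub_mem h1 (Submodule.smul_mem _ _ ?_)⟩
    simpa [ChevGen.deg] using hmon (.f j)
  | ef i j =>
    have h1 := mul_mem_freeGr (hmon (.e i)) (hmon (.f j))
    refine ⟨_, sub_mem h1 ?_⟩
    split_ifs with hij
    · subst hij
      refine Submodule.smul_mem _ _ ?_
      simpa [ChevGen.deg] using hmon (.h i)
    · rw [zero_smul]; exact zero_mem _

lemma br_f_e (i j : ι) : ∃ t : 𝕂, br (f B c i) (e B c j) = (if j = i then t else 0) • h B c i := by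
  refine ⟨-ksgn 𝕂 (-c i) (c j), ?_⟩
  rw [br_skew (f_mem i) (e_mem j), br_e_f]
  split_ifs <;> simp

lemma br_f_h (i j : ι) : br (f B c i) (h B c j) = B j i • f B c i := by
  rw [br_skew (f_mem i) (h_mem j), ksgn_comm, ksgn_zero_left, one_smul, br_h_f]
  simp

/-- An element of degree at least two that commutes with all `f i` is zero: the ideal that it
generates is spanned by its images under the `e i` and `h i`, and thus does not intersect the local
part. -/
lemma mk_eq_zero_of_br_f {u : FreeNA 𝕂 (ChevGen ι)} {n r : ℤ}
    (hu : u ∈ freeGr 𝕂 (ChevGen.deg fun _ => 1) n) (hn : 2 ≤ n)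
    (hur : u ∈ freeGr 𝕂 (ChevGen.deg c) r)
    (hf : ∀ i, br (f B c i) (mk (ChevGen.deg c) (ChevGen.deg fun _ => 1) {r | ChevRel B r} u) = 0) :
    mk (ChevGen.deg c) (ChevGen.deg fun _ => 1) {r | ChevRel B r} u = 0 := by
  set M := mk (ChevGen.deg c) (ChevGen.deg fun _ => 1) {r | ChevRel B r} with hM
  have hhom {v} (hv : BorelWord u v) :
      ∃ k, M v ∈ gr (ChevGen.deg c) (ChevGen.deg fun _ => 1) {r | ChevRel B r} k := by
    obtain ⟨k, hk, -⟩ := hv.exists_mem_freeGr c hur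
    exact ⟨k, Submodule.mem_map_of_mem hk⟩
  set P : Submodule 𝕂 (Contragredient B c) := (Submodule.span 𝕂 {v | BorelWord u v}).map M with hP
  have hmem {v} (hv : BorelWord u v) : M v ∈ P :=
    Submodule.mem_map_of_mem (Submodule.subset_span hv)
  have hind {T : Contragredient B c →ₗ[𝕂] Contragredient B c}
      (hT : ∀ v, BorelWord u v → T (M v) ∈ P) : ∀ y ∈ P, T y ∈ P := by
    rintro _ ⟨v, hv, rfl⟩
    have : Submodule.span 𝕂 {v | BorelWord u v} ≤ P.comap (T ∘ₗ M) := Submodule.span_le.2 hT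
    exact this hv
  have he (i : ι) : ∀ y ∈ P, br (e B c i) y ∈ P := hind fun v hv => hmem (.e i hv)
  have hh (i : ι) : ∀ y ∈ P, br (h B c i) y ∈ P := hind fun v hv => hmem (.h i hv)
  have hfP (i : ι) : ∀ y ∈ P, br (f B c i) y ∈ P := by
    refine hind fun v hv => ?_
    induction hv with
    | base => rw [hf]; exact zero_mem _
    | @e k v hv ih =>
      obtain ⟨r, hr⟩ := hhom hv
      obtain ⟨t, ht⟩ := br_f_e (B := B) (c := c) i k
      change br (f B c i) (br (e B c k) (M v)) ∈ P
      rw [br_jacobi (f_mem i) (e_mem k) hr, ht, map_smul, LinearMap.smul_apply]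
      exact add_mem (Submodule.smul_mem _ _ (hh i _ (hmem hv)))
        (Submodule.smul_mem _ _ (he k _ ih))
    | @h k v hv ih =>
      obtain ⟨r, hr⟩ := hhom hv
      change br (f B c i) (br (h B c k) (M v)) ∈ P
      rw [br_jacobi (f_mem i) (h_mem k) hr, br_f_h, map_smul, LinearMap.smul_apply]
      exact add_mem (Submodule.smul_mem _ _ ih) (Submodule.smul_mem _ _ (hh k _ ih))
  have hmon (m : FreeMagma (ChevGen ι)) : ∀ y ∈ P, br (M (mon 𝕂 m)) y ∈ P := by
    induction m using FreeMagma.rec with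
    | of x => cases x with
      | e i => exact he i
      | f i => exact hfP i
      | h i => exact hh i
    | mul a b ha hb =>
      refine hind fun v hv => ?_
      obtain ⟨r, hr⟩ := hhom hv
      have := br_jacobi (mk_mon_mem (d := ChevGen.deg fun _ => 1) a) (mk_mon_mem b) hr
      rw [hM, mk_mon_mul, eq_sub_of_add_eq this.symm]
      exact sub_mem (ha _ (hb _ (hmem hv))) (Submodule.smul_mem _ _ (hb _ (ha _ (hmem hv))))
  have hmon' (m : FreeMagma (ChevGen ι)) : ∀ y ∈ P, br y (M (mon 𝕂 m)) ∈ P := by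
    refine hind (T := br.flip (M (mon 𝕂 m))) fun v hv => ?_
    obtain ⟨r, hr⟩ := hhom hv
    rw [LinearMap.flip_apply, br_skew hr (mk_mon_mem m)]
    exact neg_mem (Submodule.smul_mem _ _ (hmon m _ (hmem hv)))
  have hN (v : FreeNA 𝕂 (ChevGen ι)) : v ∈ minIdeal (ChevGen.deg c) (ChevGen.deg fun _ => 1)
      {r | ChevRel B r} ⊔ Submodule.span 𝕂 {v | BorelWord u v} ↔ M v ∈ P := by
    rw [hP, ← Submodule.mem_comap, Submodule.comap_map_eq, sup_comm]
    have : LinearMap.ker M = minIdeal (ChevGen.deg c) (ChevGen.deg fun _ => 1)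
      {r | ChevRel B r} := Submodule.ker_mkQ _
    rw [this]
  have key := subset_minIdeal (p := ChevGen.deg c) (d := ChevGen.deg fun _ => 1)
    (R := {r | ChevRel B r}) (S := {v | BorelWord u v})
    (fun r hr => chevRel_homogeneous _ hr) ?_ ?_ BorelWord.base
  · exact (Submodule.Quotient.mk_eq_zero _).2 key
  · intro v hv
    obtain ⟨k, hk, hk'⟩ := BorelWord.exists_mem_freeGr _ hv hu
    have := hk' (by simp)
    exact ⟨k, by simp only [Set.mem_insert_iff, Set.mem_singleton_iff]; lia, hk⟩
  · constructor
    · intro x v hv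
      rw [hN] at hv ⊢
      rw [LinearMap.mul_apply', hM, ← br_mk]
      induction x using freeNA_induction with
      | h0 => simp
      | hadd x y hx hy => rw [map_add, map_add, LinearMap.add_apply]; exact add_mem hx hy
      | hsmul t x hx => rw [map_smul, map_smul, LinearMap.smul_apply]; exact P.smul_mem t hx
      | hmon m => exact hmon m _ hv
    · intro v hv x
      rw [hN] at hv ⊢
      rw [LinearMap.mul_apply', hM, ← br_mk]
      induction x using freeNA_induction with
      | h0 => simp
      | hadd x y hx hy => rw [map_add, map_add]; exact add_mem hx hy
      | hsmul t x hx => rw [map_smul, map_smul]; exact P.smul_mem t hx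
      | hmon m => exact hmon' m _ hv

end Contragredient

/-! ### Words in the Chevalley generators and the triangular decomposition -/

section Words

variable {𝕂 : Type*} [Field 𝕂] {κ V W : Type*} [AddCommGroup V] [Module 𝕂 V]
  [AddCommGroup W] [Module 𝕂 W]

lemma map_mem_of_mem_span {T : V →ₗ[𝕂] W} {S : Set V} {N : Submodule 𝕂 W} (h : ∀ x ∈ S, T x ∈ N)
    {x : V} (hx : x ∈ Submodule.span 𝕂 S) : T x ∈ N :=
  Submodule.mem_comap.1 (Submodule.span_le.2 (fun x hx => Submodule.mem_comap.2 (h x hx)) hx)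

/-- The right-normed products `p k₁ (p k₂ (⋯ p kₙ))` with `n ≥ 1`, together with the multiset of their
indices. -/
inductive BrWord (μ : V →ₗ[𝕂] V →ₗ[𝕂] V) (p : κ → V) : Multiset κ → V → Prop
  | gen (k : κ) : BrWord μ p {k} (p k)
  | cons (k : κ) {s : Multiset κ} {x : V} : BrWord μ p s x → BrWord μ p (k ::ₘ s) (μ (p k) x)

namespace BrWord

variable {μ : V →ₗ[𝕂] V →ₗ[𝕂] V} {ν : W →ₗ[𝕂] W →ₗ[𝕂] W} {p : κ → V} {s : Multiset κ}

lemma map {x : V} (hx : BrWord μ p s x) {φ : V →ₗ[𝕂] W} (hφ : ∀ x y, φ (μ x y) = ν (φ x) (φ y)) :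
    BrWord ν (fun k => φ (p k)) s (φ x) := by
  induction hx with
  | gen k => exact .gen k
  | cons k _ ih => rw [hφ]; exact .cons k ih

lemma exists_lift {φ : V →ₗ[𝕂] W} (hφ : ∀ x y, φ (μ x y) = ν (φ x) (φ y)) {y : W}
    (hy : BrWord ν (fun k => φ (p k)) s y) : ∃ x, BrWord μ p s x ∧ φ x = y := by
  induction hy with
  | gen k => exact ⟨_, .gen k, rfl⟩
  | cons k _ ih =>
    obtain ⟨x, hx, rfl⟩ := ih
    exact ⟨_, .cons k hx, hφ _ _⟩

lemma card_pos {x : V} (hx : BrWord μ p s x) : 1 ≤ s.card := by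
  cases hx <;> simp

lemma mem_freeGr {X : Type*} {p : κ → FreeNA 𝕂 X} {d : X → ℤ} {c : κ → ℤ}
    (hp : ∀ k, p k ∈ freeGr 𝕂 d (c k)) {x : FreeNA 𝕂 X}
    (hx : BrWord (LinearMap.mul 𝕂 (FreeNA 𝕂 X)) p s x) : x ∈ freeGr 𝕂 d (s.map c).sum := by
  induction hx with
  | gen k => simpa using hp k
  | cons k _ ih => rw [Multiset.map_cons, Multiset.sum_cons]; exact mul_mem_freeGr (hp k) ih

end BrWord

end Words

open MinSuper

section Super

variable {𝕂 : Type*} [Field 𝕂] {X : Type*} {p d : X → ℤ} {R : Set (FreeNA 𝕂 X)} {κ : Type*}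

namespace BrWord

variable {P : κ → MinSuper p d R} {s t : Multiset κ} {x y : MinSuper p d R}

lemma mem_gr {c : κ → ℤ} (hP : ∀ k, P k ∈ gr p d R (c k)) (hx : BrWord br P s x) :
    x ∈ gr p d R (s.map c).sum := by
  induction hx with
  | gen k => simpa using hP k
  | cons k _ ih => rw [Multiset.map_cons, Multiset.sum_cons]; exact br_mem (hP k) ih

/-- Words are weight vectors. -/
lemma br_weight {c : κ → ℤ} (hP : ∀ k, P k ∈ gr p d R (c k)) {h : MinSuper p d R}
    (hh : h ∈ gr p d R 0) {w : κ → 𝕂} (hw : ∀ k, br h (P k) = w k • P k) (hx : BrWord br P s x) :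
    br h x = (s.map w).sum • x := by
  induction hx with
  | gen k => simpa using hw k
  | cons k hx ih =>
    rw [br_jacobi hh (hP k) (hx.mem_gr hP), hw, ih, ksgn_zero_left]
    simp [add_smul]

/-- The bracket of two words is a combination of words. -/
lemma br_mem_span {c : κ → ℤ} (hP : ∀ k, P k ∈ gr p d R (c k)) (hx : BrWord br P s x)
    (hy : BrWord br P t y) : br x y ∈ Submodule.span 𝕂 {z | BrWord br P (s + t) z} := by
  induction hx generalizing t y with
  | gen k => rw [Multiset.singleton_add]; exact Submodule.subset_span (.cons k hy)
  | @cons k s x hx ih =>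
    have hjac := br_jacobi (hP k) (hx.mem_gr hP) (hy.mem_gr hP)
    rw [eq_sub_of_add_eq hjac.symm]
    refine sub_mem ?_ (Submodule.smul_mem _ _ ?_)
    · refine map_mem_of_mem_span (fun z hz => Submodule.subset_span ?_) (ih hy)
      rw [Multiset.cons_add]
      exact .cons k hz
    · have h := ih (.cons k hy)
      rwa [Multiset.add_cons, ← Multiset.cons_add] at h

end BrWord

/-- Elements `P k`, `Q k`, `H k` that satisfy the Chevalley relations of a matrix `M`, up to
a factor in the bracket of `Q k` and `P k`. -/
structure ChevFamily [DecidableEq κ] (P Q H : κ → MinSuper p d R) (c : κ → ℤ) (M : Matrix κ κ 𝕂)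
    (s : κ → 𝕂) : Prop where
  memP : ∀ k, P k ∈ gr p d R (c k)
  memQ : ∀ k, Q k ∈ gr p d R (-c k)
  memH : ∀ k, H k ∈ gr p d R 0
  hP : ∀ i k, br (H i) (P k) = M i k • P k
  hQ : ∀ i k, br (H i) (Q k) = -M i k • Q k
  qp : ∀ i k, br (Q i) (P k) = (if i = k then s i else 0) • H i
  hh : ∀ i k, br (H i) (H k) = 0

namespace ChevFamily

/-- The words in the `P k`, the words in the `Q k`, and the elements `H k`, of degree `a` with respect
to the grading where `P k` has degree `d' k` and `Q k` has degree `-d' k`. -/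
def triangSet (P Q H : κ → MinSuper p d R) (d' : κ → ℤ) (a : ℤ) : Set (MinSuper p d R) :=
  {x | (∃ t, BrWord br P t x ∧ (t.map d').sum = a) ∨ (∃ t, BrWord br Q t x ∧ -(t.map d').sum = a) ∨
    a = 0 ∧ ∃ i, x = H i}

lemma triangSet_opp (P Q H : κ → MinSuper p d R) (d' : κ → ℤ) (a : ℤ) :
    triangSet Q P H (fun k => -d' k) a = triangSet P Q H d' a := by
  ext x
  have h (t : Multiset κ) : (t.map fun k => -d' k).sum = -(t.map d').sum :=
    Multiset.sum_map_neg
  simp only [triangSet, h, neg_neg, Set.mem_ofPred_eq]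
  exact or_left_comm

variable [DecidableEq κ] {P Q H : κ → MinSuper p d R} {c : κ → ℤ} {M : Matrix κ κ 𝕂} {s : κ → 𝕂}

lemma ph (F : ChevFamily P Q H c M s) (i k : κ) : br (P k) (H i) = -M i k • P k := by
  rw [br_skew (F.memP k) (F.memH i), Contragredient.ksgn_comm, ksgn_zero_left, one_smul, F.hP,
    neg_smul]

/-- The roles of `P` and `Q` can be exchanged. -/
lemma opp (F : ChevFamily P Q H c M s) :
    ChevFamily Q P H (fun k => -c k) (-M) (fun k => -(ksgn 𝕂 (c k) (-c k) * s k)) where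
  memP := F.memQ
  memQ k := by rw [neg_neg]; exact F.memP k
  memH := F.memH
  hP := F.hQ
  hQ i k := by rw [F.hP]; simp
  qp i k := by
    rw [br_skew (F.memP i) (F.memQ k), F.qp]
    by_cases hik : i = k
    · subst hik; simp [smul_smul]
    · simp [hik, Ne.symm hik]
  hh := F.hh

lemma br_H_word (F : ChevFamily P Q H c M s) (i : κ) {t : Multiset κ} {x : MinSuper p d R}
    (hx : BrWord br P t x) : br (H i) x = (t.map (M i)).sum • x :=
  hx.br_weight F.memP (F.memH i) (F.hP i)

/-- The bracket of `Q j` with a word in the `P k` is a combination of words with one factor `P j`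
less. -/
lemma br_Q_word (F : ChevFamily P Q H c M s) (j : κ) {t : Multiset κ} {x : MinSuper p d R}
    (hx : BrWord br P t x) : br (Q j) x ∈ Submodule.span 𝕂
      {y | (∃ t', BrWord br P t' y ∧ t = j ::ₘ t') ∨ (t = {j} ∧ y = H j)} := by
  induction hx with
  | gen k =>
    rw [F.qp]
    split_ifs with hjk
    · subst hjk
      exact Submodule.smul_mem _ _ (Submodule.subset_span (Or.inr ⟨rfl, rfl⟩))
    · rw [zero_smul]; exact zero_mem _
  | @cons k t x hx ih =>
    rw [br_jacobi (F.memQ j) (F.memP k) (hx.mem_gr F.memP), F.qp]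
    refine add_mem ?_ (Submodule.smul_mem _ _ ?_)
    · split_ifs with hjk
      · subst hjk
        rw [map_smul, LinearMap.smul_apply, F.br_H_word j hx]
        exact Submodule.smul_mem _ _ (Submodule.smul_mem _ _
          (Submodule.subset_span (Or.inl ⟨t, hx, rfl⟩)))
      · simp
    · refine map_mem_of_mem_span ?_ ih
      rintro y (⟨t', hy, rfl⟩ | ⟨rfl, rfl⟩)
      · exact Submodule.subset_span (Or.inl ⟨k ::ₘ t', .cons k hy, Multiset.cons_swap _ _ _⟩)
      · rw [F.ph]
        exact Submodule.smul_mem _ _ (Submodule.subset_span (Or.inl ⟨{k}, .gen k, by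
          rw [← Multiset.singleton_add, add_comm, Multiset.singleton_add]⟩))

lemma triangSet_mem_gr (F : ChevFamily P Q H c M s) {d' : κ → ℤ} {a : ℤ} {x : MinSuper p d R}
    (hx : x ∈ triangSet P Q H d' a) : ∃ k, x ∈ gr p d R k := by
  obtain ⟨t, ht, -⟩ | ⟨t, ht, -⟩ | ⟨-, i, rfl⟩ := hx
  exacts [⟨_, ht.mem_gr F.memP⟩, ⟨_, ht.mem_gr F.memQ⟩, ⟨_, F.memH i⟩]

lemma br_P_triangSet (F : ChevFamily P Q H c M s) {d' : κ → ℤ} {a : ℤ} (k : κ)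
    {x : MinSuper p d R} (hx : x ∈ triangSet P Q H d' a) :
    br (P k) x ∈ Submodule.span 𝕂 (triangSet P Q H d' (d' k + a)) := by
  obtain ⟨t, ht, rfl⟩ | ⟨t, ht, rfl⟩ | ⟨rfl, i, rfl⟩ := hx
  · exact Submodule.subset_span (Or.inl ⟨_, .cons k ht, by simp⟩)
  · refine Submodule.span_mono ?_ (F.opp.br_Q_word k ht)
    rintro y (⟨t', hy, rfl⟩ | ⟨rfl, rfl⟩)
    · exact Or.inr (Or.inl ⟨t', hy, by simp⟩)
    · exact Or.inr (Or.inr ⟨by simp, _, rfl⟩)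
  · rw [F.ph]
    exact Submodule.smul_mem _ _ (Submodule.subset_span (Or.inl ⟨_, .gen k, by simp⟩))

lemma br_Q_triangSet (F : ChevFamily P Q H c M s) {d' : κ → ℤ} {a : ℤ} (k : κ)
    {x : MinSuper p d R} (hx : x ∈ triangSet P Q H d' a) :
    br (Q k) x ∈ Submodule.span 𝕂 (triangSet P Q H d' (-d' k + a)) := by
  rw [← triangSet_opp] at hx ⊢
  exact F.opp.br_P_triangSet k hx

lemma br_H_triangSet (F : ChevFamily P Q H c M s) {d' : κ → ℤ} {a : ℤ} (k : κ)
    {x : MinSuper p d R} (hx : x ∈ triangSet P Q H d' a) :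
    br (H k) x ∈ Submodule.span 𝕂 (triangSet P Q H d' a) := by
  have hx' := hx
  obtain ⟨t, ht, rfl⟩ | ⟨t, ht, rfl⟩ | ⟨rfl, i, rfl⟩ := hx
  · rw [F.br_H_word k ht]; exact Submodule.smul_mem _ _ (Submodule.subset_span hx')
  · rw [F.opp.br_H_word k ht]; exact Submodule.smul_mem _ _ (Submodule.subset_span hx')
  · rw [F.hh]; exact zero_mem _

section Hom

variable {φ : FreeNA 𝕂 (ChevGen κ) →ₗ[𝕂] MinSuper p d R}

/-- The homomorphism `φ` maps the Chevalley generators to `P k`, `Q k`, `H k`. -/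
structure IsHom (φ : FreeNA 𝕂 (ChevGen κ) →ₗ[𝕂] MinSuper p d R) (P Q H : κ → MinSuper p d R) :
    Prop where
  mul : ∀ x y, φ (x * y) = br (φ x) (φ y)
  e : ∀ k, φ (mon 𝕂 (.of (.e k))) = P k
  f : ∀ k, φ (mon 𝕂 (.of (.f k))) = Q k
  h : ∀ k, φ (mon 𝕂 (.of (.h k))) = H k

lemma hom_mem_gr (F : ChevFamily P Q H c M s) (hφ : IsHom φ P Q H) (m : FreeMagma (ChevGen κ)) :
    φ (mon 𝕂 m) ∈ gr p d R (wordDeg (ChevGen.deg c) m) := by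
  induction m using FreeMagma.rec with
  | of x => cases x with
    | e k => rw [hφ.e]; exact F.memP k
    | f k => rw [hφ.f]; exact F.memQ k
    | h k => rw [hφ.h]; exact F.memH k
  | mul a b ha hb =>
    rw [← mon_mul (𝕂 := 𝕂) a b, hφ.mul]
    exact br_mem ha hb

/-- The triangular decomposition: the subalgebra generated by the `P k`, `Q k` and `H k` is spanned by
the words in the `P k`, the words in the `Q k`, and the elements `H k`. -/
lemma hom_mem_triang (F : ChevFamily P Q H c M s) (hφ : IsHom φ P Q H) (d' : κ → ℤ)
    (m : FreeMagma (ChevGen κ)) :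
    φ (mon 𝕂 m) ∈ Submodule.span 𝕂 (triangSet P Q H d' (wordDeg (ChevGen.deg d') m)) := by
  have hext {T : MinSuper p d R →ₗ[𝕂] MinSuper p d R} {a b : ℤ}
      (hT : ∀ x ∈ triangSet P Q H d' a, T x ∈ Submodule.span 𝕂 (triangSet P Q H d' b)) :
      ∀ x ∈ Submodule.span 𝕂 (triangSet P Q H d' a),
        T x ∈ Submodule.span 𝕂 (triangSet P Q H d' b) :=
    fun x hx => map_mem_of_mem_span hT hx
  have hact (m : FreeMagma (ChevGen κ)) : ∀ a, ∀ x ∈ Submodule.span 𝕂 (triangSet P Q H d' a),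
      br (φ (mon 𝕂 m)) x ∈
        Submodule.span 𝕂 (triangSet P Q H d' (wordDeg (ChevGen.deg d') m + a)) := by
    induction m using FreeMagma.rec with
    | of x =>
      intro a
      cases x with
      | e k => rw [hφ.e]; exact hext fun x hx => F.br_P_triangSet k hx
      | f k => rw [hφ.f]; exact hext fun x hx => F.br_Q_triangSet k hx
      | h k =>
        rw [hφ.h]
        refine hext fun x hx => ?_
        simp only [wordDeg, ChevGen.deg, zero_add]
        exact F.br_H_triangSet k hx
    | mul u v hu hv =>
      intro a
      refine hext fun x hx => ?_
      obtain ⟨k, hk⟩ := F.triangSet_mem_gr hx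
      have hjac := br_jacobi (F.hom_mem_gr hφ u) (F.hom_mem_gr hφ v) hk
      have hx' := Submodule.subset_span (R := 𝕂) hx
      have huv : φ (mon 𝕂 (u.mul v)) = br (φ (mon 𝕂 u)) (φ (mon 𝕂 v)) := by
        rw [← hφ.mul, mon_mul]
      have h1 := hu _ _ (hv _ _ hx')
      have h2 := hv _ _ (hu _ _ hx')
      rw [← add_assoc] at h1
      rw [← add_assoc, add_comm (wordDeg _ v)] at h2
      change br (φ (mon 𝕂 (u.mul v))) x ∈ _
      rw [huv, eq_sub_of_add_eq hjac.symm]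
      exact sub_mem h1 (Submodule.smul_mem _ _ h2)
  induction m using FreeMagma.rec with
  | of x =>
    refine Submodule.subset_span ?_
    cases x with
    | e k => rw [hφ.e]; exact Or.inl ⟨_, .gen k, by simp [wordDeg, ChevGen.deg]⟩
    | f k => rw [hφ.f]; exact Or.inr (Or.inl ⟨_, .gen k, by simp [wordDeg, ChevGen.deg]⟩)
    | h k => rw [hφ.h]; exact Or.inr (Or.inr ⟨rfl, k, rfl⟩)
  | mul a b _ hb =>
    rw [← mon_mul (𝕂 := 𝕂) a b, hφ.mul]
    exact hact a _ _ hb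

/-- The elements of positive degree are combinations of words in the `P k`. -/
lemma hom_mem_span_word (F : ChevFamily P Q H c M s) (hφ : IsHom φ P Q H) {d' : κ → ℤ}
    (hd : ∀ k, 0 ≤ d' k) {a : ℤ} (ha : 0 < a) {u : FreeNA 𝕂 (ChevGen κ)}
    (hu : u ∈ freeGr 𝕂 (ChevGen.deg d') a) :
    φ u ∈ Submodule.span 𝕂 {x | ∃ t, BrWord br P t x ∧ (t.map d').sum = a} := by
  refine map_mem_of_mem_span ?_ hu
  rintro _ ⟨m, rfl, rfl⟩
  refine Submodule.span_mono ?_ (F.hom_mem_triang hφ d' m)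
  rintro x (h | ⟨t, -, h⟩ | ⟨h, -⟩)
  · exact h
  · have : 0 ≤ (t.map d').sum := Multiset.sum_nonneg (by
      simp only [Multiset.mem_map]; rintro _ ⟨k, -, rfl⟩; exact hd k)
    lia
  · lia

end Hom

end ChevFamily

end Super

/-- The Chevalley generators of a contragredient Lie superalgebra. -/
lemma Contragredient.chevFamily {𝕂 ι : Type*} [Field 𝕂] [DecidableEq ι] (B : Matrix ι ι 𝕂)
    (c : ι → ℤ) : ChevFamily (e B c) (f B c) (h B c) c B (fun k => -ksgn 𝕂 (-c k) (c k)) where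
  memP := e_mem
  memQ := f_mem
  memH := h_mem
  hP := br_h_e
  hQ := br_h_f
  qp i k := by
    rw [br_skew (f_mem i) (e_mem k), br_e_f]
    by_cases hik : i = k
    · subst hik; simp
    · simp [hik, Ne.symm hik]
  hh := br_h_h

/-- A subset of the indices gives a subfamily. -/
lemma ChevFamily.comp {𝕂 : Type*} [Field 𝕂] {X : Type*} {p d : X → ℤ} {R : Set (FreeNA 𝕂 X)}
    {κ κ' : Type*} [DecidableEq κ] [DecidableEq κ'] {P Q H : κ → MinSuper p d R} {c : κ → ℤ}
    {M : Matrix κ κ 𝕂} {s : κ → 𝕂} (F : ChevFamily P Q H c M s) {g : κ' → κ}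
    (hg : Function.Injective g) : ChevFamily (fun k => P (g k)) (fun k => Q (g k))
      (fun k => H (g k)) (fun k => c (g k)) (M.submatrix g g) (fun k => s (g k)) where
  memP _ := F.memP _
  memQ _ := F.memQ _
  memH _ := F.memH _
  hP _ _ := F.hP _ _
  hQ _ _ := F.hQ _ _
  qp i k := by rw [F.qp]; simp [hg.eq_iff]
  hh _ _ := F.hh _ _

/-! ### From the Kac-Moody algebra to the contragredient Lie superalgebra -/

lemma sum_map_eq_sum_count {𝕂 I : Type*} [Field 𝕂] [Fintype I] [DecidableEq I] (s : Multiset I)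
    (w : I → 𝕂) : (s.map w).sum = ∑ k, (s.count k : 𝕂) * w k := by
  induction s using Multiset.induction_on with
  | empty => simp
  | cons a s ih =>
    simp only [Multiset.map_cons, Multiset.sum_cons, ih, Multiset.count_cons, Nat.cast_add, add_mul,
      Finset.sum_add_distrib]
    simp [add_comm]

lemma BrWord.eq_of_singleton {𝕂 κ V : Type*} [Field 𝕂] [AddCommGroup V] [Module 𝕂 V]
    {μ : V →ₗ[𝕂] V →ₗ[𝕂] V} {p : κ → V} {s : Multiset κ} {x : V} (hx : BrWord μ p s x) {k : κ}
    (hs : s = {k}) : x = p k := by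
  cases hx with
  | gen i => rw [Multiset.singleton_inj.1 hs]
  | cons i h =>
    have h1 := h.card_pos
    have h2 := congrArg Multiset.card hs
    simp only [Multiset.card_cons, Multiset.card_singleton] at h2
    lia

/-- An element of a subspace `N` in the span of a subset of `N` is in the span of this subset, taken
inside `N`. -/
lemma mem_span_subtype {𝕂 V : Type*} [Field 𝕂] [AddCommGroup V] [Module 𝕂 V] {N : Submodule 𝕂 V}
    {S : Set V} (hS : S ⊆ N) {y : N} (hy : y.1 ∈ Submodule.span 𝕂 S) :
    y ∈ Submodule.span 𝕂 {x : N | x.1 ∈ S} := by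
  have h : S = N.subtype '' {x : N | x.1 ∈ S} := by
    ext x
    exact ⟨fun hx => ⟨⟨x, hS hx⟩, hx, rfl⟩, by rintro ⟨x, hx, rfl⟩; exact hx⟩
  rw [h, ← Submodule.map_span] at hy
  obtain ⟨z, hz, hzy⟩ := hy
  rwa [← Subtype.ext hzy]

namespace Triple

variable {𝕂 I : Type*} [Field 𝕂]

/-- The inclusion of the generators indexed by `I` into those indexed by `{0} ∪ I`. -/
def genIncl {I : Type*} : ChevGen I → ChevGen (Option I)
  | .e i => .e (some i)
  | .f i => .f (some i)
  | .h i => .h (some i)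

variable (𝕂) in
/-- The homomorphism of free nonassociative algebras induced by `genIncl`. -/
def freeIncl (I : Type*) : FreeNA 𝕂 (ChevGen I) →ₗ[𝕂] FreeNA 𝕂 (ChevGen (Option I)) where
  toFun := FreeNonUnitalNonAssocAlgebra.lift 𝕂 fun x => mon 𝕂 (.of (genIncl x))
  map_add' := map_add _
  map_smul' := map_smul _

lemma freeIncl_mul (u v : FreeNA 𝕂 (ChevGen I)) :
    freeIncl 𝕂 I (u * v) = freeIncl 𝕂 I u * freeIncl 𝕂 I v :=
  map_mul (FreeNonUnitalNonAssocAlgebra.lift 𝕂 fun x => mon 𝕂 (.of (genIncl x))) u v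

lemma freeIncl_of (x : ChevGen I) : freeIncl 𝕂 I (mon 𝕂 (.of x)) = mon 𝕂 (.of (genIncl x)) :=
  FreeNonUnitalNonAssocAlgebra.lift_of_apply 𝕂 (fun x => mon 𝕂 (.of (genIncl x))) x

lemma freeIncl_mem {c : Option I → ℤ} {n : ℤ} {u : FreeNA 𝕂 (ChevGen I)}
    (hu : u ∈ freeGr 𝕂 (ChevGen.deg fun k => c (some k)) n) :
    freeIncl 𝕂 I u ∈ freeGr 𝕂 (ChevGen.deg c) n := by
  refine map_mem_of_mem_span ?_ hu
  rintro _ ⟨m, rfl, rfl⟩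
  clear hu
  have hgen (x : ChevGen I) :
      ChevGen.deg c (genIncl x) = ChevGen.deg (fun k => c (some k)) x := by
    cases x <;> rfl
  induction m using FreeMagma.rec with
  | of x =>
    rw [freeIncl_of]
    exact Submodule.subset_span ⟨.of (genIncl x), hgen x, rfl⟩
  | mul a b ha hb =>
    have h := mul_mem_freeGr ha hb
    rw [← freeIncl_mul, mon_mul] at h
    exact h

lemma wordDeg_zero (m : FreeMagma (ChevGen I)) : wordDeg (ChevGen.deg fun _ => 0) m = 0 := by
  induction m using FreeMagma.rec with
  | of x => cases x <;> rfl
  | mul a b ha hb => rw [wordDeg, ha, hb, add_zero]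

lemma mem_freeGr_zero (u : FreeNA 𝕂 (ChevGen I)) : u ∈ freeGr 𝕂 (ChevGen.deg fun _ => 0) 0 := by
  induction u using freeNA_induction with
  | h0 => exact zero_mem _
  | hadd x y hx hy => exact add_mem hx hy
  | hsmul c x hx => exact Submodule.smul_mem _ c hx
  | hmon m => exact Submodule.subset_span ⟨m, wordDeg_zero m, rfl⟩

variable [Fintype I] [DecidableEq I] (T : Triple 𝕂 I)

/-- The generators of the contragredient Lie superalgebra that are indexed by `I`. -/
lemma family : ChevFamily (fun k => Contragredient.e T.B nodeDeg (some k))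
    (fun k => Contragredient.f T.B nodeDeg (some k)) (fun k => Contragredient.h T.B nodeDeg (some k))
    (fun _ => 0) (T.B.submatrix some some) (fun _ => -ksgn 𝕂 (-0) 0) :=
  (Contragredient.chevFamily T.B nodeDeg).comp (Option.some_injective I)

/-- The homomorphism to the contragredient Lie superalgebra that maps the generators of the Kac-Moody
algebra to the generators indexed by `I`. -/
def psi : FreeNA 𝕂 (ChevGen I) →ₗ[𝕂] T.BKM :=
  MinSuper.mk (ChevGen.deg nodeDeg) (ChevGen.deg fun _ => 1) {r | ChevRel T.B r} ∘ₗ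
    freeIncl 𝕂 I

lemma psi_apply (u : FreeNA 𝕂 (ChevGen I)) : T.psi u = MinSuper.mk _ _ _ (freeIncl 𝕂 I u) := rfl

lemma psi_isHom : ChevFamily.IsHom T.psi (fun k => Contragredient.e T.B nodeDeg (some k))
    (fun k => Contragredient.f T.B nodeDeg (some k))
    (fun k => Contragredient.h T.B nodeDeg (some k)) where
  mul x y := by rw [psi_apply, freeIncl_mul, ← br_mk]; rfl
  e k := by rw [psi_apply, freeIncl_of]; rfl
  f k := by rw [psi_apply, freeIncl_of]; rfl
  h k := by rw [psi_apply, freeIncl_of]; rfl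

lemma superIdeal_le_ker_psi :
    superIdeal (ChevGen.deg fun _ => 0) {r | ChevRel (T.A.map (Int.cast : ℤ → 𝕂)) r} ≤
      LinearMap.ker T.psi := by
  have hgr (m : FreeMagma (ChevGen I)) : T.psi (mon 𝕂 m) ∈ T.comp 0 := by
    have := T.family.hom_mem_gr T.psi_isHom m
    rwa [wordDeg_zero] at this
  refine sInf_le ⟨⟨fun x n hn => ?_, fun n hn x => ?_⟩, fun a b => ?_, fun a b d => ?_, ?_⟩
  · rw [LinearMap.mem_ker] at hn ⊢
    rw [LinearMap.mul_apply', T.psi_isHom.mul, hn, map_zero]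
  · rw [LinearMap.mem_ker] at hn ⊢
    rw [LinearMap.mul_apply', T.psi_isHom.mul, hn, map_zero, LinearMap.zero_apply]
  · rw [LinearMap.mem_ker, map_add, map_smul, T.psi_isHom.mul, T.psi_isHom.mul, wordDeg_zero,
      wordDeg_zero, br_skew (hgr a) (hgr b), neg_add_cancel]
  · rw [LinearMap.mem_ker, map_sub, map_sub, map_smul]
    simp only [T.psi_isHom.mul, wordDeg_zero]
    rw [br_jacobi (hgr a) (hgr b) (hgr d)]
    simp
  · rintro _ (⟨i, j⟩ | ⟨i, j⟩ | ⟨i, j⟩)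
    · rw [SetLike.mem_coe, LinearMap.mem_ker, map_sub, map_smul, T.psi_isHom.mul, T.psi_isHom.h,
        T.psi_isHom.e, Contragredient.br_h_e]
      exact sub_self _
    · rw [SetLike.mem_coe, LinearMap.mem_ker, map_sub, map_smul, T.psi_isHom.mul, T.psi_isHom.h,
        T.psi_isHom.f, Contragredient.br_h_f]
      exact sub_self _
    · rw [SetLike.mem_coe, LinearMap.mem_ker, map_sub, map_smul, T.psi_isHom.mul, T.psi_isHom.h,
        T.psi_isHom.f, T.psi_isHom.e, Contragredient.br_e_f]
      simp

/-- The words in the `e k` for `k ∈ I`. -/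
abbrev Word (s : Multiset I) (x : T.BKM) : Prop :=
  BrWord br (fun k => Contragredient.e T.B nodeDeg (some k)) s x

lemma f0_word {s : Multiset I} {x : T.BKM} (hx : T.Word s x) :
    br (Contragredient.f T.B nodeDeg none) x = 0 := by
  induction hx with
  | gen k => rw [(Contragredient.chevFamily T.B nodeDeg).qp]; simp
  | cons k hx ih =>
    rw [br_jacobi (Contragredient.f_mem none) (T.family.memP k) (hx.mem_gr T.family.memP), ih,
      (Contragredient.chevFamily T.B nodeDeg).qp]
    simp

/-- The positive part of the Kac-Moody algebra maps to the contragredient Lie superalgebra.  In degree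
one, this holds since no relations are added there.  In higher degrees, the image of an element that
vanishes in the Kac-Moody algebra commutes with the `f i` for `i ∈ I`, by induction, and with `f 0`,
since it is a combination of words in the `e k` for `k ∈ I`. -/
lemma psi_eq_zero (n : ℕ) : ∀ u : FreeNA 𝕂 (ChevGen I),
    u ∈ freeGr 𝕂 (ChevGen.deg fun _ => 1) (n + 1 : ℤ) →
    (MinSuper.mk _ _ _ u : T.g) = 0 → T.psi u = 0 := by
  induction n with
  | zero =>
    intro u hu h
    have h1 := degProj_mem_superIdeal (k := 1) (d := ChevGen.deg fun _ => 1)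
      (fun r hr => Contragredient.chevRel_homogeneous (fun _ => 1) hr) (by simp)
      ((Submodule.Quotient.mk_eq_zero _).1 h)
    rw [degProj_of_mem hu, if_pos (by simp)] at h1
    exact T.superIdeal_le_ker_psi h1
  | succ n ih =>
    intro u hu h
    rw [psi_apply]
    refine Contragredient.mk_eq_zero_of_br_f (freeIncl_mem hu) (by lia) (freeIncl_mem (mem_freeGr_zero u)) ?_
    rintro (_ | i)
    · have h1 := T.family.hom_mem_span_word T.psi_isHom (d' := fun _ => 1) (by simp) (by lia) hu
      rw [psi_apply] at h1
      refine (Submodule.mem_bot 𝕂).1 (map_mem_of_mem_span ?_ h1)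
      rintro x ⟨t, ht, -⟩
      exact (Submodule.mem_bot 𝕂).2 (T.f0_word ht)
    · have h1 := ih (mon 𝕂 (.of (.f i)) * u) ?_ ?_
      · rwa [T.psi_isHom.mul, T.psi_isHom.f] at h1
      · have := mul_mem_freeGr (mon_mem_freeGr (𝕂 := 𝕂) (ChevGen.deg fun _ => 1) (.of (.f i))) hu
        simpa [wordDeg, ChevGen.deg] using this
      · rw [← br_mk, h, map_zero]

end Triple

/-! ### Pseudo-minuscule weights -/

namespace Triple

variable {𝕂 I : Type*} [Field 𝕂] [Fintype I] [DecidableEq I] (T : Triple 𝕂 I)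

lemma ε_mul_A (i j : I) : T.ε i * (T.A j i : 𝕂) = (T.A i j : 𝕂) * T.ε j := by
  have h := congrFun (congrFun T.isSymm i) j
  simp only [Matrix.transpose_apply, Matrix.diagonal_mul, Matrix.map_apply] at h
  have hi := T.ε_ne_zero i
  have hj := T.ε_ne_zero j
  field_simp at h
  linear_combination h

/-- On a weight in the root lattice, `weightForm μ` is the sum of the coefficients of the simple
roots, weighted by `μ k / ε k`. -/
lemma weightForm_root (μ : I → 𝕂) (a : I → 𝕂) :
    T.weightForm μ (fun i => ∑ k, a k * (T.A i k : 𝕂)) = ∑ k, μ k * (a k / T.ε k) := by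
  have hgram : T.gram = T.A.map (Int.cast : ℤ → 𝕂) * Matrix.diagonal T.ε := by
    ext i j
    simp [gram, ε_mul_A]
  have hunit : IsUnit T.gram := by
    rw [hgram]
    refine T.isUnit_A.mul ?_
    rw [Matrix.isUnit_diagonal, Pi.isUnit_iff]
    exact fun i => (T.ε_ne_zero i).isUnit
  have hmul : T.gram.mulVec (fun k => a k / T.ε k) = fun i => ∑ k, a k * (T.A i k : 𝕂) := by
    ext i
    simp only [Matrix.mulVec, dotProduct, gram, Matrix.of_apply, ε_mul_A]
    refine Finset.sum_congr rfl fun k _ => ?_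
    have := T.ε_ne_zero k
    field_simp
  rw [weightForm, ← hmul, Matrix.mulVec_mulVec,
    Matrix.nonsing_inv_mul _ ((Matrix.isUnit_iff_isUnit_det _).1 hunit), Matrix.one_mulVec]
  rfl

lemma B_some_none (i : I) : T.B (some i) none = -(T.lam i : 𝕂) := rfl

lemma B_none_some (j : I) : T.B none (some j) = -((T.lam j : 𝕂) / T.ε j) := rfl

lemma B_some_some (i j : I) : T.B (some i) (some j) = (T.A i j : 𝕂) := rfl

/-- The words in the generators `e k` of the Kac-Moody algebra. -/
abbrev GWord (s : Multiset I) (x : T.g) : Prop :=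
  BrWord br (fun k => Contragredient.e (T.A.map (Int.cast : ℤ → 𝕂)) (fun _ => 0) k) s x

lemma lam_div_ε {T : Triple 𝕂 I} (hlam : T.lamWeight = T.triUp T.lamWeight) (k : I) :
    (T.lam k : 𝕂) / T.ε k = T.lam k := (congrFun hlam k).symm

/-- The generators `e i`, for `i ∈ I`. -/
def e (i : I) : T.comp 0 := ⟨Contragredient.e T.B nodeDeg (some i), T.family.memP i⟩

/-- The words in which the labels `lam k` of the factors `e k` add up to `r`, as elements of
degree zero. -/
def lamWords (r : ℕ) : Set (T.comp 0) := {x | ∃ s, T.Word s x.1 ∧ (s.map T.lam).sum = r}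

lemma mem_span_lamWords {r : ℕ} {x : T.comp 0}
    (hx : x.1 ∈ Submodule.span 𝕂 {y : T.BKM | ∃ s, T.Word s y ∧ (s.map T.lam).sum = r}) :
    x ∈ Submodule.span 𝕂 (T.lamWords r) := by
  have hsub : {y : T.BKM | ∃ s, T.Word s y ∧ (s.map T.lam).sum = r} ⊆ T.comp 0 := by
    rintro y ⟨s, hs, -⟩
    have := hs.mem_gr T.family.memP
    rwa [Multiset.map_const', Multiset.sum_replicate, smul_zero] at this
  exact mem_span_subtype (N := T.comp 0) hsub hx

/-- The bracket of `f j` and a word without a factor `e j` vanishes. -/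
lemma lie_f_word_of_notMem {j : I} {s : Multiset I} {x : T.BKM} (hx : T.Word s x) (hj : j ∉ s) :
    br (Contragredient.f T.B nodeDeg (some j)) x = 0 := by
  refine (Submodule.mem_bot 𝕂).1 (Submodule.span_le.2 ?_ (T.family.br_Q_word j hx))
  rintro y (⟨t, -, rfl⟩ | ⟨rfl, -⟩)
  · exact absurd (Multiset.mem_cons_self _ _) hj
  · exact absurd (Multiset.mem_singleton_self _) hj

lemma e_mem_lamWords {T : Triple 𝕂 I} (k : I) : T.e k ∈ T.lamWords (T.lam k) := ⟨{k}, .gen k, by simp⟩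

section CharZero

variable [CharZero 𝕂]

/-- A nonzero word in the generators `e k` is a root vector. -/
lemma isPosRoot_of_word {s : Multiset I} {x : T.g} (hx : T.GWord s x) (h0 : x ≠ 0) :
    T.IsPosRoot fun i => ∑ k, (s.count k : 𝕂) * (T.A i k : 𝕂) := by
  refine ⟨⟨fun h => ?_, x, h0, fun i => ?_⟩, fun k => s.count k, fun i => rfl⟩
  · have h1 : (T.A.map (Int.cast : ℤ → 𝕂)).mulVec (fun k => (s.count k : 𝕂)) = 0 := by
      rw [← h]
      ext i
      simp [Matrix.mulVec, dotProduct, mul_comm]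
    have h2 := Matrix.mulVec_injective_of_isUnit T.isUnit_A (h1.trans (Matrix.mulVec_zero _).symm)
    have h3 : s = 0 := by
      ext k
      have := congrFun h2 k
      simpa using this
    have := hx.card_pos
    simp [h3] at this
  · have F := Contragredient.chevFamily (T.A.map (Int.cast : ℤ → 𝕂)) (fun _ => 0)
    rw [F.br_H_word i hx, sum_map_eq_sum_count]
    rfl

variable {T}

/-- If `lam` is pseudo-minuscule, then a nonzero word has at most one factor `e k` with
`lam k ≠ 0`. -/
lemma gword_lam_le_one (hpm : T.IsPseudoMinuscule (T.triUp T.lamWeight))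
    (hlam : T.lamWeight = T.triUp T.lamWeight) {s : Multiset I} {x : T.g} (hx : T.GWord s x)
    (h0 : x ≠ 0) : (s.map T.lam).sum ≤ 1 := by
  have h1 := hpm.2 _ (T.isPosRoot_of_word hx h0)
  have h2 : T.weightForm (T.triDown (T.triUp T.lamWeight))
      (fun i => ∑ k, (s.count k : 𝕂) * (T.A i k : 𝕂)) = (((s.map T.lam).sum : ℕ) : 𝕂) := by
    rw [weightForm_root]
    have h3 : (((s.map T.lam).sum : ℕ) : 𝕂) = (s.map fun k => (T.lam k : 𝕂)).sum := by
      rw [Nat.cast_multiset_sum, Multiset.map_map]; rfl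
    rw [h3, sum_map_eq_sum_count]
    refine Finset.sum_congr rfl fun k _ => ?_
    have h4 := lam_div_ε hlam k
    have h5 := T.ε_ne_zero k
    simp only [triDown, triUp, lamWeight]
    rw [h4, ← mul_div_assoc]
    rw [div_eq_iff h5]
    ring
  rw [h2] at h1
  obtain h | h := h1
  · rw [Nat.cast_eq_zero] at h; lia
  · rw [Nat.cast_eq_one] at h; lia

lemma lam_le_one (hpm : T.IsPseudoMinuscule (T.triUp T.lamWeight))
    (hlam : T.lamWeight = T.triUp T.lamWeight) (k : I) : T.lam k ≤ 1 := by
  have h0 : Contragredient.e (T.A.map (Int.cast : ℤ → 𝕂)) (fun _ => 0) k ≠ 0 := by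
    intro h
    have h1 := Contragredient.br_e_f (B := T.A.map (Int.cast : ℤ → 𝕂)) (c := fun _ => 0) k k
    rw [h, map_zero, LinearMap.zero_apply, if_pos rfl, one_smul] at h1
    have h2 := Contragredient.char_h (T.A.map (Int.cast : ℤ → 𝕂)) (fun _ => 0) k k
    rw [← h1, map_zero, if_pos rfl] at h2
    exact zero_ne_one h2
  have := gword_lam_le_one hpm hlam (x := Contragredient.e _ _ k) (.gen k) h0
  simpa using this

/-- The same as `gword_lam_le_one`, for words in the contragredient Lie superalgebra. -/
lemma word_eq_zero (hpm : T.IsPseudoMinuscule (T.triUp T.lamWeight))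
    (hlam : T.lamWeight = T.triUp T.lamWeight) {s : Multiset I} {x : T.BKM} (hx : T.Word s x)
    (hs : 2 ≤ (s.map T.lam).sum) : x = 0 := by
  have hP : (fun k => Contragredient.e T.B nodeDeg (some k)) =
      fun k => T.psi (mon 𝕂 (.of (.e k))) := by
    ext k; exact (T.psi_isHom.e k).symm
  rw [Word, hP] at hx
  obtain ⟨u, hu, rfl⟩ := hx.exists_lift (μ := LinearMap.mul 𝕂 _) T.psi_isHom.mul
  have hdeg := hu.mem_freeGr (d := ChevGen.deg fun _ => 1) (c := fun _ => 1)
    fun k => mon_mem_freeGr (ChevGen.deg fun _ => 1) (.of (.e k))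
  have hcard := hu.card_pos
  refine T.psi_eq_zero (s.card - 1) u ?_ ?_
  · have hn : (s.map fun _ => (1 : ℤ)).sum = ((s.card - 1 : ℕ) : ℤ) + 1 := by
      simp only [Multiset.map_const', Multiset.sum_replicate, nsmul_eq_mul, mul_one]
      lia
    rwa [hn] at hdeg
  · by_contra h0
    have hg : T.GWord s (MinSuper.mk _ _ _ u) :=
      hu.map (φ := MinSuper.mk (ChevGen.deg fun _ => 0) (ChevGen.deg fun _ => 1)
        {r | ChevRel (T.A.map (Int.cast : ℤ → 𝕂)) r}) fun x y => (br_mk x y).symm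
    have := gword_lam_le_one hpm hlam hg h0
    lia

variable (T)

/-- If `lam k = 0`, then `⁅e k, e 0⁆` commutes with all `f i`. -/
lemma lie_e0_of_lam_eq_zero {k : I} (hk : T.lam k = 0) : ⁅T.e k, T.e0⁆ = 0 := by
  have F := Contragredient.chevFamily T.B nodeDeg
  have hgr (c : Option I → ℤ) := mul_mem_freeGr
    (mon_mem_freeGr (𝕂 := 𝕂) (ChevGen.deg c) (.of (.e (some k))))
    (mon_mem_freeGr (𝕂 := 𝕂) (ChevGen.deg c) (.of (.e none)))
  refine Subtype.ext (Contragredient.mk_eq_zero_of_br_f (B := T.B) (c := nodeDeg)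
    (hgr fun _ => 1) le_rfl (hgr nodeDeg) fun i => ?_)
  change br _ (br (Contragredient.e T.B nodeDeg (some k)) (Contragredient.e T.B nodeDeg none)) = 0
  rw [br_jacobi (F.memQ i) (F.memP _) (F.memP _), F.qp, F.qp, map_smul, map_smul, F.ph,
    LinearMap.smul_apply, F.hP]
  cases i with
  | none => simp [B_none_some, hk]
  | some i =>
    by_cases hik : i = k
    · subst hik; simp [B_some_none, hk]
    · simp [hik]

lemma word_e0 {s : Multiset I} {x : T.BKM} (hx : T.Word s x) (hs : (s.map T.lam).sum = 0) :
    br x T.e0.1 = 0 := by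
  induction hx with
  | gen k =>
    exact congrArg Subtype.val (T.lie_e0_of_lam_eq_zero (k := k) (by simpa using hs))
  | @cons k s x hx ih =>
    rw [Multiset.map_cons, Multiset.sum_cons, Nat.add_eq_zero_iff] at hs
    have hk : br (Contragredient.e T.B nodeDeg (some k)) T.e0.1 = 0 :=
      congrArg Subtype.val (T.lie_e0_of_lam_eq_zero hs.1)
    have hjac := br_jacobi (T.family.memP k) (hx.mem_gr T.family.memP) T.e0.2
    rw [eq_sub_of_add_eq hjac.symm, hk, ih hs.2]
    simp

lemma word_f0 {s : Multiset I} {x : T.comp 0} (hx : T.Word s x.1) : ⁅x, T.f0⁆ = 0 := by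
  ext
  change br x.1 (Contragredient.f T.B nodeDeg none) = 0
  rw [br_skew x.2 (Contragredient.f_mem none), T.f0_word hx]
  simp

/-- The bracket of `f j` and a word that contains `e j` as the only factor `e k` with `lam k ≠ 0`. -/
lemma lie_f_word {j : I} (hj : T.lam j = 1) {x : T.comp 0} (hx : x ∈ T.lamWords 1)
    (hxe : x ≠ T.e j) : ⁅T.f j, x⁆ ∈ Submodule.span 𝕂 (T.lamWords 0) := by
  obtain ⟨s, hs, hs1⟩ := hx
  refine T.mem_span_lamWords (Submodule.span_mono ?_ (T.family.br_Q_word j hs))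
  rintro y (⟨t, ht, rfl⟩ | ⟨rfl, -⟩)
  · refine ⟨t, ht, ?_⟩
    rw [Multiset.map_cons, Multiset.sum_cons, hj] at hs1
    lia
  · exact absurd (Subtype.ext (hs.eq_of_singleton rfl)) hxe

lemma lie_f_f_word {j : I} (hj : T.lam j = 1) {x : T.comp 0} (hx : x ∈ T.lamWords 1)
    (hxe : x ≠ T.e j) : ⁅T.f j, ⁅T.f j, x⁆⁆ = 0 := by
  have h := T.lie_f_word hj hx hxe
  generalize ⁅T.f j, x⁆ = y at h ⊢
  induction h using Submodule.span_induction with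
  | mem y hy =>
    obtain ⟨s, hs, hs0⟩ := hy
    ext
    refine T.lie_f_word_of_notMem hs fun hjs => ?_
    obtain ⟨t, rfl⟩ := Multiset.exists_cons_of_mem hjs
    rw [Multiset.map_cons, Multiset.sum_cons, hj] at hs0
    lia
  | zero => simp
  | add a b _ _ ha hb => rw [lie_add, ha, hb, add_zero]
  | smul c a _ ha => rw [lie_smul, ha, smul_zero]

lemma lie_mem_span_lamWords {q r : ℕ} {x y : T.comp 0} (hx : x ∈ T.lamWords q)
    (hy : y ∈ T.lamWords r) : ⁅x, y⁆ ∈ Submodule.span 𝕂 (T.lamWords (q + r)) := by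
  obtain ⟨s, hs, rfl⟩ := hx
  obtain ⟨t, ht, rfl⟩ := hy
  refine T.mem_span_lamWords (Submodule.span_mono ?_ (hs.br_mem_span T.family.memP ht))
  exact fun z hz => ⟨s + t, hz, by rw [Multiset.map_add, Multiset.sum_add]⟩

variable {T}

lemma lie_eq_zero (hpm : T.IsPseudoMinuscule (T.triUp T.lamWeight))
    (hlam : T.lamWeight = T.triUp T.lamWeight) {x y : T.comp 0} (hx : x ∈ T.lamWords 1)
    (hy : y ∈ T.lamWords 1) : ⁅x, y⁆ = 0 := by
  refine (Submodule.mem_bot 𝕂).1 (Submodule.span_le.2 ?_ (T.lie_mem_span_lamWords hx hy))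
  rintro z ⟨s, hs, hs2⟩
  exact Subtype.ext (word_eq_zero hpm hlam hs hs2.ge)

/-- For a word `x ≠ e j` with exactly one factor `e k` with `lam k ≠ 0`, the bracket `⁅f j, x⁆` has
degree zero in the grading by the number of such factors, and it vanishes unless the `h j`-weight `b`
of `x` is equal to one. -/
lemma lie_f_word_properties (hpm : T.IsPseudoMinuscule (T.triUp T.lamWeight))
    (hlam : T.lamWeight = T.triUp T.lamWeight) {j : I} (hj : T.lam j = 1) {x : T.comp 0}
    (hx : x ∈ T.lamWords 1) (hxe : x ≠ T.e j) :
    ⁅⁅T.f j, x⁆, T.e0⁆ = 0 ∧ ⁅⁅T.f j, x⁆, T.f0⁆ = 0 ∧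
    (∀ x' ∈ T.lamWords 1, ⁅x', ⁅T.f j, x⁆⁆ ∈ Submodule.span 𝕂 (T.lamWords 1)) ∧
    ∃ b : 𝕂, ⁅T.h (some j), x⁆ = b • x ∧ b • ⁅T.f j, x⁆ = ⁅T.f j, x⁆ := by
  have hY := T.lie_f_word hj hx hxe
  refine ⟨?_, ?_, fun x' hx' => ?_, ?_⟩
  · generalize ⁅T.f j, x⁆ = y at hY ⊢
    induction hY using Submodule.span_induction with
    | mem y hy => obtain ⟨s, hs, hs0⟩ := hy; ext; exact T.word_e0 hs hs0
    | zero => simp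
    | add a b _ _ ha hb => rw [add_lie, ha, hb, add_zero]
    | smul c a _ ha => rw [smul_lie, ha, smul_zero]
  · generalize ⁅T.f j, x⁆ = y at hY ⊢
    induction hY using Submodule.span_induction with
    | mem y hy => obtain ⟨s, hs, -⟩ := hy; exact T.word_f0 hs
    | zero => simp
    | add a b _ _ ha hb => rw [add_lie, ha, hb, add_zero]
    | smul c a _ ha => rw [smul_lie, ha, smul_zero]
  · generalize ⁅T.f j, x⁆ = y at hY ⊢
    induction hY using Submodule.span_induction with
    | mem y hy =>
      have h := T.lie_mem_span_lamWords hx' hy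
      rwa [add_zero] at h
    | zero => simp
    | add a b _ _ ha hb => rw [lie_add]; exact add_mem ha hb
    | smul c a _ ha => rw [lie_smul]; exact Submodule.smul_mem _ c ha
  · obtain ⟨s, hs, -⟩ := id hx
    set b := (s.map (T.B.submatrix some some j)).sum
    have hb : ⁅T.h (some j), x⁆ = b • x := by ext; exact T.family.br_H_word j hs
    refine ⟨b, hb, ?_⟩
    have hex : ⁅T.e j, x⁆ = 0 :=
      lie_eq_zero hpm hlam (by rw [← hj]; exact e_mem_lamWords j) hx
    have hef : ⁅T.e j, T.f j⁆ = T.h (some j) := by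
      ext
      refine (Contragredient.br_e_f (some j) (some j)).trans ?_
      rw [if_pos rfl, one_smul]; rfl
    have hhf : ⁅T.h (some j), T.f j⁆ = -(2 : 𝕂) • T.f j := by
      ext
      refine (Contragredient.br_h_f (some j) (some j)).trans ?_
      rw [B_some_some, T.A_diag, Int.cast_ofNat]
      rfl
    -- Since `⁅e j, x⁆ = 0`, applying `e j` to `⁅f j, ⁅f j, x⁆⁆ = 0` gives `2 (b - 1) ⁅f j, x⁆ = 0`.
    have h1 : ⁅T.e j, ⁅T.f j, x⁆⁆ = b • x := by rw [leibniz_lie, hef, hb, hex, lie_zero, add_zero]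
    have h2 : ⁅T.h (some j), ⁅T.f j, x⁆⁆ = (b - 2) • ⁅T.f j, x⁆ := by
      rw [leibniz_lie, hhf, hb, smul_lie, lie_smul, ← add_smul]; congr 1; ring
    have h3 : ⁅T.e j, ⁅T.f j, ⁅T.f j, x⁆⁆⁆ = (2 : 𝕂) • (b • ⁅T.f j, x⁆ - ⁅T.f j, x⁆) := by
      rw [leibniz_lie, hef, h1, h2, lie_smul, sub_smul, smul_sub, two_smul, two_smul]; abel
    rw [T.lie_f_f_word hj hx hxe, lie_zero] at h3
    exact sub_eq_zero.1 ((smul_eq_zero.1 h3.symm).resolve_left two_ne_zero)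

variable (T) in
/-- The component of degree one is generated by `e 0` under the `e k` for `k ∈ I`. -/
lemma span_raised {E : Set (T.comp 0)} (hE : ∀ k, T.e k ∈ E) :
    Submodule.span 𝕂 {y | ContragredientLocal.Raised E {T.e0} y} = ⊤ := by
  set S : Set T.BKM := {y | ∃ z : T.comp 1, ContragredientLocal.Raised E {T.e0} z ∧ z.1 = y}
    with hS
  have F := Contragredient.chevFamily T.B nodeDeg
  have hnn (s : Multiset (Option I)) : 0 ≤ (s.map nodeDeg).sum := Multiset.sum_nonneg (by
    simp only [Multiset.mem_map]
    rintro _ ⟨k, -, rfl⟩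
    cases k <;> simp [nodeDeg])
  have he (k : I) : ∀ y ∈ Submodule.span 𝕂 S,
      br (Contragredient.e T.B nodeDeg (some k)) y ∈ Submodule.span 𝕂 S := by
    refine fun y hy => map_mem_of_mem_span ?_ hy
    rintro _ ⟨z, hz, rfl⟩
    exact Submodule.subset_span ⟨⁅T.e k, z⁆, .lie (hE k) hz, rfl⟩
  have h0 {s : Multiset (Option I)} {x : T.BKM}
      (hx : BrWord br (Contragredient.e T.B nodeDeg) s x) :
      (s.map nodeDeg).sum = 0 → ∀ y ∈ Submodule.span 𝕂 S, br x y ∈ Submodule.span 𝕂 S := by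
    induction hx with
    | gen k =>
      cases k with
      | none => intro h; simp [nodeDeg] at h
      | some k => exact fun _ => he k
    | @cons k s x hx ih =>
      have hs := hnn s
      cases k with
      | none => intro h; simp [nodeDeg] at h; lia
      | some k =>
        intro h y hy
        have h' : (s.map nodeDeg).sum = 0 := by simpa [nodeDeg] using h
        refine map_mem_of_mem_span ?_ hy
        intro y hy
        have hy' := Submodule.subset_span (R := 𝕂) hy
        obtain ⟨z, -, rfl⟩ := hy
        have hjac := br_jacobi (F.memP (some k)) (hx.mem_gr F.memP) z.2
        rw [eq_sub_of_add_eq hjac.symm]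
        exact sub_mem (he k _ (ih h' _ hy')) (Submodule.smul_mem _ _ (ih h' _ (he k _ hy')))
  have hbase : T.e0.1 ∈ Submodule.span 𝕂 S := Submodule.subset_span ⟨T.e0, .base rfl, rfl⟩
  have h1 {s : Multiset (Option I)} {x : T.BKM}
      (hx : BrWord br (Contragredient.e T.B nodeDeg) s x) :
      (s.map nodeDeg).sum = 1 → x ∈ Submodule.span 𝕂 S := by
    induction hx with
    | gen k =>
      cases k with
      | none => exact fun _ => hbase
      | some k => intro h; simp [nodeDeg] at h
    | @cons k s x hx ih =>
      cases k with
      | none =>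
        intro h
        have h' : (s.map nodeDeg).sum = 0 := by simpa [nodeDeg] using h
        rw [br_skew (F.memP none) (hx.mem_gr F.memP)]
        exact neg_mem (Submodule.smul_mem _ _ (h0 hx h' _ hbase))
      | some k =>
        intro h
        exact he k _ (ih (by simpa [nodeDeg] using h))
  have hφ : ChevFamily.IsHom (MinSuper.mk (ChevGen.deg nodeDeg) (ChevGen.deg fun _ => 1)
      {r | ChevRel T.B r}) (Contragredient.e T.B nodeDeg) (Contragredient.f T.B nodeDeg)
      (Contragredient.h T.B nodeDeg) := ⟨fun _ _ => rfl, fun _ => rfl, fun _ => rfl, fun _ => rfl⟩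
  rw [eq_top_iff]
  rintro ⟨y, hy⟩ -
  have hyS : y ∈ Submodule.span 𝕂 S := by
    obtain ⟨u, hu, rfl⟩ := hy
    refine Submodule.span_le.2 ?_ (F.hom_mem_span_word hφ (d' := nodeDeg)
      (by rintro (_ | _) <;> simp [nodeDeg]) one_pos hu)
    rintro x ⟨t, ht, ht1⟩
    exact h1 ht ht1
  refine Submodule.span_mono ?_ (mem_span_subtype (N := T.comp 1) (S := S) ?_ hyS)
  · rintro z ⟨w, hw, hwz⟩
    rwa [← Subtype.ext hwz]
  · rintro _ ⟨z, -, rfl⟩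
    exact z.2

/-- The relations from which the vanishing of `f₀ f j - ⟦f₀, f j⟧ h j` follows. -/
lemma localPart_abelian (hpm : T.IsPseudoMinuscule (T.triUp T.lamWeight))
    (hlam : T.lamWeight = T.triUp T.lamWeight) {j : I} (hj : T.lam j = 1) :
    T.localPart.Abelian T.e0 T.f0 (T.h none) (T.e j) (T.f j) (T.h (some j))
      (T.e '' {k | T.lam k = 0}) (T.lamWords 1) where
  brk_f₀_e₀ := by
    ext
    refine ((Contragredient.chevFamily T.B nodeDeg).qp none none).trans ?_
    simp [ksgn, nodeDeg, h]
  form_f₀_e₀ := T.exists_pairing.choose_spec.2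
  f_e₀ := by
    ext
    exact ((Contragredient.chevFamily T.B nodeDeg).qp (some j) none).trans (by simp)
  h_e₀ := by
    ext
    exact (Contragredient.br_h_e (some j) none).trans
      (by rw [B_some_none, hj, Nat.cast_one, neg_one_smul]; rfl)
  h_f₀ := by
    ext
    exact (Contragredient.br_h_f (some j) none).trans
      (by rw [B_some_none, hj, Nat.cast_one, neg_neg, one_smul]; rfl)
  h₀_f := by
    ext
    refine (Contragredient.br_h_f none (some j)).trans ?_
    rw [B_none_some, lam_div_ε hlam, hj, Nat.cast_one, neg_neg, one_smul]; rfl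
  e_f := by
    ext
    refine (Contragredient.br_e_f (some j) (some j)).trans ?_
    rw [if_pos rfl, one_smul]; rfl
  h_e := by
    ext
    refine (Contragredient.br_h_e (some j) (some j)).trans ?_
    rw [B_some_some, T.A_diag, Int.cast_ofNat]; rfl
  e_mem := by rw [← hj]; exact e_mem_lamWords j
  x_f₀ := by rintro x ⟨s, hs, -⟩; exact T.word_f0 hs
  h₀_x := by
    rintro x ⟨s, hs, hs1⟩
    ext
    refine (hs.br_weight T.family.memP (Contragredient.h_mem none)
      fun k => Contragredient.br_h_e none (some k)).trans ?_
    have hsum : (s.map fun k => T.B none (some k)).sum = -(((s.map T.lam).sum : ℕ) : 𝕂) := by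
      rw [Nat.cast_multiset_sum, Multiset.map_map, ← Multiset.sum_map_neg']
      simp [B_none_some, lam_div_ε hlam]
    rw [hsum, hs1]
    simp
  x_x x hx x' hx' := lie_eq_zero hpm hlam hx hx'
  E_e₀ := by rintro _ ⟨k, hk, rfl⟩; exact T.lie_e0_of_lam_eq_zero hk
  E_f₀ := by rintro _ ⟨k, -, rfl⟩; exact T.word_f0 (.gen k)
  E_x := by
    rintro _ ⟨k, hk, rfl⟩ x hx
    have hk' : T.lam k = 0 := hk
    have := T.lie_mem_span_lamWords (e_mem_lamWords k) hx
    rwa [hk', zero_add] at this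
  f_x x hx hxe := lie_f_word_properties hpm hlam hj hx hxe

end CharZero

end Triple

end Cartanif

end

theorem proposition3p3 {𝕂 I : Type*} [Field 𝕂] [IsAlgClosed 𝕂] [CharZero 𝕂]
    [Fintype I] [DecidableEq I] (T : Cartanif.Triple 𝕂 I)
    (hpm : T.IsPseudoMinuscule (T.triUp T.lamWeight))
    (hlam : T.lamWeight = T.triUp T.lamWeight)
    (j : I) (hj : T.lam j ≠ 0) :
    T.mulW T.f0 (T.f j) - T.mulW (Cartanif.MinSuper.brZero T.f0 (T.f j)) (T.h (some j)) = 0 := by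
  have hle := Cartanif.Triple.lam_le_one hpm hlam
  have hj1 : T.lam j = 1 := by have := hle j; lia
  have H := Cartanif.Triple.localPart_abelian hpm hlam hj1
  have hbr : Cartanif.MinSuper.brZero T.f0 (T.f j) = -⁅T.f j, T.f0⁆ := by
    ext
    refine (Cartanif.MinSuper.br_skew T.f0.2 (T.f j).2).trans ?_
    rw [Cartanif.Contragredient.ksgn_comm, Cartanif.MinSuper.ksgn_zero_left, one_smul]
    rfl
  refine sub_eq_zero.2 (T.localPart.prod_eq_prod ?_)
  rw [hbr, TensorProduct.neg_tmul, sub_neg_eq_add]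
  refine H.contract_tensorElt_eq_zero (T.span_raised fun k => ?_)
  obtain hk | hk := Nat.le_one_iff_eq_zero_or_eq_one.1 (hle k)
  · exact Or.inl ⟨k, hk, rfl⟩
  · exact Or.inr (by rw [← hk]; exact Cartanif.Triple.e_mem_lamWords k)
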